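/- **Theorem (Variance and gradients of multi-step LQG).** *Setting.* Let $T\in\mathbb N$ and consider $s_{t+1}=As_t+Ba_t$ with $s_t\in\mathbb R^n$, $a_t\in\mathbb R^m$, reward $r(s,a)=-(s^\top Q_s s+a^\top Q_a a)$ with $Q_s,Q_a\succeq 0$, discount factor $\gamma>0$, $s_0\sim\mathcal N(0,\Sigma_0)$ with $\Sigma_0\succeq0$, and policy $\pi(\cdot\mid s)=\mathcal N(Ks,\Sigma)$, where $\Sigma=\mathrm{diag}(e^{2\ell})$, $K\in\mathbb R^{m\times n}$, $\ell\in\mathbb R^m$. Thus $a_t=Ks_t+\varepsilon_t$, where $s_0$ and the $\varepsilon_t\sim\mathcal N(0,\Sigma)$ are independent. Let $R(\tau)=\sum_{t=0}^{T-1}\gamma^t r(s_{t+1},a_t)$, $J(K,\ell)=\mathbb E[R(\tau)]$, and $$\widehat G_K=\Big(\sum_{t<T}\nabla_K\log\pi(a_t\mid s_t)\Big)R(\tau),\qquad \widehat G_\ell=\Big(\sum_{t<T}\nabla_\ell\log\pi(a_t\mid s_t)\Big)R(\tau),$$ with matrix gradients taken for the Frobenius inner product. Put $F=A+BK$. *Lifted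 notation.* Stack $\bar s=(s_0,\dots,s_{T-1})$, $\bar s^+=(s_1,\dots,s_T)$, $\bar a=(a_0,\dots,a_{T-1})$, $\bar\varepsilon=(\varepsilon_0,\dots,\varepsilon_{T-1})$. With block indices $t,k\in\{0,\dots,T-1\}$, let $[\mathcal F_S]_t=F^t$, $[\mathcal F_S^+]_t=F^{t+1}$, $[\mathcal K_S]_t=KF^t$; $[\mathcal F_E]_{t,k}=F^{t-1-k}B$ if $k<t$ and $0$ otherwise; $[\mathcal F_E^+]_{t,k}=F^{t-k}B$ if $k\le t$ and $0$ otherwise; $[\mathcal K_E]_{t,k}=KF^{t-1-k}B$ if $k<t$, $I_m$ if $k=t$ and $0$ if $k>t$. Let $D_\gamma=\mathrm{diag}(\gamma^0,\dots,\gamma^{T-1})$, $\mathsf Q_s=D_\gamma\otimes Q_s$, $\mathsf Q_a=D_\gamma\otimes Q_a$, $\overline\Sigma=I_T\otimes\Sigma$ and $$M_{ss}=\mathcal F_S^{+\top}\mathsf Q_s\mathcal F_S^++\mathcal K_S^\top\mathsf Q_a\mathcal K_S,\quad M_{se}=\mathcal F_S^{+\top}\mathsf Q_s\mathcal F_E^++\mathcal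 K_S^\top\mathsf Q_a\mathcal K_E,\quad M_{ee}=\mathcal F_E^{+\top}\mathsf Q_s\mathcal F_E^++\mathcal K_E^\top\mathsf Q_a\mathcal K_E .$$ Let $\mathrm{sym}(X)=\frac12(X+X^\top)$ and $\mathrm{IS}_\Omega(A_1,\dots,A_k)=\mathbb E\big[\prod_i x^\top A_ix\big]$ for $x\sim\mathcal N(0,\Omega)$. Let $\Pi_t,S_t$ be the block selectors with $\varepsilon_t=\Pi_t\bar\varepsilon$, $s_t=S_t\bar s$; put $F_t=S_t\mathcal F_S$, $E_t=S_t\mathcal F_E$. For fixed $t,p$ write $$W=\mathrm{sym}(\Pi_t^\top\Sigma^{-2}\Pi_p),\quad G=\mathrm{sym}(F_t^\top F_p),\quad U=\mathrm{sym}(E_t^\top E_p),\quad N=F_t^\top E_p+F_p^\top E_t,$$ $X=\mathrm{sym}(M_{ss})$, $Z=\mathrm{sym}(M_{ee})$, $\alpha=\mathrm{tr}(\overline\Sigma W)$, $\beta=\mathrm{tr}(\overline\Sigma U)$, $\delta=\mathrm{tr}(\overline\Sigma W\overline\Sigma U)$, $\mu=\mathrm{tr}(\overline\Sigma Z)$,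 $\kappa=\mathrm{tr}(\overline\Sigma W\overline\Sigma Z)$, $V_0=M_{se}\overline\Sigma M_{se}^\top$, $V=M_{se}\overline\Sigma W\overline\Sigma M_{se}^\top$, $\widetilde V=M_{se}\overline\Sigma U\overline\Sigma M_{se}^\top$, $\widehat V=M_{se}\overline\Sigma W\overline\Sigma U\overline\Sigma M_{se}^\top$, and $V^{(j)}=\mathrm{sym}(M_{se}A^{(j)}N^\top)$ with $A^{(0)}=\overline\Sigma$, $A^{(1)}=\overline\Sigma W\overline\Sigma$, $A^{(2)}=\overline\Sigma Z\overline\Sigma$, $A^{(3)}=\mathrm{sym}(\overline\Sigma W\overline\Sigma Z\overline\Sigma)$. Finally $d_i=(\Sigma^{-1})_{ii}$, $Q_{t,i}=\Pi_t^\top e_ie_i^\top\Pi_t$, $W^\ell_t=\Pi_t^\top\Sigma^{-1}\Pi_t$, $V_{tp,i}=\mathrm{sym}(M_{se}\overline\Sigma Q_{t,i}\overline\Sigma Q_{p,i}\overline\Sigma M_{se}^\top)$. *Claims.* **(0) Lifted representation.** For every realization, $\bar s=\mathcal F_Ss_0+\mathcal F_E\bar\varepsilon$, $\bar s^+=\mathcal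 F_S^+s_0+\mathcal F_E^+\bar\varepsilon$, $\bar a=\mathcal K_Ss_0+\mathcal K_E\bar\varepsilon$, and $R(\tau)=-(x+2y+z)$ with $x=s_0^\top M_{ss}s_0$, $y=s_0^\top M_{se}\bar\varepsilon$, $z=\bar\varepsilon^\top M_{ee}\bar\varepsilon$. **(i) Second moments.** $\|\widehat G_K\|_F^2$ and $\|\widehat G_\ell\|_2^2$ are integrable, and $$\mathbb E\|\widehat G_K\|_F^2=\sum_{t,p=0}^{T-1}\sum_{i=1}^6E^K_{i,tp},\qquad \mathbb E\|\widehat G_\ell\|_2^2=\sum_{t,p=0}^{T-1}\sum_{i=1}^4E^\ell_{i,tp},$$ where $$\begin{aligned} E^K_{1,tp}&=\mathrm{IS}_{\Sigma_0}(G,X,X)\,\mathrm{IS}_{\overline\Sigma}(W)+\mathrm{IS}_{\Sigma_0}(X,X)\,\mathrm{IS}_{\overline\Sigma}(W,U),\\ E^K_{2,tp}&=\mathrm{IS}_{\Sigma_0}(G)\,\mathrm{IS}_{\overline\Sigma}(W,Z,Z)+\mathrm{IS}_{\overline\Sigma}(W,U,Z,Z),\\ E^K_{3,tp}&=2\,\mathrm{IS}_{\Sigma_0}(G,X)\,\mathrm{IS}_{\overline\Sigma}(W,Z)+2\,\mathrm{IS}_{\Sigma_0}(X)\,\mathrm{IS}_{\overline\Sigma}(W,U,Z),\\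 E^K_{4,tp}&=4\big(\alpha\,\mathrm{IS}_{\Sigma_0}(G,V_0)+2\,\mathrm{IS}_{\Sigma_0}(G,V)+(\alpha\beta+2\delta)\,\mathrm{IS}_{\Sigma_0}(V_0)+2\beta\,\mathrm{IS}_{\Sigma_0}(V)+2\alpha\,\mathrm{IS}_{\Sigma_0}(\widetilde V)+8\,\mathrm{IS}_{\Sigma_0}(\mathrm{sym}(\widehat V))\big),\\ E^K_{5,tp}&=4\big(\alpha\,\mathrm{IS}_{\Sigma_0}(X,V^{(0)})+2\,\mathrm{IS}_{\Sigma_0}(X,V^{(1)})\big),\\ E^K_{6,tp}&=4\big((\alpha\mu+2\kappa)\,\mathrm{IS}_{\Sigma_0}(V^{(0)})+2\mu\,\mathrm{IS}_{\Sigma_0}(V^{(1)})+2\alpha\,\mathrm{IS}_{\Sigma_0}(V^{(2)})+8\,\mathrm{IS}_{\Sigma_0}(V^{(3)})\big),\\ E^\ell_{1,tp}&=2m\,\mathbf 1_{t=p}\,\mathrm{IS}_{\Sigma_0}(X,X),\\ E^\ell_{2,tp}&=\textstyle\sum_{i=1}^m d_i^2\,\mathrm{IS}_{\overline\Sigma}(Q_{t,i},Q_{p,i},Z,Z)-\mathrm{IS}_{\overline\Sigma}(W^\ell_t,Z,Z)-\mathrm{IS}_{\overline\Sigma}(W^\ell_p,Z,Z)+m\,\mathrm{IS}_{\overline\Sigma}(Z,Z),\\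 E^\ell_{3,tp}&=2\,\mathrm{IS}_{\Sigma_0}(X)\Big[\textstyle\sum_{i=1}^m d_i^2\,\mathrm{IS}_{\overline\Sigma}(Q_{t,i},Q_{p,i},Z)-\mathrm{IS}_{\overline\Sigma}(W^\ell_t,Z)-\mathrm{IS}_{\overline\Sigma}(W^\ell_p,Z)+m\,\mathrm{IS}_{\overline\Sigma}(Z)\Big],\\ E^\ell_{4,tp}&=8m\,\mathbf 1_{t=p}\,\mathrm{IS}_{\Sigma_0}(V_0)+32\textstyle\sum_{i=1}^m d_i^2\,\mathrm{IS}_{\Sigma_0}(V_{tp,i}). \end{aligned}$$ **(ii) Mean gradients.** The covariances $P_t=\mathrm{Cov}(s_t)$ satisfy $P_0=\Sigma_0$ and $P_{t+1}=FP_tF^\top+B\Sigma B^\top$ for $0\le t<T$. Let $\Lambda_T=\frac1\gamma Q_s$ and $\Lambda_t=\frac1\gamma Q_s+K^\top Q_aK+\gamma F^\top\Lambda_{t+1}F$ for $1\le t<T$. Then $R(\tau)$, $\widehat G_K$, $\widehat G_\ell$ are integrable, $J$ is differentiable in $K$ and in $\ell$, and $$\nabla_KJ=\mathbb E[\widehat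 G_K]=-2\sum_{t=0}^{T-1}\gamma^t\big(Q_aKP_t+\gamma B^\top\Lambda_{t+1}FP_t\big),$$ $$\nabla_\ell J=\mathbb E[\widehat G_\ell]=-2\,\mathrm{diag}\Big(\Sigma\sum_{t=0}^{T-1}\gamma^t\big(Q_a+\gamma B^\top\Lambda_{t+1}B\big)\Big),$$ where $\mathrm{diag}(\cdot)$ is the vector of diagonal entries. -/

import Mathlib

open MeasureTheory ProbabilityTheory Matrix
open scoped Kronecker

/-- The symmetric part of a square matrix. -/
noncomputable def symPart {ι : Type*} (M : Matrix ι ι ℝ) : Matrix ι ι ℝ :=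
  (1 / 2 : ℝ) • (M + Mᵀ)

/-- The Gaussian moment `IS_Ω(A₁, …, A_k) = E[∏ᵢ xᵀ Aᵢ x]` with `x ∼ N(0, Ω)`. -/
noncomputable def gaussIS {ι : Type*} [Fintype ι] [DecidableEq ι] (Ω : Matrix ι ι ℝ)
    (As : List (Matrix ι ι ℝ)) : ℝ :=
  ∫ x, (As.map fun A => x.ofLp ⬝ᵥ (A *ᵥ x.ofLp)).prod ∂(multivariateGaussian 0 Ω)

/-! ### Matrices as Euclidean vectors (Frobenius inner product) -/

/-- The matrix with the given vector of entries. -/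
def toMat {m n : ℕ} (k : EuclideanSpace ℝ (Fin m × Fin n)) : Matrix (Fin m) (Fin n) ℝ :=
  Matrix.of fun i j => k (i, j)

/-- The vector of entries of a matrix. -/
def toEuc {m n : ℕ} (K : Matrix (Fin m) (Fin n) ℝ) : EuclideanSpace ℝ (Fin m × Fin n) :=
  WithLp.toLp 2 fun q => K q.1 q.2

/-- The gradient of a function of a matrix, for the Frobenius inner product. -/
noncomputable def matGradient {m n : ℕ} (f : Matrix (Fin m) (Fin n) ℝ → ℝ)
    (K : Matrix (Fin m) (Fin n) ℝ) : Matrix (Fin m) (Fin n) ℝ :=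
  toMat (gradient (fun k => f (toMat k)) (toEuc K))

/-- `f` is differentiable at `K` with gradient `G`, for the Frobenius inner product. -/
def HasMatGradientAt {m n : ℕ} (f : Matrix (Fin m) (Fin n) ℝ → ℝ)
    (G K : Matrix (Fin m) (Fin n) ℝ) : Prop :=
  HasGradientAt (fun k => f (toMat k)) (toEuc G) (toEuc K)

/-- The squared Frobenius norm. -/
def frobSq {m n : ℕ} (G : Matrix (Fin m) (Fin n) ℝ) : ℝ := ∑ i, ∑ j, G i j ^ 2

/-! ### The linear Gaussian policy -/

/-- `Σ = diag(σ)²` with `σ = exp ℓ`. -/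
noncomputable def policyCov {m : ℕ} (ℓ : EuclideanSpace ℝ (Fin m)) : Matrix (Fin m) (Fin m) ℝ :=
  Matrix.diagonal fun i => Real.exp (2 * ℓ i)

/-- The density at `a` of the policy `π(· ∣ s) = N(K s, Σ)`. -/
noncomputable def policyDensity {n m : ℕ} (K : Matrix (Fin m) (Fin n) ℝ)
    (ℓ : EuclideanSpace ℝ (Fin m)) (s : Fin n → ℝ) (a : Fin m → ℝ) : ℝ :=
  (Real.sqrt ((2 * Real.pi) ^ m * (policyCov ℓ).det))⁻¹ *
    Real.exp (-(1 / 2) * ((a - K *ᵥ s) ⬝ᵥ ((policyCov ℓ)⁻¹ *ᵥ (a - K *ᵥ s))))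

/-- The score `∇_K log π(a ∣ s)`. -/
noncomputable def scoreK {n m : ℕ} (K : Matrix (Fin m) (Fin n) ℝ)
    (ℓ : EuclideanSpace ℝ (Fin m)) (s : Fin n → ℝ) (a : Fin m → ℝ) : Matrix (Fin m) (Fin n) ℝ :=
  matGradient (fun K' => Real.log (policyDensity K' ℓ s a)) K

/-- The score `∇_ℓ log π(a ∣ s)`. -/
noncomputable def scoreL {n m : ℕ} (K : Matrix (Fin m) (Fin n) ℝ)
    (ℓ : EuclideanSpace ℝ (Fin m)) (s : Fin n → ℝ) (a : Fin m → ℝ) : EuclideanSpace ℝ (Fin m) :=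
  gradient (fun ℓ' => Real.log (policyDensity K ℓ' s a)) ℓ

/-! ### The control problem -/

/-- The data of a linear-quadratic-Gaussian problem: dynamics `s' = A s + B a`, reward weights,
initial-state covariance and discount factor. -/
structure LQG (n m : ℕ) where
  A : Matrix (Fin n) (Fin n) ℝ
  B : Matrix (Fin n) (Fin m) ℝ
  Qs : Matrix (Fin n) (Fin n) ℝ
  Qa : Matrix (Fin m) (Fin m) ℝ
  Sigma0 : Matrix (Fin n) (Fin n) ℝ
  gamma : ℝ

/-- A sample `(s₀, (ε₀, …, ε_{T-1}))`. -/
abbrev Sample (n m T : ℕ) : Type :=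
  EuclideanSpace ℝ (Fin n) × (Fin T → EuclideanSpace ℝ (Fin m))

namespace LQG

section

variable {n m T : ℕ} (S : LQG n m) (K : Matrix (Fin m) (Fin n) ℝ) (ℓ : EuclideanSpace ℝ (Fin m))

/-- `s₀ ∼ N(0, Σ₀)` and `ε₀, …, ε_{T-1} ∼ N(0, Σ)`, all independent. -/
noncomputable def law (T : ℕ) : Measure (Sample n m T) :=
  (multivariateGaussian 0 S.Sigma0).prod
    (Measure.pi fun _ : Fin T => multivariateGaussian 0 (policyCov ℓ))

/-- The exploration noise at time `t` (read only at times `t < T`). -/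
def noise (ω : Sample n m T) (t : ℕ) : Fin m → ℝ :=
  if h : t < T then (ω.2 ⟨t, h⟩).ofLp else 0

/-- The states: `s_{t+1} = A s_t + B a_t` with `a_t = K s_t + ε_t`. -/
def state (ω : Sample n m T) : ℕ → Fin n → ℝ
  | 0 => ω.1.ofLp
  | t + 1 => S.A *ᵥ state ω t + S.B *ᵥ (K *ᵥ state ω t + noise ω t)

/-- The actions `a_t = K s_t + ε_t`, that is `a_t ∼ N(K s_t, Σ)` given the past. -/
def action (ω : Sample n m T) (t : ℕ) : Fin m → ℝ :=
  K *ᵥ S.state K ω t + noise ω t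

def reward (s : Fin n → ℝ) (a : Fin m → ℝ) : ℝ :=
  -(s ⬝ᵥ (S.Qs *ᵥ s) + a ⬝ᵥ (S.Qa *ᵥ a))

/-- The discounted return `R(τ)`. -/
def ret (ω : Sample n m T) : ℝ :=
  ∑ t : Fin T, S.gamma ^ (t : ℕ) * S.reward (S.state K ω (t + 1)) (S.action K ω t)

/-- The objective `J`. -/
noncomputable def objective (T : ℕ) : ℝ := ∫ ω : Sample n m T, S.ret K ω ∂(S.law ℓ T)

/-- The estimator for the gain. -/
noncomputable def estK (ω : Sample n m T) : Matrix (Fin m) (Fin n) ℝ :=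
  S.ret K ω • ∑ t : Fin T, scoreK K ℓ (S.state K ω t) (S.action K ω t)

/-- The estimator for the log standard deviations. -/
noncomputable def estL (ω : Sample n m T) : EuclideanSpace ℝ (Fin m) :=
  S.ret K ω • ∑ t : Fin T, scoreL K ℓ (S.state K ω t) (S.action K ω t)

/-- The covariance matrix of the state `s_t`. -/
noncomputable def stateCov (T : ℕ) (t : ℕ) : Matrix (Fin n) (Fin n) ℝ :=
  Matrix.of fun i j =>
    cov[fun ω : Sample n m T => S.state K ω t i, fun ω => S.state K ω t j; S.law ℓ T]

/-- The closed-loop matrix `F = A + B K`. -/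
def F : Matrix (Fin n) (Fin n) ℝ := S.A + S.B * K

/-! ### Lifted system -/

def stackState (ω : Sample n m T) : Fin T × Fin n → ℝ := fun q => S.state K ω q.1 q.2

def stackNext (ω : Sample n m T) : Fin T × Fin n → ℝ := fun q => S.state K ω (q.1 + 1) q.2

def stackAction (ω : Sample n m T) : Fin T × Fin m → ℝ := fun q => S.action K ω q.1 q.2

def stackNoise (ω : Sample n m T) : Fin T × Fin m → ℝ := fun q => ω.2 q.1 q.2

def FS (T : ℕ) : Matrix (Fin T × Fin n) (Fin n) ℝ :=
  Matrix.of fun q j => (S.F K ^ (q.1 : ℕ)) q.2 j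

def FSnext (T : ℕ) : Matrix (Fin T × Fin n) (Fin n) ℝ :=
  Matrix.of fun q j => (S.F K ^ ((q.1 : ℕ) + 1)) q.2 j

def FE (T : ℕ) : Matrix (Fin T × Fin n) (Fin T × Fin m) ℝ :=
  Matrix.of fun q r =>
    if r.1 < q.1 then (S.F K ^ ((q.1 : ℕ) - 1 - (r.1 : ℕ)) * S.B) q.2 r.2 else 0

def FEnext (T : ℕ) : Matrix (Fin T × Fin n) (Fin T × Fin m) ℝ :=
  Matrix.of fun q r =>
    if r.1 ≤ q.1 then (S.F K ^ ((q.1 : ℕ) - (r.1 : ℕ)) * S.B) q.2 r.2 else 0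

def KS (T : ℕ) : Matrix (Fin T × Fin m) (Fin n) ℝ :=
  Matrix.of fun q j => (K * S.F K ^ (q.1 : ℕ)) q.2 j

def KE (T : ℕ) : Matrix (Fin T × Fin m) (Fin T × Fin m) ℝ :=
  Matrix.of fun q r =>
    if r.1 < q.1 then (K * S.F K ^ ((q.1 : ℕ) - 1 - (r.1 : ℕ)) * S.B) q.2 r.2
    else if r.1 = q.1 then (1 : Matrix (Fin m) (Fin m) ℝ) q.2 r.2 else 0

/-- `D_γ = diag(γ⁰, …, γ^{T-1})`. -/
def Dgamma (T : ℕ) : Matrix (Fin T) (Fin T) ℝ :=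
  Matrix.diagonal fun t => S.gamma ^ (t : ℕ)

def QsLift (T : ℕ) : Matrix (Fin T × Fin n) (Fin T × Fin n) ℝ := S.Dgamma T ⊗ₖ S.Qs

def QaLift (T : ℕ) : Matrix (Fin T × Fin m) (Fin T × Fin m) ℝ := S.Dgamma T ⊗ₖ S.Qa

noncomputable def covLift (ℓ : EuclideanSpace ℝ (Fin m)) (T : ℕ) :
    Matrix (Fin T × Fin m) (Fin T × Fin m) ℝ :=
  (1 : Matrix (Fin T) (Fin T) ℝ) ⊗ₖ policyCov ℓ

def Mss (T : ℕ) : Matrix (Fin n) (Fin n) ℝ :=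
  (S.FSnext K T)ᵀ * S.QsLift T * S.FSnext K T + (S.KS K T)ᵀ * S.QaLift T * S.KS K T

def Mse (T : ℕ) : Matrix (Fin n) (Fin T × Fin m) ℝ :=
  (S.FSnext K T)ᵀ * S.QsLift T * S.FEnext K T + (S.KS K T)ᵀ * S.QaLift T * S.KE K T

def Mee (T : ℕ) : Matrix (Fin T × Fin m) (Fin T × Fin m) ℝ :=
  (S.FEnext K T)ᵀ * S.QsLift T * S.FEnext K T + (S.KE K T)ᵀ * S.QaLift T * S.KE K T

/-- The block selector extracting block `t` from a stacked vector with blocks of size `d`. -/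
def blockSel (d : ℕ) (t : Fin T) : Matrix (Fin d) (Fin T × Fin d) ℝ :=
  Matrix.of fun i q => if q.1 = t ∧ q.2 = i then 1 else 0

/-! ### The six terms for the gain -/

/-- `W^K_{tp} = Π_tᵀ Σ⁻² Π_p`. -/
noncomputable def WK (ℓ : EuclideanSpace ℝ (Fin m)) (t p : Fin T) :
    Matrix (Fin T × Fin m) (Fin T × Fin m) ℝ :=
  (blockSel m t)ᵀ * ((policyCov ℓ)⁻¹ * (policyCov ℓ)⁻¹) * blockSel m p

/-- `F_t = S_t 𝓕_S`. -/
def Fblk (t : Fin T) : Matrix (Fin n) (Fin n) ℝ := blockSel n t * S.FS K T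

/-- `E_t = S_t 𝓕_E`. -/
def Eblk (t : Fin T) : Matrix (Fin n) (Fin T × Fin m) ℝ := blockSel n t * S.FE K T

def Gtp (t p : Fin T) : Matrix (Fin n) (Fin n) ℝ := (S.Fblk K t)ᵀ * S.Fblk K p

def Jtp (t p : Fin T) : Matrix (Fin n) (Fin T × Fin m) ℝ :=
  (S.Fblk K t)ᵀ * S.Eblk K p + (S.Fblk K p)ᵀ * S.Eblk K t

def Utp (t p : Fin T) : Matrix (Fin T × Fin m) (Fin T × Fin m) ℝ :=
  (S.Eblk K t)ᵀ * S.Eblk K p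

noncomputable def alpha (ℓ : EuclideanSpace ℝ (Fin m)) (t p : Fin T) : ℝ :=
  (covLift ℓ T * symPart (WK ℓ t p)).trace

noncomputable def beta (t p : Fin T) : ℝ := (covLift ℓ T * symPart (S.Utp K t p)).trace

noncomputable def delta (t p : Fin T) : ℝ :=
  (covLift ℓ T * symPart (WK ℓ t p) * covLift ℓ T * symPart (S.Utp K t p)).trace

noncomputable def mu (T : ℕ) : ℝ := (covLift ℓ T * symPart (S.Mee K T)).trace

noncomputable def kappa (t p : Fin T) : ℝ :=
  (covLift ℓ T * symPart (WK ℓ t p) * covLift ℓ T * symPart (S.Mee K T)).trace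

noncomputable def EK1 (t p : Fin T) : ℝ :=
  gaussIS S.Sigma0 [symPart (S.Gtp K t p), symPart (S.Mss K T), symPart (S.Mss K T)] *
      gaussIS (covLift ℓ T) [symPart (WK ℓ t p)] +
    gaussIS S.Sigma0 [symPart (S.Mss K T), symPart (S.Mss K T)] *
      gaussIS (covLift ℓ T) [symPart (WK ℓ t p), symPart (S.Utp K t p)]

noncomputable def EK2 (t p : Fin T) : ℝ :=
  gaussIS S.Sigma0 [symPart (S.Gtp K t p)] *
      gaussIS (covLift ℓ T) [symPart (WK ℓ t p), symPart (S.Mee K T), symPart (S.Mee K T)] +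
    gaussIS (covLift ℓ T)
      [symPart (WK ℓ t p), symPart (S.Utp K t p), symPart (S.Mee K T), symPart (S.Mee K T)]

noncomputable def EK3 (t p : Fin T) : ℝ :=
  2 * gaussIS S.Sigma0 [symPart (S.Gtp K t p), symPart (S.Mss K T)] *
      gaussIS (covLift ℓ T) [symPart (WK ℓ t p), symPart (S.Mee K T)] +
    2 * gaussIS S.Sigma0 [symPart (S.Mss K T)] *
      gaussIS (covLift ℓ T) [symPart (WK ℓ t p), symPart (S.Utp K t p), symPart (S.Mee K T)]

/-- `M_se X M_seᵀ`. -/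
def sandwich (X : Matrix (Fin T × Fin m) (Fin T × Fin m) ℝ) : Matrix (Fin n) (Fin n) ℝ :=
  S.Mse K T * X * (S.Mse K T)ᵀ

noncomputable def V0 (T : ℕ) : Matrix (Fin n) (Fin n) ℝ := S.sandwich K (covLift ℓ T)

noncomputable def Vtp (t p : Fin T) : Matrix (Fin n) (Fin n) ℝ :=
  S.sandwich K (covLift ℓ T * symPart (WK ℓ t p) * covLift ℓ T)

noncomputable def VtildeTp (t p : Fin T) : Matrix (Fin n) (Fin n) ℝ :=
  S.sandwich K (covLift ℓ T * symPart (S.Utp K t p) * covLift ℓ T)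

noncomputable def VhatTp (t p : Fin T) : Matrix (Fin n) (Fin n) ℝ :=
  S.sandwich K (covLift ℓ T * symPart (WK ℓ t p) * covLift ℓ T * symPart (S.Utp K t p) *
    covLift ℓ T)

noncomputable def EK4 (t p : Fin T) : ℝ :=
  4 * (alpha ℓ t p * gaussIS S.Sigma0 [symPart (S.Gtp K t p), S.V0 K ℓ T]
    + 2 * gaussIS S.Sigma0 [symPart (S.Gtp K t p), S.Vtp K ℓ t p]
    + (alpha ℓ t p * S.beta K ℓ t p + 2 * S.delta K ℓ t p) * gaussIS S.Sigma0 [S.V0 K ℓ T]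
    + 2 * S.beta K ℓ t p * gaussIS S.Sigma0 [S.Vtp K ℓ t p]
    + 2 * alpha ℓ t p * gaussIS S.Sigma0 [S.VtildeTp K ℓ t p]
    + 8 * gaussIS S.Sigma0 [symPart (S.VhatTp K ℓ t p)])

/-- `sym(M_se X J_{tp}ᵀ)`. -/
noncomputable def crossV (t p : Fin T) (X : Matrix (Fin T × Fin m) (Fin T × Fin m) ℝ) :
    Matrix (Fin n) (Fin n) ℝ :=
  symPart (S.Mse K T * X * (S.Jtp K t p)ᵀ)

noncomputable def cross0 (t p : Fin T) : Matrix (Fin n) (Fin n) ℝ :=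
  S.crossV K t p (covLift ℓ T)

noncomputable def cross1 (t p : Fin T) : Matrix (Fin n) (Fin n) ℝ :=
  S.crossV K t p (covLift ℓ T * symPart (WK ℓ t p) * covLift ℓ T)

noncomputable def cross2 (t p : Fin T) : Matrix (Fin n) (Fin n) ℝ :=
  S.crossV K t p (covLift ℓ T * symPart (S.Mee K T) * covLift ℓ T)

noncomputable def cross3 (t p : Fin T) : Matrix (Fin n) (Fin n) ℝ :=
  S.crossV K t p (symPart
    (covLift ℓ T * symPart (WK ℓ t p) * covLift ℓ T * symPart (S.Mee K T) * covLift ℓ T))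

noncomputable def EK5 (t p : Fin T) : ℝ :=
  4 * (alpha ℓ t p * gaussIS S.Sigma0 [symPart (S.Mss K T), S.cross0 K ℓ t p]
    + 2 * gaussIS S.Sigma0 [symPart (S.Mss K T), S.cross1 K ℓ t p])

noncomputable def EK6 (t p : Fin T) : ℝ :=
  4 * ((alpha ℓ t p * S.mu K ℓ T + 2 * S.kappa K ℓ t p) * gaussIS S.Sigma0 [S.cross0 K ℓ t p]
    + 2 * S.mu K ℓ T * gaussIS S.Sigma0 [S.cross1 K ℓ t p]
    + 2 * alpha ℓ t p * gaussIS S.Sigma0 [S.cross2 K ℓ t p]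
    + 8 * gaussIS S.Sigma0 [S.cross3 K ℓ t p])

/-! ### The four terms for the log standard deviations -/

/-- `Q_{t,i} = Π_tᵀ e_i e_iᵀ Π_t`. -/
def Qsel (t : Fin T) (i : Fin m) : Matrix (Fin T × Fin m) (Fin T × Fin m) ℝ :=
  (blockSel m t)ᵀ * Matrix.single i i (1 : ℝ) * blockSel m t

/-- `W^ℓ_t = Π_tᵀ Σ⁻¹ Π_t`. -/
noncomputable def WL (ℓ : EuclideanSpace ℝ (Fin m)) (t : Fin T) :
    Matrix (Fin T × Fin m) (Fin T × Fin m) ℝ :=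
  (blockSel m t)ᵀ * (policyCov ℓ)⁻¹ * blockSel m t

/-- `d_i = (Σ⁻¹)_{ii}`. -/
noncomputable def dinv (ℓ : EuclideanSpace ℝ (Fin m)) (i : Fin m) : ℝ := (policyCov ℓ)⁻¹ i i

noncomputable def EL1 (t p : Fin T) : ℝ :=
  2 * (m : ℝ) * (if t = p then 1 else 0) *
    gaussIS S.Sigma0 [symPart (S.Mss K T), symPart (S.Mss K T)]

noncomputable def EL2 (t p : Fin T) : ℝ :=
  (∑ i : Fin m, dinv ℓ i ^ 2 * gaussIS (covLift ℓ T)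
      [symPart (Qsel t i), symPart (Qsel p i), symPart (S.Mee K T), symPart (S.Mee K T)])
    - gaussIS (covLift ℓ T) [symPart (WL ℓ t), symPart (S.Mee K T), symPart (S.Mee K T)]
    - gaussIS (covLift ℓ T) [symPart (WL ℓ p), symPart (S.Mee K T), symPart (S.Mee K T)]
    + (m : ℝ) * gaussIS (covLift ℓ T) [symPart (S.Mee K T), symPart (S.Mee K T)]

noncomputable def EL3 (t p : Fin T) : ℝ :=
  2 * gaussIS S.Sigma0 [symPart (S.Mss K T)] *
    ((∑ i : Fin m, dinv ℓ i ^ 2 * gaussIS (covLift ℓ T)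
        [symPart (Qsel t i), symPart (Qsel p i), symPart (S.Mee K T)])
      - gaussIS (covLift ℓ T) [symPart (WL ℓ t), symPart (S.Mee K T)]
      - gaussIS (covLift ℓ T) [symPart (WL ℓ p), symPart (S.Mee K T)]
      + (m : ℝ) * gaussIS (covLift ℓ T) [symPart (S.Mee K T)])

/-- `V_{tp,i}`. -/
noncomputable def VtpI (t p : Fin T) (i : Fin m) : Matrix (Fin n) (Fin n) ℝ :=
  symPart (S.sandwich K (covLift ℓ T * symPart (Qsel t i) * covLift ℓ T * symPart (Qsel p i) *
    covLift ℓ T))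

noncomputable def EL4 (t p : Fin T) : ℝ :=
  8 * (m : ℝ) * (if t = p then 1 else 0) * gaussIS S.Sigma0 [S.V0 K ℓ T]
    + 32 * ∑ i : Fin m, dinv ℓ i ^ 2 * gaussIS S.Sigma0 [S.VtpI K ℓ t p i]

end

end LQG

/-! Second moments. The action minus its mean is the noise, so the scores are `Σ⁻¹ ε_t s_tᵀ` and
`d_i ε_{t,i}² - 1`, while states and return are polynomials in `s₀` and the stacked noise `ε̄`.
Squaring the estimators gives double sums over `t, p`. Each term is `R²` times `(ε̄ᵀ W ε̄)(s_t ·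
s_p)` for the gain, and times a product of two centred squares for the log standard deviations. Fix
`s₀` and integrate over `ε̄`, whose covariance is diagonal with positive entries. There Gaussian
integration by parts, `E[(a·x) p] = E[∂_{Ωa} p]`, is available for every polynomial `p`
(`gaussMoment_linPoly_mul`). It yields the Wick formulas up to `gaussMoment_quad_quad_lin_lin`, and
the terms odd in `ε̄` vanish by symmetry. What remains is a polynomial in `s₀`, whose moments stay
as `IS_{Σ₀}`; hence `Σ₀` may be singular and no Wick formula is needed for it. The outcome is
`integral_quadratic_score_sq` for the gain and `integral_centered_score_sq` for the log standard
deviations.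

Mean gradients. The identity between the gradient of `J` and the mean of the estimator is not
obtained by differentiating under the integral: both sides are computed and agree with the same
closed form. The common tool is the duality `IsCostToGo.sum_trace_eq`, a telescoping sum that turns
a discounted sum of `Q_s` and `KᵀQ_aK` costs along a forward recursion `Y_{t+1} = F Y_t Fᵀ + N_t`
into one in which `Λ_{t+1}` meets only the source `N_t`.

For the gradient of `J`, apply the duality with the cost-to-go of `K` to the covariances generated
by another gain `K'`. This is the performance-difference identity `IsCostToGo.objective_eq`. It
writes `J(K') - J(K)` exactly as `⟨g(K'), K' - K⟩` with `g` continuous, so the gradient is `g(K)`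
and no covariance is ever differentiated. At `K' = K` the same identity shows that `J` is a sum of
functions of the single coordinates of `ℓ`.

For the means of the estimators, integrate by parts in `ε_{t,i}`: the variance cancels `d_i` and the
expectation falls on the derivative of `R`. The derivatives of the trajectory are deterministic and
follow the closed loop after time `t`, so duality with a rank-one `Y` collapses the sum over later
times to one term in `Λ_{t+1}` (`IsCostToGo.sum_sens_action_eq`). -/

open scoped NNReal ENNReal in
/-- A function with finite moments of all orders. -/
def AllLp {Ω : Type*} [MeasurableSpace Ω] (f : Ω → ℝ) (μ : Measure Ω) : Prop :=
  ∀ p : ℝ≥0, MemLp f p μ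

/-! ### Closure properties that settle all integrability questions -/

namespace AllLp

variable {Ω Ω' : Type*} [MeasurableSpace Ω] [MeasurableSpace Ω'] {μ : Measure Ω} {ν : Measure Ω'}
  {f g : Ω → ℝ}

theorem integrable (hf : AllLp f μ) : Integrable f μ := by
  have := hf 1
  rwa [ENNReal.coe_one, memLp_one_iff_integrable] at this

theorem const [IsFiniteMeasure μ] (c : ℝ) : AllLp (fun _ => c) μ := fun _ => memLp_const c

theorem add (hf : AllLp f μ) (hg : AllLp g μ) : AllLp (fun x => f x + g x) μ :=
  fun p => (hf p).add (hg p)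

theorem sub (hf : AllLp f μ) (hg : AllLp g μ) : AllLp (fun x => f x - g x) μ :=
  fun p => (hf p).sub (hg p)

theorem neg (hf : AllLp f μ) : AllLp (fun x => -f x) μ := fun p => (hf p).neg

/-- Hölder with both exponents equal to `2p`. This closure is the reason for asking for all finite
exponents at once. -/
theorem mul (hf : AllLp f μ) (hg : AllLp g μ) : AllLp (fun x => f x * g x) μ := by
  intro p
  have h2 : ((2 * p : NNReal) : ENNReal)⁻¹ + ((2 * p : NNReal) : ENNReal)⁻¹ = (p : ENNReal)⁻¹ := by
    rw [ENNReal.coe_mul, ENNReal.mul_inv (by simp) (by simp), ← add_mul]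
    simp [ENNReal.inv_two_add_inv_two]
  have : ENNReal.HolderTriple ((2 * p : NNReal) : ENNReal) ((2 * p : NNReal) : ENNReal) p := ⟨h2⟩
  exact (hg (2 * p)).mul (hf (2 * p))

theorem const_mul (hf : AllLp f μ) (c : ℝ) : AllLp (fun x => c * f x) μ :=
  fun p => (hf p).const_mul c

theorem pow [IsFiniteMeasure μ] (hf : AllLp f μ) (k : ℕ) : AllLp (fun x => f x ^ k) μ := by
  induction k with
  | zero => simpa using const (μ := μ) 1
  | succ k ih => simpa only [pow_succ] using ih.mul hf

theorem sum {α : Type*} (s : Finset α) {f : α → Ω → ℝ} (hf : ∀ i ∈ s, AllLp (f i) μ) :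
    AllLp (fun x => ∑ i ∈ s, f i x) μ :=
  fun p => memLp_finsetSum s fun i hi => hf i hi p

theorem comp_measurePreserving {f : Ω' → ℝ} (hf : AllLp f ν) {φ : Ω → Ω'}
    (hφ : MeasurePreserving φ μ ν) : AllLp (fun x => f (φ x)) μ :=
  fun p => (hf p).comp_measurePreserving hφ

theorem mulVec {ι κ : Type*} [Fintype κ] (A : Matrix ι κ ℝ) {f : Ω → κ → ℝ}
    (hf : ∀ j, AllLp (fun x => f x j) μ) (i : ι) : AllLp (fun x => (A *ᵥ f x) i) μ :=
  sum _ fun j _ => (hf j).const_mul _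

theorem dotProduct {κ : Type*} [Fintype κ] {f g : Ω → κ → ℝ}
    (hf : ∀ j, AllLp (fun x => f x j) μ) (hg : ∀ j, AllLp (fun x => g x j) μ) :
    AllLp (fun x => f x ⬝ᵥ g x) μ :=
  sum _ fun j _ => (hf j).mul (hg j)

theorem mvPolynomial_eval {ι : Type*} [IsFiniteMeasure μ] {X : Ω → ι → ℝ}
    (hX : ∀ i, AllLp (fun ω => X ω i) μ) (p : MvPolynomial ι ℝ) :
    AllLp (fun ω => MvPolynomial.eval (X ω) p) μ := by
  induction p using MvPolynomial.induction_on with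
  | C a => simpa using const (μ := μ) a
  | add p q hp hq => simpa using hp.add hq
  | mul_X p i hp => simpa using hp.mul (hX i)

theorem multivariateGaussian_coord {ι : Type*} [Fintype ι] [DecidableEq ι] (m : EuclideanSpace ℝ ι)
    (Ω : Matrix ι ι ℝ) (i : ι) :
    AllLp (fun x : EuclideanSpace ℝ ι => x.ofLp i) (multivariateGaussian m Ω) := by
  intro p
  exact (IsGaussian.memLp_id (multivariateGaussian m Ω) p ENNReal.coe_ne_top).continuousLinearMap_comp
    (EuclideanSpace.proj (𝕜 := ℝ) i)

end AllLp

/-! ### Moments of Gaussian measures with diagonal covariance -/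

theorem hasDerivAt_gaussianPDFReal {v : NNReal} (hv : v ≠ 0) (x : ℝ) :
    HasDerivAt (gaussianPDFReal 0 v) (-(x / v) * gaussianPDFReal 0 v x) x := by
  have hv' : (v : ℝ) ≠ 0 := by exact_mod_cast hv
  have h : HasDerivAt (fun x : ℝ => -(x - 0) ^ 2 / (2 * v)) (-(x / v)) x := by
    have := (((hasDerivAt_id x).sub_const 0).pow 2).neg.div_const (2 * (v : ℝ))
    refine this.congr_deriv ?_
    simp
    field_simp
  have := (h.exp).const_mul (√(2 * Real.pi * v))⁻¹
  rw [gaussianPDFReal_def]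
  refine this.congr_deriv ?_
  ring

/-- Integration by parts against the density, whose derivative is `-(x/v)` times itself. At `k = 0`
the truncated exponent `k - 1` is harmless, since its coefficient is zero. -/
theorem integral_pow_succ_gaussianReal {v : NNReal} (hv : v ≠ 0) (k : ℕ) :
    ∫ x, x ^ (k + 1) ∂(gaussianReal 0 v) = v * (k * ∫ x, x ^ (k - 1) ∂(gaussianReal 0 v)) := by
  have hv' : (v : ℝ) ≠ 0 := by exact_mod_cast hv
  have hint : ∀ j : ℕ, Integrable (fun x : ℝ => x ^ j * gaussianPDFReal 0 v x) := by
    intro j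
    have h : Integrable (fun x : ℝ => x ^ j) (gaussianReal 0 v) :=
      (AllLp.pow (f := id) (fun p => memLp_id_gaussianReal p) j).integrable
    rw [gaussianReal_of_var_ne_zero _ hv, gaussianPDF_def,
      integrable_withDensity_iff (by fun_prop) (by simp)] at h
    refine h.congr (Filter.Eventually.of_forall fun x => ?_)
    simp [ENNReal.toReal_ofReal (gaussianPDFReal_nonneg _ _ _)]
  have key := integral_mul_deriv_eq_deriv_mul_of_integrable (u := fun x : ℝ => x ^ k)
    (u' := fun x => k * x ^ (k - 1)) (v := gaussianPDFReal 0 v)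
    (v' := fun x => -(x / v) * gaussianPDFReal 0 v x) (fun x _ => by simpa using hasDerivAt_pow k x)
    (fun x _ => hasDerivAt_gaussianPDFReal hv x) ?_ ?_ (hint k)
  · rw [integral_gaussianReal_eq_integral_smul hv, integral_gaussianReal_eq_integral_smul hv]
    have e1 : ∀ x : ℝ, x ^ k * (-(x / v) * gaussianPDFReal 0 v x)
        = -(v : ℝ)⁻¹ * (gaussianPDFReal 0 v x • x ^ (k + 1)) := by
      intro x; simp only [smul_eq_mul]; field_simp; ring
    have e2 : ∀ x : ℝ, (k * x ^ (k - 1)) * gaussianPDFReal 0 v x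
        = k * (gaussianPDFReal 0 v x • x ^ (k - 1)) := by
      intro x; simp only [smul_eq_mul]; ring
    simp_rw [e1, e2, integral_const_mul] at key
    field_simp at key
    linarith
  · have := (hint (k + 1)).const_mul (-(v : ℝ)⁻¹)
    refine this.congr (Filter.Eventually.of_forall fun x => ?_)
    simp only [Pi.mul_apply]
    field_simp
    ring
  · have := (hint (k - 1)).const_mul (k : ℝ)
    refine this.congr (Filter.Eventually.of_forall fun x => ?_)
    simp only [Pi.mul_apply]
    ring

section Stein

variable {ι : Type*} [Fintype ι] [DecidableEq ι]

/-- The characteristic functions agree. This reduces a diagonal Gaussian to one-dimensional ones. -/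
theorem multivariateGaussian_diagonal {v : ι → ℝ} (hv : ∀ i, 0 < v i) :
    multivariateGaussian 0 (Matrix.diagonal v) =
      (Measure.pi fun i => gaussianReal 0 (v i).toNNReal).map (WithLp.toLp 2) := by
  have hpsd : (Matrix.diagonal v).PosSemidef := Matrix.PosSemidef.diagonal fun i => (hv i).le
  apply Measure.ext_of_charFun (E := EuclideanSpace ℝ ι)
  ext t
  simp_rw [charFun_multivariateGaussian hpsd, charFun_pi, charFun_gaussianReal, ← Complex.exp_sum]
  congr 1
  simp [dotProduct, mulVec_diagonal, Finset.sum_div, Real.coe_toNNReal _ (hv _).le]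
  refine Finset.sum_congr rfl fun i _ => ?_
  ring

open MvPolynomial in
-- Both sides are linear in `p`, so monomials suffice. Their integrals factor over the coordinates,
-- and only the factor at `i` changes, by the one-dimensional recursion.
theorem integral_X_mul_pi_gaussianReal {v : ι → NNReal} (hv : ∀ i, v i ≠ 0) (i : ι)
    (p : MvPolynomial ι ℝ) :
    ∫ x, eval x (X i * p) ∂(Measure.pi fun i => gaussianReal 0 (v i)) =
      v i * ∫ x, eval x (pderiv i p) ∂(Measure.pi fun i => gaussianReal 0 (v i)) := by
  have hint : ∀ q : MvPolynomial ι ℝ,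
      Integrable (fun x => eval x q) (Measure.pi fun i => gaussianReal 0 (v i)) := by
    intro q
    refine (AllLp.mvPolynomial_eval (X := fun x => x) (fun j => ?_) q).integrable
    exact AllLp.comp_measurePreserving (f := id) (fun p => memLp_id_gaussianReal p)
      (measurePreserving_eval _ j)
  have hmon : ∀ s : ι →₀ ℕ, ∀ a : ℝ,
      ∫ x, eval x (monomial s a) ∂(Measure.pi fun i => gaussianReal 0 (v i)) =
        a * ∏ j, ∫ x, x ^ s j ∂(gaussianReal 0 (v j)) := by
    intro s a
    simp_rw [eval_monomial, integral_const_mul,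
      Finsupp.prod_fintype _ _ (fun i => pow_zero _)]
    rw [integral_fintype_prod_eq_prod (f := fun j (x : ℝ) => x ^ s j)]
  induction p using MvPolynomial.induction_on' with
  | add p q hp hq =>
    simp only [mul_add, map_add]
    rw [integral_add, integral_add, hp, hq, mul_add]
    all_goals exact hint _
  | monomial s a =>
    rw [X, monomial_mul, pderiv_monomial, hmon, hmon,
      Fintype.prod_eq_mul_prod_compl i, Fintype.prod_eq_mul_prod_compl i]
    have h1 : ∀ j ∈ ({i} : Finset ι)ᶜ, (Finsupp.single i 1 + s : ι →₀ ℕ) j = s j := by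
      intro j hj
      have : i ≠ j := by simpa [eq_comm] using hj
      simp [this]
    have h2 : ∀ j ∈ ({i} : Finset ι)ᶜ, (s - Finsupp.single i 1 : ι →₀ ℕ) j = s j := by
      intro j hj
      have : i ≠ j := by simpa [eq_comm] using hj
      simp [this]
    have e : ∀ r : ι →₀ ℕ, (∀ j ∈ ({i} : Finset ι)ᶜ, r j = s j) →
        ∏ j ∈ ({i} : Finset ι)ᶜ, ∫ x, x ^ r j ∂(gaussianReal 0 (v j)) =
          ∏ j ∈ ({i} : Finset ι)ᶜ, ∫ x, x ^ s j ∂(gaussianReal 0 (v j)) :=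
      fun r hr => Finset.prod_congr rfl fun j hj => by rw [hr j hj]
    rw [e _ h1, e _ h2]
    have := integral_pow_succ_gaussianReal (hv i) (s i)
    simp only [Finsupp.add_apply, Finsupp.single_eq_same, Finsupp.tsub_apply, one_mul]
    rw [add_comm 1, this]
    ring

/-- The moment functional of a centred Gaussian measure on polynomials. -/
noncomputable def gaussMoment (Ω : Matrix ι ι ℝ) : MvPolynomial ι ℝ →ₗ[ℝ] ℝ where
  toFun p := ∫ x, MvPolynomial.eval x.ofLp p ∂(multivariateGaussian 0 Ω)
  map_add' p q := by
    simp only [map_add]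
    exact integral_add
      (AllLp.mvPolynomial_eval (AllLp.multivariateGaussian_coord 0 Ω) p).integrable
      (AllLp.mvPolynomial_eval (AllLp.multivariateGaussian_coord 0 Ω) q).integrable
  map_smul' c p := by
    simp only [MvPolynomial.smul_eval, integral_const_mul, smul_eq_mul, RingHom.id_apply]

theorem gaussMoment_apply (Ω : Matrix ι ι ℝ) (p : MvPolynomial ι ℝ) :
    gaussMoment Ω p = ∫ x, MvPolynomial.eval x.ofLp p ∂(multivariateGaussian 0 Ω) := rfl

theorem gaussMoment_C (Ω : Matrix ι ι ℝ) (c : ℝ) : gaussMoment Ω (MvPolynomial.C c) = c := by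
  simp [gaussMoment_apply]

theorem gaussMoment_one (Ω : Matrix ι ι ℝ) : gaussMoment Ω 1 = 1 := gaussMoment_C Ω 1

theorem gaussMoment_diagonal_X_mul {v : ι → ℝ} (hv : ∀ i, 0 < v i) (i : ι)
    (p : MvPolynomial ι ℝ) :
    gaussMoment (Matrix.diagonal v) (MvPolynomial.X i * p) =
      v i * gaussMoment (Matrix.diagonal v) (MvPolynomial.pderiv i p) := by
  have h : ∀ q, gaussMoment (Matrix.diagonal v) q =
      ∫ x, MvPolynomial.eval x q ∂(Measure.pi fun i => gaussianReal 0 (v i).toNNReal) := by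
    intro q
    rw [gaussMoment_apply, multivariateGaussian_diagonal hv, integral_map (by fun_prop)]
    rw [← multivariateGaussian_diagonal hv]
    exact (AllLp.mvPolynomial_eval
      (AllLp.multivariateGaussian_coord 0 _) q).integrable.aestronglyMeasurable
  rw [h, h, integral_X_mul_pi_gaussianReal (fun i => by simpa using hv i),
    Real.coe_toNNReal _ (hv i).le]

end Stein

/-- A positive diagonal matrix. -/
def IsPosDiag {ι : Type*} [DecidableEq ι] (Ω : Matrix ι ι ℝ) : Prop := ∃ v : ι → ℝ, (∀ i, 0 < v i) ∧ Ω = Matrix.diagonal v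

theorem IsPosDiag.transpose_eq {ι : Type*} [DecidableEq ι] {Ω : Matrix ι ι ℝ} (hΩ : IsPosDiag Ω) : Ωᵀ = Ω := by
  obtain ⟨v, -, rfl⟩ := hΩ
  exact diagonal_transpose v

/-! ### Linear and quadratic forms as polynomials, and their Wick formulas -/

section Wick

open MvPolynomial

variable {ι : Type*} [Fintype ι]

/-- The linear form `x ↦ a ⬝ x` as a polynomial. -/
noncomputable def linPoly (a : ι → ℝ) : MvPolynomial ι ℝ := ∑ i, C (a i) * X i

/-- The quadratic form `x ↦ xᵀ A x` as a polynomial. -/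
noncomputable def quadPoly (A : Matrix ι ι ℝ) : MvPolynomial ι ℝ := ∑ i, X i * linPoly (A i)

theorem eval_linPoly (a x : ι → ℝ) : eval x (linPoly a) = a ⬝ᵥ x := by
  simp [linPoly, dotProduct]

theorem eval_quadPoly (A : Matrix ι ι ℝ) (x : ι → ℝ) :
    eval x (quadPoly A) = x ⬝ᵥ (A *ᵥ x) := by
  simp [quadPoly, eval_linPoly, dotProduct, mulVec]

theorem linPoly_add (a b : ι → ℝ) : linPoly (a + b) = linPoly a + linPoly b := by
  simp [linPoly, add_mul, Finset.sum_add_distrib]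

theorem linPoly_smul (c : ℝ) (a : ι → ℝ) : linPoly (c • a) = c • linPoly a := by
  simp [linPoly, smul_eq_C_mul, Finset.mul_sum, mul_assoc]

theorem quadPoly_add (A B : Matrix ι ι ℝ) : quadPoly (A + B) = quadPoly A + quadPoly B := by
  simp only [quadPoly, ← Finset.sum_add_distrib, ← mul_add]
  exact Finset.sum_congr rfl fun i _ => by rw [← linPoly_add]; rfl

theorem quadPoly_smul (c : ℝ) (A : Matrix ι ι ℝ) : quadPoly (c • A) = c • quadPoly A := by
  simp only [quadPoly, Finset.smul_sum, ← mul_smul_comm]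
  exact Finset.sum_congr rfl fun i _ => by rw [← linPoly_smul]; rfl

theorem quadPoly_transpose (A : Matrix ι ι ℝ) : quadPoly Aᵀ = quadPoly A := by
  simp only [quadPoly, linPoly, Finset.mul_sum]
  rw [Finset.sum_comm]
  exact Finset.sum_congr rfl fun i _ => Finset.sum_congr rfl fun j _ => by
    rw [transpose_apply]; ring

/-- Allows any quadratic form to be fed to the Wick formulas, which require symmetric matrices. -/
theorem quadPoly_symPart (A : Matrix ι ι ℝ) : quadPoly (symPart A) = quadPoly A := by
  rw [symPart, quadPoly_smul, quadPoly_add, quadPoly_transpose, ← two_smul ℝ, smul_smul]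
  norm_num

theorem symPart_transpose {κ : Type*} (A : Matrix κ κ ℝ) : (symPart A)ᵀ = symPart A := by
  simp [symPart, add_comm]

theorem dotProduct_mulVec_swap {κ : Type*} [Fintype κ] (A : Matrix ι κ ℝ) (a : ι → ℝ) (b : κ → ℝ) :
    a ⬝ᵥ A *ᵥ b = b ⬝ᵥ Aᵀ *ᵥ a := by
  rw [dotProduct_mulVec, ← mulVec_transpose, dotProduct_comm]

theorem mulVec_dotProduct {κ : Type*} [Fintype κ] (A : Matrix κ ι ℝ) (a : ι → ℝ) (b : κ → ℝ) :
    (A *ᵥ a) ⬝ᵥ b = a ⬝ᵥ Aᵀ *ᵥ b := by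
  rw [dotProduct_comm, dotProduct_mulVec_swap]

/-- The derivation in the direction `b`. -/
noncomputable def dirDeriv (b : ι → ℝ) : Derivation ℝ (MvPolynomial ι ℝ) (MvPolynomial ι ℝ) :=
  mkDerivation ℝ fun i => C (b i)

theorem dirDeriv_linPoly (a b : ι → ℝ) : dirDeriv b (linPoly a) = C (a ⬝ᵥ b) := by
  simp [dirDeriv, linPoly, Derivation.leibniz, mkDerivation_X, dotProduct]

theorem dirDeriv_quadPoly {A : Matrix ι ι ℝ} (hA : Aᵀ = A) (b : ι → ℝ) :
    dirDeriv b (quadPoly A) = (2 : ℝ) • linPoly (A *ᵥ b) := by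
  have hX : ∀ i, dirDeriv b (X i) = C (b i) := fun i => by simp [dirDeriv, mkDerivation_X]
  have h1 : ∑ i, X i * C (A i ⬝ᵥ b) = linPoly (A *ᵥ b) := by
    simp only [linPoly, mulVec, mul_comm (X _)]
  have h2 : ∑ i, linPoly (A i) * C (b i) = linPoly (A *ᵥ b) := by
    simp only [linPoly, mulVec, dotProduct, map_sum, Finset.sum_mul]
    rw [Finset.sum_comm]
    refine Finset.sum_congr rfl fun i _ => Finset.sum_congr rfl fun j _ => ?_
    conv_rhs => rw [← hA, transpose_apply, C_mul]
    ring
  simp only [quadPoly, map_sum, Derivation.leibniz, hX, dirDeriv_linPoly, smul_eq_mul,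
    Finset.sum_add_distrib, h1, h2]
  rw [two_smul]

variable [DecidableEq ι]

/-- Two derivations of a polynomial ring that agree on the variables are equal. -/
theorem dirDeriv_eq_sum (b : ι → ℝ) (p : MvPolynomial ι ℝ) :
    dirDeriv b p = ∑ i, b i • pderiv i p := by
  have hsum : ∀ q, (∑ i, b i • (pderiv i : Derivation ℝ (MvPolynomial ι ℝ) _)) q =
      ∑ i, b i • pderiv i q := fun q => by
    have := congrFun (map_sum (Derivation.coeFnAddMonoidHom (R := ℝ) (A := MvPolynomial ι ℝ)
      (M := MvPolynomial ι ℝ)) (fun i => b i • pderiv i) Finset.univ) q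
    rwa [Finset.sum_apply] at this
  have : dirDeriv b = ∑ i, b i • (pderiv i : Derivation ℝ (MvPolynomial ι ℝ) _) := by
    refine derivation_ext fun j => ?_
    rw [dirDeriv, mkDerivation_X, hsum, Finset.sum_eq_single j]
    · simp [smul_eq_C_mul]
    · intro i _ hij
      rw [pderiv_X_of_ne hij.symm, smul_zero]
    · simp
  rw [this, hsum]

variable {Ω : Matrix ι ι ℝ}

theorem gaussIS_eq_gaussMoment (As : List (Matrix ι ι ℝ)) :
    gaussIS Ω As = gaussMoment Ω (As.map quadPoly).prod := by
  rw [gaussIS, gaussMoment_apply]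
  refine integral_congr_ae (Filter.Eventually.of_forall fun x => ?_)
  simp only [map_list_prod, List.map_map]
  congr 2
  ext A
  simp [eval_quadPoly]

/-- Gaussian integration by parts. -/
theorem gaussMoment_linPoly_mul (hΩ : IsPosDiag Ω) (a : ι → ℝ) (p : MvPolynomial ι ℝ) :
    gaussMoment Ω (linPoly a * p) = gaussMoment Ω (dirDeriv (Ω *ᵥ a) p) := by
  obtain ⟨v, hv, rfl⟩ := hΩ
  rw [linPoly, Finset.sum_mul, map_sum, dirDeriv_eq_sum, map_sum]
  refine Finset.sum_congr rfl fun i _ => ?_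
  rw [mul_assoc, ← smul_eq_C_mul, map_smul, map_smul, gaussMoment_diagonal_X_mul hv,
    mulVec_diagonal]
  simp only [smul_eq_mul]; ring

theorem gaussMoment_linPoly_linPoly (hΩ : IsPosDiag Ω) (a b : ι → ℝ) :
    gaussMoment Ω (linPoly a * linPoly b) = b ⬝ᵥ Ω *ᵥ a := by
  rw [gaussMoment_linPoly_mul hΩ, dirDeriv_linPoly, gaussMoment_C]

theorem gaussMoment_quadPoly (hΩ : IsPosDiag Ω) (A : Matrix ι ι ℝ) :
    gaussMoment Ω (quadPoly A) = (Ω * A).trace := by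
  obtain ⟨v, hv, rfl⟩ := id hΩ
  have hX : ∀ i, (X i : MvPolynomial ι ℝ) = linPoly (Pi.single i 1) := by
    intro i; simp [linPoly, Pi.single_apply]
  simp only [quadPoly, map_sum, hX, gaussMoment_linPoly_linPoly hΩ, mulVec_diagonal, trace, diag,
    diagonal_mul, dotProduct, Pi.single_apply]
  refine Finset.sum_congr rfl fun i _ => ?_
  simp [mul_comm]

/-- Integrate by parts in the factor `a`: the derivative hits either `b`, leaving the mean of the
quadratic form, or `W`, leaving a covariance of two linear forms. -/
theorem gaussMoment_quad_lin_lin (hΩ : IsPosDiag Ω) {W : Matrix ι ι ℝ} (hW : Wᵀ = W)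
    (a b : ι → ℝ) :
    gaussMoment Ω (quadPoly W * (linPoly a * linPoly b)) =
      (Ω * W).trace * (a ⬝ᵥ Ω *ᵥ b) + 2 * (a ⬝ᵥ (Ω * W * Ω) *ᵥ b) := by
  rw [mul_left_comm, gaussMoment_linPoly_mul hΩ, Derivation.leibniz, dirDeriv_linPoly,
    dirDeriv_quadPoly hW, map_add, smul_eq_mul, smul_eq_mul, mul_smul_comm, map_smul,
    gaussMoment_linPoly_linPoly hΩ, mul_comm _ (C _), ← smul_eq_C_mul, map_smul,
    gaussMoment_quadPoly hΩ, smul_eq_mul, smul_eq_mul, dotProduct_mulVec_swap Ω b,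
    mulVec_dotProduct, mulVec_dotProduct, hΩ.transpose_eq, hW]
  simp only [mulVec_mulVec, Matrix.mul_assoc]
  ring

/-- Write the second form as a sum of products of two linear forms and sum the previous formula; the
sums over coordinates become traces. -/
theorem gaussMoment_quad_quad (hΩ : IsPosDiag Ω) {W Z : Matrix ι ι ℝ} (hW : Wᵀ = W)
    (hZ : Zᵀ = Z) :
    gaussMoment Ω (quadPoly W * quadPoly Z) =
      (Ω * W).trace * (Ω * Z).trace + 2 * (Ω * W * Ω * Z).trace := by
  have hX : ∀ i, (X i : MvPolynomial ι ℝ) = linPoly (Pi.single i 1) := by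
    intro i; simp [linPoly, Pi.single_apply]
  rw [quadPoly.eq_1 Z, Finset.mul_sum, map_sum]
  simp only [hX, gaussMoment_quad_lin_lin hΩ hW, Finset.sum_add_distrib, ← Finset.mul_sum,
    single_one_dotProduct]
  have h : ∀ A : Matrix ι ι ℝ, ∑ i, (A *ᵥ Z i) i = (A * Z).trace := by
    intro A
    simp only [mulVec, dotProduct, trace, diag, mul_apply]
    refine Finset.sum_congr rfl fun i _ => Finset.sum_congr rfl fun j _ => ?_
    conv_lhs => rw [← hZ, transpose_apply]
  rw [h, h]

/-- Integration by parts in `a` has three targets: `b`, `Z` and `W`. The last two each give `4`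
times a chain, with `W` and `Z` in opposite orders; together they are `8` times a symmetric part. -/
theorem gaussMoment_quad_quad_lin_lin (hΩ : IsPosDiag Ω) {W Z : Matrix ι ι ℝ} (hW : Wᵀ = W)
    (hZ : Zᵀ = Z) (a b : ι → ℝ) :
    gaussMoment Ω (quadPoly W * quadPoly Z * (linPoly a * linPoly b)) =
      ((Ω * W).trace * (Ω * Z).trace + 2 * (Ω * W * Ω * Z).trace) * (a ⬝ᵥ Ω *ᵥ b)
        + 2 * (Ω * Z).trace * (a ⬝ᵥ (Ω * W * Ω) *ᵥ b)
        + 2 * (Ω * W).trace * (a ⬝ᵥ (Ω * Z * Ω) *ᵥ b)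
        + 8 * (a ⬝ᵥ symPart (Ω * W * Ω * Z * Ω) *ᵥ b) := by
  have e : quadPoly W * quadPoly Z * (linPoly a * linPoly b) =
    linPoly a * (quadPoly W * (quadPoly Z * linPoly b)) := by ring
  rw [e, gaussMoment_linPoly_mul hΩ]
  simp only [Derivation.leibniz, dirDeriv_linPoly, dirDeriv_quadPoly hW, dirDeriv_quadPoly hZ,
    smul_eq_mul]
  have e2 : quadPoly W * (quadPoly Z * C (b ⬝ᵥ Ω *ᵥ a)
        + linPoly b * (2 : ℝ) • linPoly (Z *ᵥ Ω *ᵥ a))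
      + quadPoly Z * linPoly b * (2 : ℝ) • linPoly (W *ᵥ Ω *ᵥ a)
      = (b ⬝ᵥ Ω *ᵥ a) • (quadPoly W * quadPoly Z)
        + (2 : ℝ) • (quadPoly W * (linPoly (Z *ᵥ Ω *ᵥ a) * linPoly b))
        + (2 : ℝ) • (quadPoly Z * (linPoly (W *ᵥ Ω *ᵥ a) * linPoly b)) := by
    simp only [smul_eq_C_mul]; ring
  rw [e2]
  simp only [map_add, map_smul, gaussMoment_quad_lin_lin hΩ hW, gaussMoment_quad_lin_lin hΩ hZ,
    gaussMoment_quad_quad hΩ hW hZ, smul_eq_mul]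
  rw [dotProduct_mulVec_swap Ω b]
  simp only [mulVec_dotProduct, hΩ.transpose_eq, hW, hZ, symPart, transpose_mul, smul_mulVec,
    add_mulVec, mulVec_mulVec, Matrix.mul_assoc, dotProduct_add, dotProduct_smul, smul_eq_mul]
  ring

/-- Odd polynomials have vanishing Gaussian moments. -/
theorem gaussMoment_eq_zero_of_odd (hΩ : IsPosDiag Ω) {p : MvPolynomial ι ℝ}
    (hp : ∀ x, eval (-x) p = -eval x p) : gaussMoment Ω p = 0 := by
  have hpsd : Ω.PosSemidef := by
    obtain ⟨v, hv, rfl⟩ := hΩ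
    exact PosSemidef.diagonal fun i => (hv i).le
  -- The law is invariant under reflection because its characteristic function is even.
  have hneg : (multivariateGaussian 0 Ω).map (fun x => -x) = multivariateGaussian 0 Ω := by
    apply Measure.ext_of_charFun
    ext t
    have := charFun_map_smul (μ := multivariateGaussian 0 Ω) (-1 : ℝ) t
    simp only [neg_smul, one_smul] at this
    rw [this, charFun_multivariateGaussian hpsd, charFun_multivariateGaussian hpsd]
    simp [mulVec_neg]
  have h : gaussMoment Ω p = -gaussMoment Ω p := by
    conv_lhs => rw [gaussMoment_apply, ← hneg]
    rw [integral_map (by fun_prop)]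
    · rw [gaussMoment_apply, ← integral_neg]
      exact integral_congr_ae (Filter.Eventually.of_forall fun x => hp x.ofLp)
    · rw [hneg]
      exact (AllLp.mvPolynomial_eval
        (AllLp.multivariateGaussian_coord 0 _) p).integrable.aestronglyMeasurable
  linarith

end Wick

/-! ### Gradients -/

/-- Carathéodory's criterion: an exact difference formula whose slope `g y` depends continuously on
the endpoint. The error is `⟨g y - g x, y - x⟩`, bounded by Cauchy–Schwarz. -/
theorem hasGradientAt_of_sub_eq_inner {E : Type*} [NormedAddCommGroup E] [InnerProductSpace ℝ E]
    [CompleteSpace E] {f : E → ℝ} {g : E → E} {x : E}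
    (h : ∀ y, f y - f x = inner ℝ (g y) (y - x)) (hg : ContinuousAt g x) :
    HasGradientAt f (g x) x := by
  rw [hasGradientAt_iff_isLittleO, Asymptotics.isLittleO_iff]
  intro c hc
  have : ∀ᶠ y in nhds x, ‖g y - g x‖ < c := by
    have := Metric.continuousAt_iff'.1 hg c hc
    simpa only [dist_eq_norm] using this
  filter_upwards [this] with y hy
  rw [h y, ← inner_sub_left]
  exact (norm_inner_le_norm _ _).trans (mul_le_mul_of_nonneg_right hy.le (norm_nonneg _))

theorem hasGradientAt_sum_coord {ι : Type*} [Fintype ι] {φ : ι → ℝ → ℝ} {φ' : ι → ℝ}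
    {x : EuclideanSpace ℝ ι} (h : ∀ i, HasDerivAt (φ i) (φ' i) (x i)) :
    HasGradientAt (fun y : EuclideanSpace ℝ ι => ∑ i, φ i (y i)) (WithLp.toLp 2 φ') x := by
  rw [hasGradientAt_iff_hasFDerivAt]
  have h2 : ∀ i, HasFDerivAt (fun y : EuclideanSpace ℝ ι => φ i (y i))
      (φ' i • (EuclideanSpace.proj (𝕜 := ℝ) i : EuclideanSpace ℝ ι →L[ℝ] ℝ)) x := by
    intro i
    exact (h i).comp_hasFDerivAt x
      (EuclideanSpace.proj (𝕜 := ℝ) i : EuclideanSpace ℝ ι →L[ℝ] ℝ).hasFDerivAt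
  have := HasFDerivAt.fun_sum (u := Finset.univ) fun i _ => h2 i
  refine this.congr_fderiv ?_
  ext y
  simp [PiLp.inner_apply, mul_comm]

theorem toMat_toEuc {m n : ℕ} (K : Matrix (Fin m) (Fin n) ℝ) : toMat (toEuc K) = K := rfl

theorem inner_toEuc {m n : ℕ} (G : Matrix (Fin m) (Fin n) ℝ)
    (k : EuclideanSpace ℝ (Fin m × Fin n)) :
    inner ℝ (toEuc G) k = ∑ i, ∑ j, G i j * k (i, j) := by
  rw [PiLp.inner_apply, Fintype.sum_prod_type]
  simp [toEuc, mul_comm]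

theorem continuous_toEuc_comp {X : Type*} [TopologicalSpace X] {m n : ℕ}
    {G : X → Matrix (Fin m) (Fin n) ℝ} (hG : ∀ i j, Continuous fun x => G x i j) :
    Continuous fun x => toEuc (G x) :=
  (PiLp.continuous_toLp 2 _).comp (continuous_pi fun q => hG q.1 q.2)

theorem hasMatGradientAt_of_sub_eq {m n : ℕ} {f : Matrix (Fin m) (Fin n) ℝ → ℝ}
    {g : Matrix (Fin m) (Fin n) ℝ → Matrix (Fin m) (Fin n) ℝ} {K : Matrix (Fin m) (Fin n) ℝ}
    (h : ∀ K', f K' - f K = ((g K')ᵀ * (K' - K)).trace)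
    (hg : ∀ i j, Continuous fun K' => g K' i j) : HasMatGradientAt f (g K) K := by
  have hc : Continuous fun k : EuclideanSpace ℝ (Fin m × Fin n) => toEuc (g (toMat k)) := by
    refine continuous_toEuc_comp fun i j => (hg i j).comp ?_
    exact continuous_matrix fun i j => by
      simp only [toMat, of_apply]
      fun_prop
  refine hasGradientAt_of_sub_eq_inner (f := fun k => f (toMat k))
    (g := fun k => toEuc (g (toMat k))) (x := toEuc K) (fun k => ?_) hc.continuousAt
  rw [toMat_toEuc, h, inner_toEuc, trace, Finset.sum_comm]
  simp only [diag, mul_apply, transpose_apply]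
  rfl

/-! ### Scores of the linear Gaussian policy -/

section Policy

variable {n m : ℕ} (K : Matrix (Fin m) (Fin n) ℝ) (ℓ : EuclideanSpace ℝ (Fin m))

theorem isPosDiag_policyCov : IsPosDiag (policyCov ℓ) := ⟨_, fun _ => Real.exp_pos _, rfl⟩

theorem policyCov_inv : (policyCov ℓ)⁻¹ = Matrix.diagonal fun i => Real.exp (-(2 * ℓ i)) := by
  refine Matrix.inv_eq_right_inv ?_
  rw [policyCov, diagonal_mul_diagonal, ← diagonal_one]
  congr 1
  ext i
  rw [← Real.exp_add]; simp

theorem log_policyDensity (s : Fin n → ℝ) (a : Fin m → ℝ) :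
    Real.log (policyDensity K ℓ s a) =
      -(m / 2) * Real.log (2 * Real.pi) - ∑ i, ℓ i
        - ∑ i, 1 / 2 * Real.exp (-(2 * ℓ i)) * (a i - (K *ᵥ s) i) ^ 2 := by
  have hdet : (policyCov ℓ).det = Real.exp (2 * ∑ i, ℓ i) := by
    rw [policyCov, det_diagonal, ← Real.exp_sum, Finset.mul_sum]
  have hpi : 0 < (2 * Real.pi) ^ m := by positivity
  rw [policyDensity, Real.log_mul (by rw [hdet]; positivity) (Real.exp_pos _).ne', Real.log_inv,
    Real.log_exp, Real.log_sqrt (by rw [hdet]; positivity), hdet,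
    Real.log_mul hpi.ne' (Real.exp_pos _).ne', Real.log_exp, Real.log_pow, policyCov_inv]
  simp only [dotProduct, mulVec_diagonal, Pi.sub_apply, Finset.mul_sum]
  rw [sub_eq_add_neg _ (∑ i, _), ← Finset.sum_neg_distrib]
  congr 1
  · rw [← Finset.mul_sum]; ring
  · exact Finset.sum_congr rfl fun i _ => by ring

/-- The log density is quadratic in `K`, so its difference at two gains factors exactly and the
Carathéodory criterion applies. -/
theorem scoreK_eq (s : Fin n → ℝ) (a : Fin m → ℝ) :
    scoreK K ℓ s a = vecMulVec ((policyCov ℓ)⁻¹ *ᵥ (a - K *ᵥ s)) s := by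
  have h := hasMatGradientAt_of_sub_eq (K := K)
    (f := fun K' => Real.log (policyDensity K' ℓ s a))
    -- The slope is the residual at the midpoint of `K` and `K'`, from factoring a difference of
    -- squares.
    (g := fun K' => vecMulVec
      (fun i => Real.exp (-(2 * ℓ i)) * (a i - ((K *ᵥ s) i + (K' *ᵥ s) i) / 2)) s)
    (fun K' => by
      rw [log_policyDensity, log_policyDensity, trace_mul_comm, transpose_vecMulVec,
        mul_vecMulVec, trace_vecMulVec, sub_mulVec]
      simp only [dotProduct, Pi.sub_apply]
      rw [sub_sub_sub_cancel_left, ← Finset.sum_sub_distrib]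
      exact Finset.sum_congr rfl fun i _ => by ring)
    (fun i j => by simp only [vecMulVec_apply, mulVec, dotProduct]; fun_prop)
  rw [scoreK, matGradient, HasGradientAt.gradient h, toMat_toEuc, policyCov_inv]
  ext i j
  simp only [vecMulVec_apply, mulVec_diagonal, Pi.sub_apply]
  ring

theorem scoreL_apply (s : Fin n → ℝ) (a : Fin m → ℝ) (i : Fin m) :
    scoreL K ℓ s a i = LQG.dinv ℓ i * (a i - (K *ᵥ s) i) ^ 2 - 1 := by
  have h := hasGradientAt_sum_coord (x := ℓ) (φ := fun i y => -y
      - 1 / 2 * Real.exp (-(2 * y)) * (a i - (K *ᵥ s) i) ^ 2)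
    (φ' := fun i => Real.exp (-(2 * ℓ i)) * (a i - (K *ᵥ s) i) ^ 2 - 1) (fun i => by
      have h1 : HasDerivAt (fun y : ℝ => -(2 * y)) (-(2 * 1)) (ℓ i) :=
        ((hasDerivAt_id (ℓ i)).const_mul 2).neg
      have h2 := ((hasDerivAt_id (ℓ i)).neg).sub
        ((h1.exp.const_mul (1 / 2)).mul_const ((a i - (K *ᵥ s) i) ^ 2))
      refine h2.congr_deriv ?_
      ring)
  have h' : HasGradientAt (fun ℓ' => Real.log (policyDensity K ℓ' s a))
      (WithLp.toLp 2 fun i => Real.exp (-(2 * ℓ i)) * (a i - (K *ᵥ s) i) ^ 2 - 1) ℓ := by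
    have h3 := (hasGradientAt_iff_hasFDerivAt.1 h).const_add (-(m / 2) * Real.log (2 * Real.pi))
    refine hasGradientAt_iff_hasFDerivAt.2 (h3.congr_of_eventuallyEq
      (Filter.Eventually.of_forall fun ℓ' => ?_))
    simp only [log_policyDensity, Finset.sum_sub_distrib, Finset.sum_neg_distrib]
    ring
  rw [scoreL, h'.gradient]
  simp [LQG.dinv, policyCov_inv]

end Policy

/-- The two cross terms are transposes of each other and coincide because `Q` is symmetric; this is
the factor `2` in front of `y` in the return. -/
theorem dotProduct_mulVec_add_add {ι κ τ : Type*} [Fintype ι] [Fintype κ] [Fintype τ]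
    {Q : Matrix τ τ ℝ} (hQ : Qᵀ = Q) (P : Matrix τ ι ℝ) (E : Matrix τ κ ℝ) (u : ι → ℝ)
    (v : κ → ℝ) :
    (P *ᵥ u + E *ᵥ v) ⬝ᵥ (Q *ᵥ (P *ᵥ u + E *ᵥ v)) =
      u ⬝ᵥ ((Pᵀ * Q * P) *ᵥ u) + 2 * (u ⬝ᵥ ((Pᵀ * Q * E) *ᵥ v)) + v ⬝ᵥ ((Eᵀ * Q * E) *ᵥ v) := by
  have h : v ⬝ᵥ (Eᵀ * Q * P) *ᵥ u = u ⬝ᵥ (Pᵀ * Q * E) *ᵥ v := by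
    rw [dotProduct_mulVec_swap]
    simp only [transpose_mul, transpose_transpose, hQ, Matrix.mul_assoc]
  simp only [mulVec_add, add_dotProduct, dotProduct_add, mulVec_dotProduct, mulVec_mulVec,
    ← Matrix.mul_assoc] at h ⊢
  rw [h]
  ring

namespace LQG

variable {n m T : ℕ} (S : LQG n m) (K : Matrix (Fin m) (Fin n) ℝ) (ℓ : EuclideanSpace ℝ (Fin m))

/-! ### Lifted representation -/

theorem state_succ (ω : Sample n m T) (t : ℕ) :
    S.state K ω (t + 1) = S.F K *ᵥ S.state K ω t + S.B *ᵥ noise ω t := by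
  rw [state, F, mulVec_add, add_mulVec, mulVec_mulVec, add_assoc]

theorem noise_coe (ω : Sample n m T) (k : Fin T) : noise ω k = (ω.2 k).ofLp := by
  simp [noise]

/-- Variation of constants for the closed loop. -/
theorem state_eq_sum_range (ω : Sample n m T) (t : ℕ) :
    S.state K ω t = S.F K ^ t *ᵥ ω.1.ofLp +
      ∑ k ∈ Finset.range t, (S.F K ^ (t - 1 - k) * S.B) *ᵥ noise ω k := by
  induction t with
  | zero => simp [state]
  | succ t ih =>
    rw [state_succ, ih, mulVec_add, mulVec_mulVec, ← pow_succ', add_assoc, Finset.sum_range_succ]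
    congr 2
    · rw [mulVec_sum]
      refine Finset.sum_congr rfl fun k hk => ?_
      rw [mulVec_mulVec, ← Matrix.mul_assoc, ← pow_succ']
      have : t - 1 - k + 1 = t + 1 - 1 - k := by
        have := Finset.mem_range.1 hk
        omega
      rw [this]
    · simp

/-- Padding with zero coefficients makes the sum run over all noise blocks, as in the rows of the
lifted matrices. -/
theorem state_eq_sum (ω : Sample n m T) {t : ℕ} (ht : t ≤ T) :
    S.state K ω t = S.F K ^ t *ᵥ ω.1.ofLp +
      ∑ k : Fin T, (if (k : ℕ) < t then S.F K ^ (t - 1 - k) * S.B else 0) *ᵥ (ω.2 k).ofLp := by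
  rw [state_eq_sum_range]
  congr 1
  simp only [← noise_coe]
  rw [Fin.sum_univ_eq_sum_range
    (fun k => (if k < t then S.F K ^ (t - 1 - k) * S.B else 0) *ᵥ noise ω k) T,
    ← Finset.sum_subset (Finset.range_mono ht)]
  · exact Finset.sum_congr rfl fun k hk => by rw [if_pos (Finset.mem_range.1 hk)]
  · intro k _ hk
    rw [if_neg (by simpa using hk), zero_mulVec]

theorem mulVec_stackNoise {κ : Type*} (A : Matrix κ (Fin T × Fin m) ℝ) (ω : Sample n m T) :
    A *ᵥ stackNoise ω = ∑ k : Fin T, (Matrix.of fun i j => A i (k, j)) *ᵥ (ω.2 k).ofLp := by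
  ext i
  simp [mulVec, dotProduct, Fintype.sum_prod_type, stackNoise]

theorem stackState_eq (ω : Sample n m T) :
    S.stackState K ω = S.FS K T *ᵥ ω.1.ofLp + S.FE K T *ᵥ stackNoise ω := by
  ext ⟨t, i⟩
  rw [stackState, S.state_eq_sum K ω t.2.le, mulVec_stackNoise]
  simp only [Pi.add_apply, Finset.sum_apply]
  congr 1
  refine Finset.sum_congr rfl fun k _ => ?_
  simp only [mulVec, dotProduct, FE, of_apply, Fin.lt_def]
  split_ifs <;> simp

theorem stackNext_eq (ω : Sample n m T) :
    S.stackNext K ω = S.FSnext K T *ᵥ ω.1.ofLp + S.FEnext K T *ᵥ stackNoise ω := by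
  ext ⟨t, i⟩
  rw [stackNext, S.state_eq_sum K ω (Nat.succ_le_of_lt t.2), mulVec_stackNoise]
  simp only [Pi.add_apply, Finset.sum_apply]
  congr 1
  refine Finset.sum_congr rfl fun k _ => ?_
  simp only [mulVec, dotProduct, FEnext, of_apply, Fin.le_def, Nat.lt_succ_iff]
  split_ifs <;> simp

theorem stackAction_eq (ω : Sample n m T) :
    S.stackAction K ω = S.KS K T *ᵥ ω.1.ofLp + S.KE K T *ᵥ stackNoise ω := by
  ext ⟨t, i⟩
  rw [stackAction, action, S.state_eq_sum K ω t.2.le, mulVec_stackNoise, mulVec_add, mulVec_sum,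
    mulVec_mulVec]
  simp only [Pi.add_apply, Finset.sum_apply, add_assoc]
  congr 1
  have h : noise ω t i = ∑ k : Fin T, if k = t then (ω.2 k).ofLp i else 0 := by
    simp [noise_coe]
  rw [h, ← Finset.sum_add_distrib]
  refine Finset.sum_congr rfl fun k _ => ?_
  rw [mulVec_mulVec]
  simp only [mulVec, dotProduct, KE, of_apply, Fin.lt_def]
  rcases lt_trichotomy k t with hk | hk | hk
  · simp [hk, hk.ne, Matrix.mul_assoc]
  · subst hk
    simp [Matrix.one_apply]
  · simp [hk.ne', not_lt.2 hk.le]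

theorem sum_dotProduct_eq_kronecker {d : ℕ} (Q : Matrix (Fin d) (Fin d) ℝ)
    (x : Fin T → Fin d → ℝ) :
    ∑ t : Fin T, S.gamma ^ (t : ℕ) * (x t ⬝ᵥ (Q *ᵥ x t)) =
      (fun q : Fin T × Fin d => x q.1 q.2) ⬝ᵥ
        ((S.Dgamma T ⊗ₖ Q) *ᵥ fun q : Fin T × Fin d => x q.1 q.2) := by
  simp only [dotProduct, mulVec, Fintype.sum_prod_type, kroneckerMap_apply, Dgamma, diagonal_apply,
    Finset.mul_sum]
  refine Finset.sum_congr rfl fun t _ => Finset.sum_congr rfl fun i _ => ?_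
  rw [Finset.sum_eq_single t]
  · exact Finset.sum_congr rfl fun j _ => by rw [if_pos rfl]; ring
  · intro p _ hp
    exact Finset.sum_eq_zero fun j _ => by rw [if_neg hp.symm]; ring
  · simp

theorem kronecker_transpose_eq {d : ℕ} {Q : Matrix (Fin d) (Fin d) ℝ} (hQ : Qᵀ = Q) :
    (S.Dgamma T ⊗ₖ Q)ᵀ = S.Dgamma T ⊗ₖ Q := by
  rw [← kroneckerMap_transpose, hQ, Dgamma, diagonal_transpose]

theorem ret_eq (hQs : S.Qsᵀ = S.Qs) (hQa : S.Qaᵀ = S.Qa) (ω : Sample n m T) :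
    S.ret K ω = -(ω.1.ofLp ⬝ᵥ (S.Mss K T *ᵥ ω.1.ofLp)
        + 2 * (ω.1.ofLp ⬝ᵥ (S.Mse K T *ᵥ stackNoise ω))
        + stackNoise ω ⬝ᵥ (S.Mee K T *ᵥ stackNoise ω)) := by
  have h : S.ret K ω = -(S.stackNext K ω ⬝ᵥ (S.QsLift T *ᵥ S.stackNext K ω)
      + S.stackAction K ω ⬝ᵥ (S.QaLift T *ᵥ S.stackAction K ω)) := by
    unfold stackNext stackAction QsLift QaLift
    rw [← S.sum_dotProduct_eq_kronecker S.Qs (fun t => S.state K ω (t + 1)),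
      ← S.sum_dotProduct_eq_kronecker S.Qa (fun t => S.action K ω t), ← Finset.sum_add_distrib,
      ← Finset.sum_neg_distrib, ret]
    exact Finset.sum_congr rfl fun t _ => by rw [reward]; ring
  rw [h, stackNext_eq, stackAction_eq,
    dotProduct_mulVec_add_add (Q := S.QsLift T) (S.kronecker_transpose_eq hQs),
    dotProduct_mulVec_add_add (Q := S.QaLift T) (S.kronecker_transpose_eq hQa), Mss, Mse, Mee]
  simp only [add_mulVec, dotProduct_add]
  ring

/-! ### The law of the initial state and the stacked noise -/

theorem covLift_eq_diagonal :
    covLift ℓ T = Matrix.diagonal fun q : Fin T × Fin m => Real.exp (2 * ℓ q.2) := by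
  rw [covLift, policyCov, ← diagonal_one, diagonal_kronecker_diagonal]
  simp

theorem isPosDiag_covLift : IsPosDiag (covLift ℓ T) :=
  ⟨_, fun _ => Real.exp_pos _, covLift_eq_diagonal ℓ⟩

theorem _root_.IsPosDiag.posSemidef {ι : Type*} [DecidableEq ι] {Ω : Matrix ι ι ℝ}
    (hΩ : IsPosDiag Ω) : Ω.PosSemidef := by
  obtain ⟨v, hv, rfl⟩ := hΩ
  exact PosSemidef.diagonal fun i => (hv i).le

/-- Independent blocks with covariance `Σ` and one Gaussian with covariance `I ⊗ Σ` have the same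
characteristic function: the product over blocks is the exponential of the same double sum. -/
theorem measurePreserving_stack :
    MeasurePreserving (fun ε : Fin T → EuclideanSpace ℝ (Fin m) =>
        (WithLp.toLp 2 fun q : Fin T × Fin m => ε q.1 q.2 : EuclideanSpace ℝ (Fin T × Fin m)))
      (Measure.pi fun _ : Fin T => multivariateGaussian 0 (policyCov ℓ))
      (multivariateGaussian 0 (covLift ℓ T)) := by
  have hmeas : Measurable (fun ε : Fin T → EuclideanSpace ℝ (Fin m) =>
      (WithLp.toLp 2 fun q : Fin T × Fin m => ε q.1 q.2 : EuclideanSpace ℝ (Fin T × Fin m))) := by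
    fun_prop
  refine ⟨hmeas, ?_⟩
  have := Measure.isProbabilityMeasure_map
    (μ := Measure.pi fun _ : Fin T => multivariateGaussian 0 (policyCov ℓ)) hmeas.aemeasurable
  apply Measure.ext_of_charFun
  ext θ
  have h := charFun_pi (μ := fun _ : Fin T => multivariateGaussian 0 (policyCov ℓ))
    (WithLp.toLp 2 fun t => WithLp.toLp 2 fun i => θ (t, i))
  have h2 : charFun ((Measure.pi fun _ : Fin T => multivariateGaussian 0 (policyCov ℓ)).map
      fun ε : Fin T → EuclideanSpace ℝ (Fin m) => (WithLp.toLp 2 fun q : Fin T × Fin m =>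
        ε q.1 q.2 : EuclideanSpace ℝ (Fin T × Fin m))) θ =
      charFun ((Measure.pi fun _ : Fin T => multivariateGaussian 0 (policyCov ℓ)).map
        (WithLp.toLp 2)) (WithLp.toLp 2 fun t => WithLp.toLp 2 fun i => θ (t, i)) := by
    rw [charFun_apply, charFun_apply, integral_map hmeas.aemeasurable (by fun_prop),
      integral_map (by fun_prop) (by fun_prop)]
    simp [PiLp.inner_apply, Fintype.sum_prod_type]
  rw [h2, h, charFun_multivariateGaussian (isPosDiag_covLift ℓ).posSemidef]
  simp_rw [charFun_multivariateGaussian (isPosDiag_policyCov ℓ).posSemidef]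
  rw [← Complex.exp_sum, covLift_eq_diagonal]
  congr 1
  simp [dotProduct, mulVec_diagonal, policyCov, Fintype.sum_prod_type, Finset.sum_div]

/-- The pair of the initial state and the stacked noise. -/
noncomputable def lift (ω : Sample n m T) :
    EuclideanSpace ℝ (Fin n) × EuclideanSpace ℝ (Fin T × Fin m) :=
  (ω.1, WithLp.toLp 2 (stackNoise ω))

theorem measurePreserving_lift : MeasurePreserving lift (S.law ℓ T)
    ((multivariateGaussian 0 S.Sigma0).prod (multivariateGaussian 0 (covLift ℓ T))) :=
  (MeasurePreserving.id _).prod (measurePreserving_stack ℓ)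

instance : IsProbabilityMeasure (S.law ℓ T) := by
  unfold law
  infer_instance

theorem allLp_init (i : Fin n) : AllLp (fun ω : Sample n m T => ω.1.ofLp i) (S.law ℓ T) :=
  (AllLp.multivariateGaussian_coord 0 S.Sigma0 i).comp_measurePreserving
    (φ := fun ω : Sample n m T => ω.1) measurePreserving_fst

theorem allLp_stackNoise (q : Fin T × Fin m) :
    AllLp (fun ω : Sample n m T => stackNoise ω q) (S.law ℓ T) :=
  (AllLp.multivariateGaussian_coord 0 (covLift ℓ T) q).comp_measurePreserving
    (φ := fun ω : Sample n m T => (lift ω).2)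
    (measurePreserving_snd.comp (S.measurePreserving_lift ℓ))

theorem allLp_noise (t : ℕ) (i : Fin m) :
    AllLp (fun ω : Sample n m T => noise ω t i) (S.law ℓ T) := by
  by_cases h : t < T
  · simpa [noise, h, stackNoise] using S.allLp_stackNoise ℓ (⟨t, h⟩, i)
  · simpa [noise, h] using AllLp.const (μ := S.law ℓ T) 0

theorem allLp_state (t : ℕ) (i : Fin n) :
    AllLp (fun ω : Sample n m T => S.state K ω t i) (S.law ℓ T) := by
  induction t generalizing i with
  | zero => exact S.allLp_init ℓ i
  | succ t ih =>
    simp only [state_succ, Pi.add_apply]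
    exact (AllLp.mulVec _ ih i).add (AllLp.mulVec _ (S.allLp_noise ℓ t) i)

theorem allLp_action (t : ℕ) (i : Fin m) :
    AllLp (fun ω : Sample n m T => S.action K ω t i) (S.law ℓ T) :=
  (AllLp.mulVec K (S.allLp_state K ℓ t) i).add (S.allLp_noise ℓ t i)

theorem allLp_ret : AllLp (fun ω : Sample n m T => S.ret K ω) (S.law ℓ T) :=
  AllLp.sum _ fun _ _ => AllLp.const_mul (AllLp.neg (AllLp.add
    (AllLp.dotProduct (S.allLp_state K ℓ _) (AllLp.mulVec _ (S.allLp_state K ℓ _)))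
    (AllLp.dotProduct (S.allLp_action K ℓ _) (AllLp.mulVec _ (S.allLp_action K ℓ _))))) _

theorem action_sub (ω : Sample n m T) (t : ℕ) :
    S.action K ω t - K *ᵥ S.state K ω t = noise ω t := by
  simp [action]

theorem policyCov_inv_mulVec (x : Fin m → ℝ) (i : Fin m) :
    ((policyCov ℓ)⁻¹ *ᵥ x) i = dinv ℓ i * x i := by
  simp [policyCov_inv, dinv, mulVec_diagonal]

/-- The residual `a_t - K s_t` is the noise, so the estimator is a polynomial in the sample. The
noise factor is kept in front, ready for integration by parts. -/
theorem estK_apply (ω : Sample n m T) (i : Fin m) (j : Fin n) :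
    S.estK K ℓ ω i j =
      ∑ t : Fin T, dinv ℓ i * (noise ω t i * (S.state K ω t j * S.ret K ω)) := by
  simp only [estK, scoreK_eq, action_sub, Matrix.smul_apply, Matrix.sum_apply, vecMulVec_apply,
    policyCov_inv_mulVec, smul_eq_mul, Finset.mul_sum]
  exact Finset.sum_congr rfl fun t _ => by ring

theorem estL_apply (ω : Sample n m T) (i : Fin m) :
    S.estL K ℓ ω i = ∑ t : Fin T, (dinv ℓ i * noise ω t i ^ 2 - 1) * S.ret K ω := by
  have h : ∀ (f : Fin T → EuclideanSpace ℝ (Fin m)), (∑ t, f t) i = ∑ t, f t i := by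
    intro f; simp
  have h2 : ∀ t : Fin T, S.action K ω t i - (K *ᵥ S.state K ω t) i = noise ω t i := fun t => by
    rw [← S.action_sub K ω t]; rfl
  simp only [estL, PiLp.smul_apply, h, scoreL_apply, h2, smul_eq_mul, Finset.mul_sum]
  exact Finset.sum_congr rfl fun t _ => by ring

theorem allLp_estK (i : Fin m) (j : Fin n) :
    AllLp (fun ω : Sample n m T => S.estK K ℓ ω i j) (S.law ℓ T) := by
  simp only [estK_apply]
  exact AllLp.sum _ fun t _ => ((S.allLp_noise ℓ t i).mul
    ((S.allLp_state K ℓ t j).mul (S.allLp_ret K ℓ))).const_mul _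

theorem allLp_estL (i : Fin m) :
    AllLp (fun ω : Sample n m T => S.estL K ℓ ω i) (S.law ℓ T) := by
  simp only [estL_apply]
  exact AllLp.sum _ fun t _ => ((((S.allLp_noise ℓ t i).pow 2).const_mul _).sub
    (AllLp.const 1)).mul (S.allLp_ret K ℓ)

end LQG

/-! ### Integrating over the noise with the initial state fixed -/

section GaussianQuadratics

open MvPolynomial

variable {ι κ : Type*} [Fintype ι] [Fintype κ]

theorem eval_neg_linPoly (a x : ι → ℝ) : eval (-x) (linPoly a) = -eval x (linPoly a) := by
  simp [eval_linPoly]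

theorem eval_neg_quadPoly (A : Matrix ι ι ℝ) (x : ι → ℝ) :
    eval (-x) (quadPoly A) = eval x (quadPoly A) := by
  simp [eval_quadPoly, mulVec_neg]

theorem transpose_mulVec_dotProduct_mulVec (M N : Matrix κ ι ℝ) (A : Matrix ι ι ℝ) (s : κ → ℝ) :
    (Mᵀ *ᵥ s) ⬝ᵥ A *ᵥ (Nᵀ *ᵥ s) = eval s (quadPoly (M * A * Nᵀ)) := by
  rw [eval_quadPoly, mulVec_dotProduct, transpose_transpose, mulVec_mulVec, mulVec_mulVec,
    Matrix.mul_assoc]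

theorem quadPoly_mul_symPart_mul (M : Matrix κ ι ℝ) (A : Matrix ι ι ℝ) :
    quadPoly (M * symPart A * Mᵀ) = quadPoly (M * A * Mᵀ) := by
  have : M * symPart A * Mᵀ = symPart (M * A * Mᵀ) := by
    simp only [symPart, transpose_mul, transpose_transpose, Matrix.mul_smul, Matrix.smul_mul,
      Matrix.mul_add, Matrix.add_mul, Matrix.mul_assoc]
  rw [this, quadPoly_symPart]

variable [DecidableEq ι] [DecidableEq κ]

/-- Expand the square: with an even weight, the terms with a single factor `linPoly v` are odd and
drop out. -/
theorem gaussMoment_even_mul_sq {Ω : Matrix ι ι ℝ} (hΩ : IsPosDiag Ω) {c : MvPolynomial ι ℝ}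
    (hc : ∀ x, eval (-x) c = eval x c) (x : ℝ) (v : ι → ℝ) (Z : Matrix ι ι ℝ) :
    gaussMoment Ω (c * (C x + 2 * linPoly v + quadPoly Z) ^ 2) =
      x ^ 2 * gaussMoment Ω c + 4 * gaussMoment Ω (c * (linPoly v * linPoly v))
        + gaussMoment Ω (c * quadPoly Z * quadPoly Z) + 2 * x * gaussMoment Ω (c * quadPoly Z) := by
  have e : c * (C x + 2 * linPoly v + quadPoly Z) ^ 2 =
      (x ^ 2) • c + (4 : ℝ) • (c * (linPoly v * linPoly v)) + c * quadPoly Z * quadPoly Z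
        + (2 * x) • (c * quadPoly Z) + (4 : ℝ) • (c * linPoly v * (C x + quadPoly Z)) := by
    simp only [smul_eq_C_mul, C_mul, C_pow, map_ofNat]; ring
  have h0 : gaussMoment Ω (c * linPoly v * (C x + quadPoly Z)) = 0 := by
    refine gaussMoment_eq_zero_of_odd hΩ fun y => ?_
    simp only [map_mul, map_add, eval_C, eval_neg_linPoly, eval_neg_quadPoly, hc]
    ring
  rw [e]
  simp only [map_add, map_smul, smul_eq_mul, h0, mul_zero, add_zero]

/-- The extra linear factor reverses the parity: now exactly the terms with a single `linPoly v`
survive. -/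
theorem gaussMoment_even_mul_lin_mul_sq {Ω : Matrix ι ι ℝ} (hΩ : IsPosDiag Ω)
    {c : MvPolynomial ι ℝ} (hc : ∀ x, eval (-x) c = eval x c) (h : ι → ℝ) (x : ℝ) (v : ι → ℝ)
    (Z : Matrix ι ι ℝ) :
    gaussMoment Ω (c * linPoly h * (C x + 2 * linPoly v + quadPoly Z) ^ 2) =
      4 * x * gaussMoment Ω (c * (linPoly v * linPoly h))
        + 4 * gaussMoment Ω (c * quadPoly Z * (linPoly v * linPoly h)) := by
  have e : c * linPoly h * (C x + 2 * linPoly v + quadPoly Z) ^ 2 =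
      (4 * x) • (c * (linPoly v * linPoly h))
        + (4 : ℝ) • (c * quadPoly Z * (linPoly v * linPoly h))
        + c * linPoly h * (C x ^ 2 + 4 * (linPoly v * linPoly v) + quadPoly Z ^ 2
          + 2 * C x * quadPoly Z) := by
    simp only [smul_eq_C_mul, C_mul, map_ofNat]; ring
  have h0 : gaussMoment Ω (c * linPoly h * (C x ^ 2 + 4 * (linPoly v * linPoly v) + quadPoly Z ^ 2
          + 2 * C x * quadPoly Z)) = 0 := by
    refine gaussMoment_eq_zero_of_odd hΩ fun y => ?_
    simp only [map_mul, map_add, map_pow, eval_C, eval_neg_linPoly, eval_neg_quadPoly, hc,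
      map_ofNat]
    ring
  rw [e]
  simp only [map_add, map_smul, smul_eq_mul, h0, add_zero]

/-- Fubini. Since the inner integral is again a polynomial, nothing is asked of `Ω₀`. -/
theorem integral_prod_eq_gaussMoment {Ω₀ : Matrix κ κ ℝ} {Ω : Matrix ι ι ℝ}
    {f : EuclideanSpace ℝ κ × EuclideanSpace ℝ ι → ℝ}
    (hf : Integrable f ((multivariateGaussian 0 Ω₀).prod (multivariateGaussian 0 Ω)))
    {P : (κ → ℝ) → MvPolynomial ι ℝ} {Q : MvPolynomial κ ℝ}
    (hP : ∀ x, f x = eval x.2.ofLp (P x.1.ofLp)) (hQ : ∀ s, gaussMoment Ω (P s) = eval s Q) :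
    ∫ x, f x ∂((multivariateGaussian 0 Ω₀).prod (multivariateGaussian 0 Ω)) =
      gaussMoment Ω₀ Q := by
  rw [integral_prod _ hf, gaussMoment_apply]
  refine integral_congr_ae (Filter.Eventually.of_forall fun s => ?_)
  simp only [hP, ← hQ]
  rfl

/-- With `R² = (x + 2y + z)²`, the first four groups come from `x²`, `z²`, `2xz` and `4y²` against
the even factors `G` and `U`. The last two come from `4xy` and `4yz` against the odd factor `N`. -/
theorem integral_quadratic_score_sq {Ω₀ : Matrix κ κ ℝ} {Ω : Matrix ι ι ℝ} (hΩ : IsPosDiag Ω)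
    (W U Z : Matrix ι ι ℝ) (G X : Matrix κ κ ℝ) (N M : Matrix κ ι ℝ)
    (hint : Integrable (fun y : EuclideanSpace ℝ κ × EuclideanSpace ℝ ι =>
      (y.2.ofLp ⬝ᵥ W *ᵥ y.2.ofLp) * (y.1.ofLp ⬝ᵥ G *ᵥ y.1.ofLp + y.1.ofLp ⬝ᵥ N *ᵥ y.2.ofLp
        + y.2.ofLp ⬝ᵥ U *ᵥ y.2.ofLp) * (y.1.ofLp ⬝ᵥ X *ᵥ y.1.ofLp
          + 2 * (y.1.ofLp ⬝ᵥ M *ᵥ y.2.ofLp) + y.2.ofLp ⬝ᵥ Z *ᵥ y.2.ofLp) ^ 2)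
      ((multivariateGaussian 0 Ω₀).prod (multivariateGaussian 0 Ω))) :
    ∫ y, (y.2.ofLp ⬝ᵥ W *ᵥ y.2.ofLp) * (y.1.ofLp ⬝ᵥ G *ᵥ y.1.ofLp + y.1.ofLp ⬝ᵥ N *ᵥ y.2.ofLp
        + y.2.ofLp ⬝ᵥ U *ᵥ y.2.ofLp) * (y.1.ofLp ⬝ᵥ X *ᵥ y.1.ofLp
          + 2 * (y.1.ofLp ⬝ᵥ M *ᵥ y.2.ofLp) + y.2.ofLp ⬝ᵥ Z *ᵥ y.2.ofLp) ^ 2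
      ∂((multivariateGaussian 0 Ω₀).prod (multivariateGaussian 0 Ω)) =
    (gaussIS Ω₀ [symPart G, symPart X, symPart X] * gaussIS Ω [symPart W]
      + gaussIS Ω₀ [symPart X, symPart X] * gaussIS Ω [symPart W, symPart U])
    + (gaussIS Ω₀ [symPart G] * gaussIS Ω [symPart W, symPart Z, symPart Z]
      + gaussIS Ω [symPart W, symPart U, symPart Z, symPart Z])
    + (2 * gaussIS Ω₀ [symPart G, symPart X] * gaussIS Ω [symPart W, symPart Z]
      + 2 * gaussIS Ω₀ [symPart X] * gaussIS Ω [symPart W, symPart U, symPart Z])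
    + 4 * ((Ω * symPart W).trace * gaussIS Ω₀ [symPart G, M * Ω * Mᵀ]
      + 2 * gaussIS Ω₀ [symPart G, M * (Ω * symPart W * Ω) * Mᵀ]
      + ((Ω * symPart W).trace * (Ω * symPart U).trace
          + 2 * (Ω * symPart W * Ω * symPart U).trace) * gaussIS Ω₀ [M * Ω * Mᵀ]
      + 2 * (Ω * symPart U).trace * gaussIS Ω₀ [M * (Ω * symPart W * Ω) * Mᵀ]
      + 2 * (Ω * symPart W).trace * gaussIS Ω₀ [M * (Ω * symPart U * Ω) * Mᵀ]
      + 8 * gaussIS Ω₀ [symPart (M * (Ω * symPart W * Ω * symPart U * Ω) * Mᵀ)])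
    + 4 * ((Ω * symPart W).trace * gaussIS Ω₀ [symPart X, symPart (M * Ω * Nᵀ)]
      + 2 * gaussIS Ω₀ [symPart X, symPart (M * (Ω * symPart W * Ω) * Nᵀ)])
    + 4 * (((Ω * symPart W).trace * (Ω * symPart Z).trace
          + 2 * (Ω * symPart W * Ω * symPart Z).trace) * gaussIS Ω₀ [symPart (M * Ω * Nᵀ)]
      + 2 * (Ω * symPart Z).trace * gaussIS Ω₀ [symPart (M * (Ω * symPart W * Ω) * Nᵀ)]
      + 2 * (Ω * symPart W).trace * gaussIS Ω₀ [symPart (M * (Ω * symPart Z * Ω) * Nᵀ)]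
      + 8 * gaussIS Ω₀ [symPart (M * symPart (Ω * symPart W * Ω * symPart Z * Ω) * Nᵀ)]) := by
  set W' := symPart W with hW'
  set U' := symPart U with hU'
  set Z' := symPart Z with hZ'
  have tW : W'ᵀ = W' := symPart_transpose W
  have tU : U'ᵀ = U' := symPart_transpose U
  have tZ : Z'ᵀ = Z' := symPart_transpose Z
  have evW : ∀ x, eval (-x) (quadPoly W') = eval x (quadPoly W') := eval_neg_quadPoly W'
  have evWU : ∀ x, eval (-x) (quadPoly W' * quadPoly U') = eval x (quadPoly W' * quadPoly U') :=
    fun x => by simp only [map_mul, eval_neg_quadPoly]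
  -- `P` is the integrand as a polynomial in the noise, split according to the factors `G`, `N` and
  -- `U`; `Q` is its noise average as a polynomial in the initial state.
  rw [integral_prod_eq_gaussMoment hint (P := fun s =>
      (s ⬝ᵥ G *ᵥ s) • (quadPoly W' * (C (s ⬝ᵥ X *ᵥ s) + 2 * linPoly (Mᵀ *ᵥ s) + quadPoly Z') ^ 2)
      + quadPoly W' * linPoly (Nᵀ *ᵥ s)
        * (C (s ⬝ᵥ X *ᵥ s) + 2 * linPoly (Mᵀ *ᵥ s) + quadPoly Z') ^ 2
      + quadPoly W' * quadPoly U'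
        * (C (s ⬝ᵥ X *ᵥ s) + 2 * linPoly (Mᵀ *ᵥ s) + quadPoly Z') ^ 2)
    (Q := gaussIS Ω [W'] • (quadPoly G * quadPoly X * quadPoly X)
      + gaussIS Ω [W', U'] • (quadPoly X * quadPoly X)
      + gaussIS Ω [W', Z', Z'] • quadPoly G + C (gaussIS Ω [W', U', Z', Z'])
      + (2 * gaussIS Ω [W', Z']) • (quadPoly G * quadPoly X)
      + (2 * gaussIS Ω [W', U', Z']) • quadPoly X
      + (4 : ℝ) • ((Ω * W').trace • (quadPoly G * quadPoly (M * Ω * Mᵀ))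
        + (2 : ℝ) • (quadPoly G * quadPoly (M * (Ω * W' * Ω) * Mᵀ))
        + ((Ω * W').trace * (Ω * U').trace + 2 * (Ω * W' * Ω * U').trace) • quadPoly (M * Ω * Mᵀ)
        + (2 * (Ω * U').trace) • quadPoly (M * (Ω * W' * Ω) * Mᵀ)
        + (2 * (Ω * W').trace) • quadPoly (M * (Ω * U' * Ω) * Mᵀ)
        + (8 : ℝ) • quadPoly (M * symPart (Ω * W' * Ω * U' * Ω) * Mᵀ))
      + (4 : ℝ) • ((Ω * W').trace • (quadPoly X * quadPoly (M * Ω * Nᵀ))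
        + (2 : ℝ) • (quadPoly X * quadPoly (M * (Ω * W' * Ω) * Nᵀ)))
      + (4 : ℝ) • (((Ω * W').trace * (Ω * Z').trace + 2 * (Ω * W' * Ω * Z').trace)
          • quadPoly (M * Ω * Nᵀ)
        + (2 * (Ω * Z').trace) • quadPoly (M * (Ω * W' * Ω) * Nᵀ)
        + (2 * (Ω * W').trace) • quadPoly (M * (Ω * Z' * Ω) * Nᵀ)
        + (8 : ℝ) • quadPoly (M * symPart (Ω * W' * Ω * Z' * Ω) * Nᵀ)))]
  -- The Wick formula symmetrises inside the sandwich by `M`, the statement outside; the quadratic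
  -- forms are the same.
  · simp only [quadPoly_mul_symPart_mul M]
    simp only [map_add, map_smul, smul_eq_mul, gaussMoment_C, gaussIS_eq_gaussMoment,
      List.map_cons, List.map_nil, List.prod_cons, List.prod_nil, mul_one, quadPoly_symPart,
      mul_assoc]
    ring
  · intro y
    simp only [map_add, map_mul, map_pow, map_ofNat, smul_eval, eval_C, eval_linPoly,
      mulVec_dotProduct, transpose_transpose]
    simp only [hW', hU', hZ', quadPoly_symPart, eval_quadPoly]
    ring
  · intro s
    simp only [map_add, map_smul]
    rw [gaussMoment_even_mul_sq hΩ evW, gaussMoment_even_mul_sq hΩ evWU,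
      gaussMoment_even_mul_lin_mul_sq hΩ evW]
    simp only [gaussMoment_quad_lin_lin hΩ tW, gaussMoment_quad_quad_lin_lin hΩ tW tU,
      gaussMoment_quad_quad_lin_lin hΩ tW tZ, transpose_mulVec_dotProduct_mulVec]
    simp only [gaussIS_eq_gaussMoment, smul_eq_mul, map_add, map_mul, smul_eval, eval_C,
      List.map_cons, List.map_nil, List.prod_cons, List.prod_nil, mul_one,
      ← eval_quadPoly, ← mul_assoc]
    ring

end GaussianQuadratics

/-! ### Integrability of the squared estimators, and the integral with centred scores -/

section GaussianQuadratics

open MvPolynomial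

variable {ι κ : Type*} [Fintype ι] [Fintype κ]

/-- The source of `G`, `N` and `U`, applied to the inner product of two states. -/
theorem dotProduct_add_mulVec_add {τ : Type*} [Fintype τ] (F F' : Matrix τ κ ℝ)
    (E E' : Matrix τ ι ℝ) (s : κ → ℝ) (e : ι → ℝ) :
    (F *ᵥ s + E *ᵥ e) ⬝ᵥ (F' *ᵥ s + E' *ᵥ e) =
      s ⬝ᵥ (Fᵀ * F') *ᵥ s + s ⬝ᵥ (Fᵀ * E' + F'ᵀ * E) *ᵥ e + e ⬝ᵥ (Eᵀ * E') *ᵥ e := by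
  have h : (E *ᵥ e) ⬝ᵥ (F' *ᵥ s) = s ⬝ᵥ (F'ᵀ * E) *ᵥ e := by
    rw [dotProduct_comm, mulVec_dotProduct, mulVec_mulVec]
  rw [add_dotProduct, dotProduct_add, dotProduct_add, h]
  simp only [mulVec_dotProduct, mulVec_mulVec, add_mulVec, dotProduct_add]
  ring

variable [DecidableEq ι] [DecidableEq κ]

theorem allLp_quadratic_fst (Ω₀ : Matrix κ κ ℝ) (Ω : Matrix ι ι ℝ) (A : Matrix κ κ ℝ) :
    AllLp (fun y : EuclideanSpace ℝ κ × EuclideanSpace ℝ ι => y.1.ofLp ⬝ᵥ A *ᵥ y.1.ofLp)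
      ((multivariateGaussian 0 Ω₀).prod (multivariateGaussian 0 Ω)) := by
  have h := fun i => (AllLp.multivariateGaussian_coord 0 Ω₀ i).comp_measurePreserving
    (measurePreserving_fst (μ := multivariateGaussian 0 Ω₀) (ν := multivariateGaussian 0 Ω))
  exact AllLp.dotProduct h (AllLp.mulVec A h)

theorem allLp_quadratic_snd (Ω₀ : Matrix κ κ ℝ) (Ω : Matrix ι ι ℝ) (A : Matrix ι ι ℝ) :
    AllLp (fun y : EuclideanSpace ℝ κ × EuclideanSpace ℝ ι => y.2.ofLp ⬝ᵥ A *ᵥ y.2.ofLp)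
      ((multivariateGaussian 0 Ω₀).prod (multivariateGaussian 0 Ω)) := by
  have h := fun i => (AllLp.multivariateGaussian_coord 0 Ω i).comp_measurePreserving
    (measurePreserving_snd (μ := multivariateGaussian 0 Ω₀) (ν := multivariateGaussian 0 Ω))
  exact AllLp.dotProduct h (AllLp.mulVec A h)

theorem allLp_bilinear (Ω₀ : Matrix κ κ ℝ) (Ω : Matrix ι ι ℝ) (A : Matrix κ ι ℝ) :
    AllLp (fun y : EuclideanSpace ℝ κ × EuclideanSpace ℝ ι => y.1.ofLp ⬝ᵥ A *ᵥ y.2.ofLp)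
      ((multivariateGaussian 0 Ω₀).prod (multivariateGaussian 0 Ω)) := by
  have h := fun i => (AllLp.multivariateGaussian_coord 0 Ω₀ i).comp_measurePreserving
    (measurePreserving_fst (μ := multivariateGaussian 0 Ω₀) (ν := multivariateGaussian 0 Ω))
  have h' := fun i => (AllLp.multivariateGaussian_coord 0 Ω i).comp_measurePreserving
    (measurePreserving_snd (μ := multivariateGaussian 0 Ω₀) (ν := multivariateGaussian 0 Ω))
  exact AllLp.dotProduct h (AllLp.mulVec A h')

theorem allLp_quadratic_score_sq (Ω₀ : Matrix κ κ ℝ) (Ω : Matrix ι ι ℝ)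
    (W U Z : Matrix ι ι ℝ) (G X : Matrix κ κ ℝ) (N M : Matrix κ ι ℝ) :
    AllLp (fun y : EuclideanSpace ℝ κ × EuclideanSpace ℝ ι =>
      (y.2.ofLp ⬝ᵥ W *ᵥ y.2.ofLp) * (y.1.ofLp ⬝ᵥ G *ᵥ y.1.ofLp + y.1.ofLp ⬝ᵥ N *ᵥ y.2.ofLp
        + y.2.ofLp ⬝ᵥ U *ᵥ y.2.ofLp) * (y.1.ofLp ⬝ᵥ X *ᵥ y.1.ofLp
          + 2 * (y.1.ofLp ⬝ᵥ M *ᵥ y.2.ofLp) + y.2.ofLp ⬝ᵥ Z *ᵥ y.2.ofLp) ^ 2)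
      ((multivariateGaussian 0 Ω₀).prod (multivariateGaussian 0 Ω)) :=
  ((allLp_quadratic_snd Ω₀ Ω W).mul (((allLp_quadratic_fst Ω₀ Ω G).add
    (allLp_bilinear Ω₀ Ω N)).add (allLp_quadratic_snd Ω₀ Ω U))).mul
    ((((allLp_quadratic_fst Ω₀ Ω X).add ((allLp_bilinear Ω₀ Ω M).const_mul 2)).add
      (allLp_quadratic_snd Ω₀ Ω Z)).pow 2)

theorem allLp_centered_score_sq (Ω₀ : Matrix κ κ ℝ) (Ω : Matrix ι ι ℝ) (d : ℝ)
    (Q Q' Z : Matrix ι ι ℝ) (X : Matrix κ κ ℝ) (M : Matrix κ ι ℝ) :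
    AllLp (fun y : EuclideanSpace ℝ κ × EuclideanSpace ℝ ι =>
      (d * (y.2.ofLp ⬝ᵥ Q *ᵥ y.2.ofLp) - 1) * (d * (y.2.ofLp ⬝ᵥ Q' *ᵥ y.2.ofLp) - 1)
        * (y.1.ofLp ⬝ᵥ X *ᵥ y.1.ofLp + 2 * (y.1.ofLp ⬝ᵥ M *ᵥ y.2.ofLp)
          + y.2.ofLp ⬝ᵥ Z *ᵥ y.2.ofLp) ^ 2)
      ((multivariateGaussian 0 Ω₀).prod (multivariateGaussian 0 Ω)) :=
  ((((allLp_quadratic_snd Ω₀ Ω Q).const_mul d).sub (AllLp.const 1)).mul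
    (((allLp_quadratic_snd Ω₀ Ω Q').const_mul d).sub (AllLp.const 1))).mul
    ((((allLp_quadratic_fst Ω₀ Ω X).add ((allLp_bilinear Ω₀ Ω M).const_mul 2)).add
      (allLp_quadratic_snd Ω₀ Ω Z)).pow 2)

/-- `hQ` and `hQ'` say that both scores have mean zero. So in the Wick expansion every term in which
a score is contracted only with itself cancels, leaving `2τ` and the chain through both scores. The
coefficients `8` and `32` are the `4` of `4y²` times `2` and `8`. -/
theorem integral_centered_score_sq {Ω₀ : Matrix κ κ ℝ} {Ω : Matrix ι ι ℝ} (hΩ : IsPosDiag Ω)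
    {Q Q' : Matrix ι ι ℝ} (tQ : Qᵀ = Q) (tQ' : Q'ᵀ = Q') {d τ : ℝ}
    (hQ : d * (Ω * Q).trace = 1) (hQ' : d * (Ω * Q').trace = 1)
    (hτ : d ^ 2 * (Ω * Q * Ω * Q').trace = τ)
    (Z : Matrix ι ι ℝ) (X : Matrix κ κ ℝ) (M : Matrix κ ι ℝ) :
    ∫ y, (d * (y.2.ofLp ⬝ᵥ Q *ᵥ y.2.ofLp) - 1) * (d * (y.2.ofLp ⬝ᵥ Q' *ᵥ y.2.ofLp) - 1)
        * (y.1.ofLp ⬝ᵥ X *ᵥ y.1.ofLp + 2 * (y.1.ofLp ⬝ᵥ M *ᵥ y.2.ofLp)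
          + y.2.ofLp ⬝ᵥ Z *ᵥ y.2.ofLp) ^ 2
      ∂((multivariateGaussian 0 Ω₀).prod (multivariateGaussian 0 Ω)) =
    2 * τ * gaussIS Ω₀ [symPart X, symPart X]
    + (d ^ 2 * gaussIS Ω [Q, Q', symPart Z, symPart Z] - d * gaussIS Ω [Q, symPart Z, symPart Z]
      - d * gaussIS Ω [Q', symPart Z, symPart Z] + gaussIS Ω [symPart Z, symPart Z])
    + 2 * gaussIS Ω₀ [symPart X] * (d ^ 2 * gaussIS Ω [Q, Q', symPart Z]
      - d * gaussIS Ω [Q, symPart Z] - d * gaussIS Ω [Q', symPart Z] + gaussIS Ω [symPart Z])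
    + (8 * τ * gaussIS Ω₀ [M * Ω * Mᵀ]
      + 32 * (d ^ 2 * gaussIS Ω₀ [symPart (M * (Ω * Q * Ω * Q' * Ω) * Mᵀ)])) := by
  set c : MvPolynomial ι ℝ := (d ^ 2) • (quadPoly Q * quadPoly Q') - d • quadPoly Q
    - d • quadPoly Q' + 1 with hc
  have evc : ∀ x, eval (-x) c = eval x c := fun x => by
    simp only [hc, map_add, map_sub, smul_eval, map_mul, eval_neg_quadPoly, map_one]
  have h1 : gaussMoment Ω c = 2 * τ := by
    simp only [hc, map_add, map_sub, map_smul, gaussMoment_quad_quad hΩ tQ tQ',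
      gaussMoment_quadPoly hΩ, gaussMoment_one, smul_eq_mul]
    -- The moment equals `(d tr ΩQ - 1)(d tr ΩQ' - 1) + 2τ`.
    linear_combination (d * (Ω * Q').trace - 1) * hQ + 2 * hτ
  have h2 : ∀ v : ι → ℝ, gaussMoment Ω (c * (linPoly v * linPoly v)) = 2 * τ * (v ⬝ᵥ Ω *ᵥ v)
      + 8 * d ^ 2 * (v ⬝ᵥ symPart (Ω * Q * Ω * Q' * Ω) *ᵥ v) := by
    intro v
    simp only [hc, add_mul, sub_mul, smul_mul_assoc, one_mul, map_add, map_sub, map_smul,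
      gaussMoment_quad_quad_lin_lin hΩ tQ tQ', gaussMoment_quad_lin_lin hΩ tQ,
      gaussMoment_quad_lin_lin hΩ tQ', gaussMoment_linPoly_linPoly hΩ, smul_eq_mul]
    linear_combination (d * (Ω * Q').trace - 1) * (v ⬝ᵥ Ω *ᵥ v) * hQ
      + 2 * (v ⬝ᵥ Ω *ᵥ v) * hτ + 2 * d * (v ⬝ᵥ (Ω * Q' * Ω) *ᵥ v) * hQ
      + 2 * d * (v ⬝ᵥ (Ω * Q * Ω) *ᵥ v) * hQ'
  have h3 : gaussMoment Ω (c * quadPoly Z) = d ^ 2 * gaussIS Ω [Q, Q', symPart Z]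
      - d * gaussIS Ω [Q, symPart Z] - d * gaussIS Ω [Q', symPart Z] + gaussIS Ω [symPart Z] := by
    simp only [hc, add_mul, sub_mul, smul_mul_assoc, one_mul, map_add, map_sub, map_smul,
      gaussIS_eq_gaussMoment, List.map_cons, List.map_nil, List.prod_cons, List.prod_nil, mul_one,
      quadPoly_symPart, smul_eq_mul, mul_assoc]
  have h4 : gaussMoment Ω (c * quadPoly Z * quadPoly Z) =
      d ^ 2 * gaussIS Ω [Q, Q', symPart Z, symPart Z] - d * gaussIS Ω [Q, symPart Z, symPart Z]
      - d * gaussIS Ω [Q', symPart Z, symPart Z] + gaussIS Ω [symPart Z, symPart Z] := by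
    simp only [hc, add_mul, sub_mul, smul_mul_assoc, one_mul, map_add, map_sub, map_smul,
      gaussIS_eq_gaussMoment, List.map_cons, List.map_nil, List.prod_cons, List.prod_nil, mul_one,
      quadPoly_symPart, smul_eq_mul, mul_assoc]
  rw [integral_prod_eq_gaussMoment (allLp_centered_score_sq Ω₀ Ω d Q Q' Z X M).integrable
    (P := fun s => c * (C (s ⬝ᵥ X *ᵥ s) + 2 * linPoly (Mᵀ *ᵥ s) + quadPoly Z) ^ 2)
    (Q := (2 * τ) • (quadPoly X * quadPoly X)
      + C (gaussMoment Ω (c * quadPoly Z * quadPoly Z))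
      + (2 * gaussMoment Ω (c * quadPoly Z)) • quadPoly X
      + (8 * τ) • quadPoly (M * Ω * Mᵀ)
      + (32 * d ^ 2) • quadPoly (M * symPart (Ω * Q * Ω * Q' * Ω) * Mᵀ)), h3, h4]
  · simp only [quadPoly_mul_symPart_mul M]
    simp only [map_add, map_smul, smul_eq_mul, gaussMoment_C, gaussIS_eq_gaussMoment,
      List.map_cons, List.map_nil, List.prod_cons, List.prod_nil, mul_one, quadPoly_symPart]
    ring
  · intro y
    simp only [hc, map_add, map_sub, map_mul, map_pow, map_ofNat, map_one, smul_eval, eval_C,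
      eval_linPoly, mulVec_dotProduct, transpose_transpose, eval_quadPoly]
    ring
  · intro s
    rw [gaussMoment_even_mul_sq hΩ evc, h1, h2]
    simp only [transpose_mulVec_dotProduct_mulVec, map_add, map_mul, smul_eval, eval_C]
    rw [eval_quadPoly X]
    ring

end GaussianQuadratics

/-! ### Second moments of the two estimators -/

namespace LQG

variable {n m T : ℕ} (S : LQG n m) (K : Matrix (Fin m) (Fin n) ℝ) (ℓ : EuclideanSpace ℝ (Fin m))

theorem blockSel_mulVec {d : ℕ} (t : Fin T) (x : Fin T × Fin d → ℝ) (i : Fin d) :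
    (blockSel d t *ᵥ x) i = x (t, i) := by
  simp only [mulVec, dotProduct, blockSel, of_apply]
  rw [Finset.sum_eq_single (t, i)]
  · simp
  · rintro ⟨p, j⟩ _ h
    have : ¬(p = t ∧ j = i) := fun h' => h (by rw [h'.1, h'.2])
    simp [this]
  · simp

theorem blockSel_mulVec_stackNoise (ω : Sample n m T) (t : Fin T) :
    blockSel m t *ᵥ stackNoise ω = noise ω t := by
  ext i
  rw [blockSel_mulVec, stackNoise, noise_coe]

theorem state_eq_blk (ω : Sample n m T) (t : Fin T) :
    S.state K ω t = S.Fblk K t *ᵥ ω.1.ofLp + S.Eblk K t *ᵥ stackNoise ω := by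
  rw [Fblk, Eblk, ← mulVec_mulVec, ← mulVec_mulVec, ← mulVec_add, ← stackState_eq]
  ext i
  rw [blockSel_mulVec]
  rfl

theorem stackNoise_WK (ω : Sample n m T) (t p : Fin T) :
    stackNoise ω ⬝ᵥ WK ℓ t p *ᵥ stackNoise ω =
      ∑ i, dinv ℓ i ^ 2 * (noise ω t i * noise ω p i) := by
  rw [WK, ← mulVec_mulVec, ← mulVec_mulVec, ← mulVec_mulVec, blockSel_mulVec_stackNoise,
    ← mulVec_dotProduct, blockSel_mulVec_stackNoise]
  simp only [dotProduct, policyCov_inv_mulVec]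
  exact Finset.sum_congr rfl fun i _ => by ring

theorem stackNoise_Qsel (ω : Sample n m T) (t : Fin T) (i : Fin m) :
    stackNoise ω ⬝ᵥ Qsel t i *ᵥ stackNoise ω = noise ω t i ^ 2 := by
  rw [Qsel, ← mulVec_mulVec, ← mulVec_mulVec, blockSel_mulVec_stackNoise,
    ← mulVec_dotProduct, blockSel_mulVec_stackNoise]
  simp [dotProduct, mulVec, Matrix.single_apply, sq, ite_and]

theorem Qsel_eq_single (t : Fin T) (i : Fin m) :
    (Qsel t i : Matrix (Fin T × Fin m) (Fin T × Fin m) ℝ) = Matrix.single (t, i) (t, i) 1 := by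
  ext ⟨p, j⟩ ⟨q, k⟩
  simp [Qsel, Matrix.mul_apply, blockSel, Matrix.single_apply, Prod.ext_iff, ite_and]
  grind

/-- The Frobenius product of two rank-one scores is `(ε_tᵀ Σ⁻² ε_p)(s_t · s_p)`; the sign of the
return disappears in the square. -/
theorem frobSq_estK (hQs : S.Qsᵀ = S.Qs) (hQa : S.Qaᵀ = S.Qa) (ω : Sample n m T) :
    frobSq (S.estK K ℓ ω) = ∑ t : Fin T, ∑ p : Fin T,
      (stackNoise ω ⬝ᵥ WK ℓ t p *ᵥ stackNoise ω) *
      (ω.1.ofLp ⬝ᵥ S.Gtp K t p *ᵥ ω.1.ofLp + ω.1.ofLp ⬝ᵥ S.Jtp K t p *ᵥ stackNoise ω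
        + stackNoise ω ⬝ᵥ S.Utp K t p *ᵥ stackNoise ω) *
      (ω.1.ofLp ⬝ᵥ S.Mss K T *ᵥ ω.1.ofLp + 2 * (ω.1.ofLp ⬝ᵥ S.Mse K T *ᵥ stackNoise ω)
        + stackNoise ω ⬝ᵥ S.Mee K T *ᵥ stackNoise ω) ^ 2 := by
  have h : ∀ t p : Fin T, ω.1.ofLp ⬝ᵥ S.Gtp K t p *ᵥ ω.1.ofLp
      + ω.1.ofLp ⬝ᵥ S.Jtp K t p *ᵥ stackNoise ω
      + stackNoise ω ⬝ᵥ S.Utp K t p *ᵥ stackNoise ω =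
      ∑ j, S.state K ω t j * S.state K ω p j := by
    intro t p
    rw [Gtp, Jtp, Utp, ← dotProduct_add_mulVec_add, ← state_eq_blk, ← state_eq_blk]
    rfl
  have hR := S.ret_eq K hQs hQa ω
  rw [← neg_eq_iff_eq_neg] at hR
  simp only [h, stackNoise_WK, ← hR, frobSq, estK_apply, neg_sq, sq (∑ t : Fin T, _),
    Finset.sum_mul_sum]
  rw [Finset.sum_congr rfl fun i _ => Finset.sum_comm, Finset.sum_comm]
  refine Finset.sum_congr rfl fun t _ => ?_
  rw [Finset.sum_congr rfl fun i _ => Finset.sum_comm, Finset.sum_comm]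
  refine Finset.sum_congr rfl fun p _ => ?_
  simp only [Finset.sum_mul]
  refine Finset.sum_congr rfl fun i _ => Finset.sum_congr rfl fun j _ => ?_
  ring

theorem norm_sq_estL (hQs : S.Qsᵀ = S.Qs) (hQa : S.Qaᵀ = S.Qa) (ω : Sample n m T) :
    ‖S.estL K ℓ ω‖ ^ 2 = ∑ t : Fin T, ∑ p : Fin T, ∑ i : Fin m,
      (dinv ℓ i * (stackNoise ω ⬝ᵥ Qsel t i *ᵥ stackNoise ω) - 1) *
      (dinv ℓ i * (stackNoise ω ⬝ᵥ Qsel p i *ᵥ stackNoise ω) - 1) *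
      (ω.1.ofLp ⬝ᵥ S.Mss K T *ᵥ ω.1.ofLp + 2 * (ω.1.ofLp ⬝ᵥ S.Mse K T *ᵥ stackNoise ω)
        + stackNoise ω ⬝ᵥ S.Mee K T *ᵥ stackNoise ω) ^ 2 := by
  have hR := S.ret_eq K hQs hQa ω
  rw [← neg_eq_iff_eq_neg] at hR
  simp only [EuclideanSpace.real_norm_sq_eq, ← hR, stackNoise_Qsel, estL_apply, neg_sq,
    sq (∑ t : Fin T, _), Finset.sum_mul_sum]
  rw [Finset.sum_comm]
  refine Finset.sum_congr rfl fun t _ => ?_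
  rw [Finset.sum_comm]
  refine Finset.sum_congr rfl fun p _ => Finset.sum_congr rfl fun i _ => ?_
  ring

theorem integral_comp_lift {f : EuclideanSpace ℝ (Fin n) × EuclideanSpace ℝ (Fin T × Fin m) → ℝ}
    (hf : AllLp f ((multivariateGaussian 0 S.Sigma0).prod (multivariateGaussian 0 (covLift ℓ T)))) :
    ∫ ω : Sample n m T, f (lift ω) ∂(S.law ℓ T) =
      ∫ y, f y ∂((multivariateGaussian 0 S.Sigma0).prod (multivariateGaussian 0 (covLift ℓ T))) := by
  have hm := S.measurePreserving_lift (T := T) ℓ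
  rw [← hm.map_eq, integral_map hm.measurable.aemeasurable]
  rw [hm.map_eq]
  exact hf.integrable.aestronglyMeasurable

theorem integral_frobSq_estK (hQs : S.Qsᵀ = S.Qs) (hQa : S.Qaᵀ = S.Qa) :
    ∫ ω : Sample n m T, frobSq (S.estK K ℓ ω) ∂(S.law ℓ T) =
      ∑ t : Fin T, ∑ p : Fin T,
        (S.EK1 K ℓ t p + S.EK2 K ℓ t p + S.EK3 K ℓ t p + S.EK4 K ℓ t p + S.EK5 K ℓ t p
          + S.EK6 K ℓ t p) := by
  refine (integral_congr_ae (Filter.Eventually.of_forall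
    (S.frobSq_estK K ℓ hQs hQa))).trans ?_
  have hL := fun t p : Fin T => allLp_quadratic_score_sq S.Sigma0 (covLift ℓ T) (WK ℓ t p)
    (S.Utp K t p) (S.Mee K T) (S.Gtp K t p) (S.Mss K T) (S.Jtp K t p) (S.Mse K T)
  have hI := fun t p => ((hL t p).comp_measurePreserving (S.measurePreserving_lift ℓ)).integrable
  refine (integral_finsetSum _ fun t _ => integrable_finsetSum _ fun p _ => hI t p).trans ?_
  refine Finset.sum_congr rfl fun t _ => ?_
  refine (integral_finsetSum _ fun p _ => hI t p).trans ?_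
  refine Finset.sum_congr rfl fun p _ => ?_
  refine (S.integral_comp_lift ℓ (hL t p)).trans ?_
  -- The six groups of the general formula are the six terms by unfolding definitions.
  exact integral_quadratic_score_sq (isPosDiag_covLift ℓ) _ _ _ _ _ _ _ (hL t p).integrable

/-- `Q_{t,i}` is the projection onto one coordinate, on which the covariance acts as the scalar `1 /
d_i`. -/
theorem covLift_mul_Qsel (t : Fin T) (i : Fin m) :
    dinv ℓ i • (covLift ℓ T * Qsel t i) = Qsel t i := by
  rw [Qsel_eq_single, covLift_eq_diagonal, dinv, policyCov_inv]
  ext q r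
  simp only [Matrix.smul_apply, diagonal_mul, Matrix.single_apply, diagonal_apply_eq, smul_eq_mul]
  split_ifs with h
  · rw [← h.1, mul_one, ← Real.exp_add]; simp
  · simp

theorem Qsel_transpose (t : Fin T) (i : Fin m) : (Qsel t i)ᵀ = Qsel t i := by
  rw [Qsel_eq_single, transpose_single]

theorem symPart_of_transpose_eq {ι : Type*} {A : Matrix ι ι ℝ} (hA : Aᵀ = A) : symPart A = A := by
  rw [symPart, hA, ← two_smul ℝ, smul_smul]
  norm_num

/-- From `Σ⁻¹ = ∑ d_i e_i e_iᵀ`. It gathers the terms containing a single score, summed over `i`,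
into `W^ℓ_t`. -/
theorem quadPoly_WL (t : Fin T) :
    quadPoly (WL ℓ t) = ∑ i, dinv ℓ i • quadPoly (Qsel t i) := by
  have h : WL ℓ t = ∑ i, dinv ℓ i • Qsel t i := by
    have : (policyCov ℓ)⁻¹ = ∑ i, dinv ℓ i • Matrix.single i i (1 : ℝ) := by
      simp only [smul_single, smul_eq_mul, mul_one, dinv, policyCov_inv, diagonal_apply_eq]
      exact (sum_single_eq_diagonal _).symm
    rw [WL, this, Matrix.mul_sum, Matrix.sum_mul]
    exact Finset.sum_congr rfl fun i _ => by rw [Qsel, Matrix.mul_smul, Matrix.smul_mul]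
  have hsum : ∀ s : Finset (Fin m), quadPoly (∑ i ∈ s, dinv ℓ i • (Qsel t i :
      Matrix (Fin T × Fin m) (Fin T × Fin m) ℝ)) = ∑ i ∈ s, dinv ℓ i • quadPoly (Qsel t i) := by
    intro s
    induction s using Finset.induction_on with
    | empty => simpa using quadPoly_smul (0 : ℝ) (0 : Matrix (Fin T × Fin m) (Fin T × Fin m) ℝ)
    | insert i s hi ih => rw [Finset.sum_insert hi, Finset.sum_insert hi, quadPoly_add, ih,
        quadPoly_smul]
  rw [h, hsum]

theorem gaussIS_WL (t : Fin T) (As : List (Matrix (Fin T × Fin m) (Fin T × Fin m) ℝ)) :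
    gaussIS (covLift ℓ T) (symPart (WL ℓ t) :: As) =
      ∑ i, dinv ℓ i * gaussIS (covLift ℓ T) (Qsel t i :: As) := by
  simp only [gaussIS_eq_gaussMoment, List.map_cons, List.prod_cons, quadPoly_symPart, quadPoly_WL,
    Finset.sum_mul, map_sum, smul_mul_assoc, map_smul, smul_eq_mul]

theorem integral_norm_sq_estL (hQs : S.Qsᵀ = S.Qs) (hQa : S.Qaᵀ = S.Qa) :
    ∫ ω : Sample n m T, ‖S.estL K ℓ ω‖ ^ 2 ∂(S.law ℓ T) =
      ∑ t : Fin T, ∑ p : Fin T,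
        (S.EL1 K t p + S.EL2 K ℓ t p + S.EL3 K ℓ t p + S.EL4 K ℓ t p) := by
  refine (integral_congr_ae (Filter.Eventually.of_forall
    (S.norm_sq_estL K ℓ hQs hQa))).trans ?_
  have hL := fun (t p : Fin T) (i : Fin m) => allLp_centered_score_sq S.Sigma0 (covLift ℓ T)
    (dinv ℓ i) (Qsel t i) (Qsel p i) (S.Mee K T) (S.Mss K T) (S.Mse K T)
  have hI := fun t p i =>
    ((hL t p i).comp_measurePreserving (S.measurePreserving_lift ℓ)).integrable
  have htr : ∀ (t : Fin T) (i : Fin m), dinv ℓ i * (covLift ℓ T * Qsel t i).trace = 1 := by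
    intro t i
    rw [← smul_eq_mul, ← trace_smul, covLift_mul_Qsel, Qsel_eq_single, trace_single_eq_same]
  -- After rescaling, the trace is that of a product of two coordinate projections: the origin of
  -- `1_{t=p}`.
  have hτ : ∀ (t p : Fin T) (i : Fin m), dinv ℓ i ^ 2 *
      (covLift ℓ T * Qsel t i * covLift ℓ T * Qsel p i).trace = if t = p then 1 else 0 := by
    intro t p i
    have : dinv ℓ i ^ 2 • (covLift ℓ T * Qsel t i * covLift ℓ T * Qsel p i) =
        Qsel t i * Qsel p i := by
      conv_rhs => rw [← covLift_mul_Qsel ℓ t i, ← covLift_mul_Qsel ℓ p i]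
      rw [Matrix.smul_mul, Matrix.mul_smul, smul_smul, sq, Matrix.mul_assoc (_ * _)]
    rw [← smul_eq_mul, ← trace_smul, this, Qsel_eq_single, Qsel_eq_single]
    split_ifs with h
    · subst h
      rw [single_mul_single_same, trace_single_eq_same, one_mul]
    · rw [single_mul_single_of_ne _ _ _ _ (by simp [h]), trace_zero]
  refine (integral_finsetSum _ fun t _ => integrable_finsetSum _ fun p _ =>
    integrable_finsetSum _ fun i _ => hI t p i).trans ?_
  refine Finset.sum_congr rfl fun t _ => ?_
  refine (integral_finsetSum _ fun p _ => integrable_finsetSum _ fun i _ => hI t p i).trans ?_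
  refine Finset.sum_congr rfl fun p _ => ?_
  refine (integral_finsetSum _ fun i _ => hI t p i).trans ?_
  rw [Finset.sum_congr rfl fun i _ => (S.integral_comp_lift ℓ (hL t p i)).trans
    (integral_centered_score_sq (isPosDiag_covLift ℓ) (Qsel_transpose t i) (Qsel_transpose p i)
      (htr t i) (htr p i) (hτ t p i) (S.Mee K T) (S.Mss K T) (S.Mse K T))]
  have hs : ∀ (t : Fin T) (i : Fin m), symPart (Qsel t i) = Qsel t i :=
    fun t i => symPart_of_transpose_eq (Qsel_transpose t i)
  simp only [EL1, EL2, EL3, EL4, gaussIS_WL, hs, VtpI, sandwich, V0, Finset.sum_add_distrib,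
    Finset.sum_sub_distrib, ← Finset.mul_sum, Finset.sum_const, Finset.card_univ, Fintype.card_fin,
    nsmul_eq_mul]
  ring

end LQG

/-! ### Matrices of mixed second moments -/

section SecondMoment

variable {Ω : Type*} [MeasurableSpace Ω] {μ : Measure Ω} {α β γ : Type*}

/-- The matrix of mixed moments `E[xᵢ yⱼ]`. -/
noncomputable def crossMoment (μ : Measure Ω) (x : Ω → α → ℝ) (y : Ω → β → ℝ) : Matrix α β ℝ :=
  Matrix.of fun i j => ∫ ω, x ω i * y ω j ∂μ

theorem crossMoment_transpose (x : Ω → α → ℝ) (y : Ω → β → ℝ) :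
    (crossMoment μ x y)ᵀ = crossMoment μ y x := by
  ext i j
  simp only [crossMoment, transpose_apply, of_apply, mul_comm]

theorem crossMoment_add_left {x x' : Ω → α → ℝ} {y : Ω → β → ℝ}
    (hx : ∀ i, AllLp (fun ω => x ω i) μ) (hx' : ∀ i, AllLp (fun ω => x' ω i) μ)
    (hy : ∀ j, AllLp (fun ω => y ω j) μ) :
    crossMoment μ (fun ω => x ω + x' ω) y = crossMoment μ x y + crossMoment μ x' y := by
  ext i j
  simp only [crossMoment, of_apply, Matrix.add_apply, Pi.add_apply, add_mul]
  exact integral_add ((hx i).mul (hy j)).integrable ((hx' i).mul (hy j)).integrable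

theorem crossMoment_mulVec_left [Fintype α] (A : Matrix γ α ℝ) {x : Ω → α → ℝ} {y : Ω → β → ℝ}
    (hx : ∀ i, AllLp (fun ω => x ω i) μ) (hy : ∀ j, AllLp (fun ω => y ω j) μ) :
    crossMoment μ (fun ω => A *ᵥ x ω) y = A * crossMoment μ x y := by
  ext i j
  simp only [crossMoment, of_apply, mul_apply, mulVec, dotProduct, Finset.sum_mul, mul_assoc]
  rw [integral_finsetSum _ fun k _ => (((hx k).mul (hy j)).const_mul _).integrable]
  simp only [integral_const_mul]

theorem integral_dotProduct_mulVec [Fintype α] (A : Matrix α α ℝ) {x : Ω → α → ℝ}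
    (hx : ∀ i, AllLp (fun ω => x ω i) μ) :
    ∫ ω, x ω ⬝ᵥ A *ᵥ x ω ∂μ = (A * crossMoment μ x x).trace := by
  rw [← crossMoment_mulVec_left A hx hx]
  simp only [dotProduct, trace, diag, crossMoment, of_apply]
  rw [integral_finsetSum _ fun k _ => ((hx k).mul (AllLp.mulVec A hx k)).integrable]
  simp only [mul_comm]

end SecondMoment

namespace LQG

variable {n m T : ℕ} (S : LQG n m) (K : Matrix (Fin m) (Fin n) ℝ) (ℓ : EuclideanSpace ℝ (Fin m))

/-! ### Integration by parts in the noise -/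

/-- `f` is a polynomial in the noise, with partial derivative `f'` in the coordinate `q`. -/
def HasNoiseDeriv (q : Fin T × Fin m) (f f' : Sample n m T → ℝ) : Prop :=
  ∀ s : EuclideanSpace ℝ (Fin n), ∃ p : MvPolynomial (Fin T × Fin m) ℝ,
    ∀ ε : Fin T → EuclideanSpace ℝ (Fin m),
      f (s, ε) = MvPolynomial.eval (stackNoise (s, ε)) p ∧
      f' (s, ε) = MvPolynomial.eval (stackNoise (s, ε)) (MvPolynomial.pderiv q p)

namespace HasNoiseDeriv

variable {q : Fin T × Fin m} {f g f' g' : Sample n m T → ℝ}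

theorem of_init (c : EuclideanSpace ℝ (Fin n) → ℝ) :
    HasNoiseDeriv (T := T) q (fun ω => c ω.1) fun _ => 0 :=
  fun s => ⟨MvPolynomial.C (c s), fun ε => by simp⟩

theorem const (c : ℝ) : HasNoiseDeriv (n := n) q (fun _ => c) fun _ => 0 := of_init fun _ => c

theorem add (hf : HasNoiseDeriv q f f') (hg : HasNoiseDeriv q g g') :
    HasNoiseDeriv q (fun ω => f ω + g ω) fun ω => f' ω + g' ω := fun s => by
  obtain ⟨p, hp⟩ := hf s
  obtain ⟨r, hr⟩ := hg s
  exact ⟨p + r, fun ε => by simp only [map_add, (hp ε).1, (hp ε).2, (hr ε).1, (hr ε).2, and_self]⟩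

theorem mul (hf : HasNoiseDeriv q f f') (hg : HasNoiseDeriv q g g') :
    HasNoiseDeriv q (fun ω => f ω * g ω) fun ω => f' ω * g ω + f ω * g' ω := fun s => by
  obtain ⟨p, hp⟩ := hf s
  obtain ⟨r, hr⟩ := hg s
  refine ⟨p * r, fun ε => ?_⟩
  simp only [(hp ε).1, (hp ε).2, (hr ε).1, (hr ε).2, map_mul, Derivation.leibniz, smul_eq_mul,
    map_add, true_and]
  ring

theorem congr (hf : HasNoiseDeriv q f f') (h : f = g) (h' : f' = g') : HasNoiseDeriv q g g' :=
  h ▸ h' ▸ hf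

theorem const_mul (hf : HasNoiseDeriv q f f') (c : ℝ) :
    HasNoiseDeriv q (fun ω => c * f ω) fun ω => c * f' ω :=
  ((const c).mul hf).congr rfl (by simp)

theorem sum {α : Type*} (s : Finset α) {f f' : α → Sample n m T → ℝ}
    (h : ∀ i ∈ s, HasNoiseDeriv q (f i) (f' i)) :
    HasNoiseDeriv q (fun ω => ∑ i ∈ s, f i ω) fun ω => ∑ i ∈ s, f' i ω := by
  classical
  induction s using Finset.induction_on with
  | empty => simpa using const 0
  | insert a s ha ih =>
    simp only [Finset.sum_insert ha]
    exact (h a (Finset.mem_insert_self a s)).add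
      (ih fun i hi => h i (Finset.mem_insert_of_mem hi))

theorem mulVec {κ τ : Type*} [Fintype τ] (A : Matrix κ τ ℝ) {x x' : Sample n m T → τ → ℝ}
    (h : ∀ i, HasNoiseDeriv q (fun ω => x ω i) fun ω => x' ω i) (j : κ) :
    HasNoiseDeriv q (fun ω => (A *ᵥ x ω) j) fun ω => (A *ᵥ x' ω) j :=
  sum _ fun i _ => (h i).const_mul _

theorem dotProduct_mulVec {τ : Type*} [Fintype τ] {A : Matrix τ τ ℝ} (hA : Aᵀ = A)
    {x x' : Sample n m T → τ → ℝ} (h : ∀ i, HasNoiseDeriv q (fun ω => x ω i) fun ω => x' ω i) :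
    HasNoiseDeriv q (fun ω => x ω ⬝ᵥ A *ᵥ x ω) fun ω => 2 * (x ω ⬝ᵥ A *ᵥ x' ω) := by
  have := sum Finset.univ fun i _ => (h i).mul (mulVec A h i)
  refine this.congr rfl ?_
  ext ω
  rw [Finset.sum_add_distrib]
  change x' ω ⬝ᵥ A *ᵥ x ω + x ω ⬝ᵥ A *ᵥ x' ω = _
  rw [dotProduct_mulVec_swap A (x' ω), hA]
  ring

end HasNoiseDeriv

theorem hasNoiseDeriv_noise (q : Fin T × Fin m) (p : ℕ) (j : Fin m) :
    HasNoiseDeriv (n := n) q (fun ω => noise ω p j)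
      fun _ => if p = q.1 then (Pi.single q.2 1 : Fin m → ℝ) j else 0 := by
  intro s
  by_cases hp : p < T
  · refine ⟨MvPolynomial.X (⟨p, hp⟩, j), fun ε => ⟨by simp [noise, hp, stackNoise], ?_⟩⟩
    rw [MvPolynomial.pderiv_X]
    obtain ⟨t, i⟩ := q
    simp only [Pi.single_apply, Prod.mk.injEq, Fin.ext_iff, ite_and]
    split_ifs <;> simp_all
  -- Past the horizon the noise is zero by convention, and `p` cannot equal the time index of `q`.
  · refine ⟨0, fun ε => ⟨by simp [noise, hp], ?_⟩⟩
    have : p ≠ q.1 := fun h => hp (h ▸ q.1.2)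
    simp [this]

/-- Gaussian integration by parts in one coordinate of the noise. -/
theorem integral_noise_mul (t : Fin T) (i : Fin m) {f f' : Sample n m T → ℝ}
    (hf : AllLp f (S.law ℓ T)) (hf' : AllLp f' (S.law ℓ T)) (h : HasNoiseDeriv (t, i) f f') :
    ∫ ω, noise ω t i * f ω ∂(S.law ℓ T) = Real.exp (2 * ℓ i) * ∫ ω, f' ω ∂(S.law ℓ T) := by
  have hI := ((S.allLp_noise ℓ t i).mul hf).integrable
  have hI' := hf'.integrable
  unfold law at hI hI' ⊢
  -- For a fixed initial state both integrands are polynomials in the stacked noise, so the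
  -- polynomial identity applies fibrewise.
  rw [integral_prod _ hI, integral_prod _ hI', ← integral_const_mul]
  refine integral_congr_ae (Filter.Eventually.of_forall fun s => ?_)
  obtain ⟨p, hp⟩ := h s
  have hm : ∀ r : MvPolynomial (Fin T × Fin m) ℝ,
      ∫ ε, MvPolynomial.eval (stackNoise (s, ε)) r
        ∂(Measure.pi fun _ : Fin T => multivariateGaussian 0 (policyCov ℓ)) =
      gaussMoment (covLift ℓ T) r := by
    intro r
    have hs := measurePreserving_stack (T := T) ℓ
    rw [gaussMoment_apply, ← hs.map_eq, integral_map hs.measurable.aemeasurable]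
    · rfl
    · rw [hs.map_eq]
      exact (AllLp.mvPolynomial_eval
        (AllLp.multivariateGaussian_coord 0 _) r).integrable.aestronglyMeasurable
  have e : ∀ ε : Fin T → EuclideanSpace ℝ (Fin m),
      noise ((s, ε) : Sample n m T) t i * f (s, ε) =
        MvPolynomial.eval (stackNoise (s, ε)) (MvPolynomial.X (t, i) * p) := by
    intro ε
    rw [map_mul, MvPolynomial.eval_X, ← (hp ε).1, noise_coe, stackNoise]
  simp only [e, (hp _).2, hm]
  rw [covLift_eq_diagonal, gaussMoment_diagonal_X_mul fun _ => Real.exp_pos _]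

/-! ### Sensitivity of the trajectory to the noise -/

/-- The derivative of the states in the noise coordinate `(t, i)`. -/
def stateSens (t : ℕ) (i : Fin m) : ℕ → Fin n → ℝ
  | 0 => 0
  | p + 1 => S.F K *ᵥ stateSens t i p + if p = t then S.B *ᵥ Pi.single i 1 else 0

/-- The derivative of the actions in the noise coordinate `(t, i)`. -/
def actionSens (t : ℕ) (i : Fin m) (p : ℕ) : Fin m → ℝ :=
  K *ᵥ S.stateSens K t i p + if p = t then Pi.single i 1 else 0

/-- Causality: the noise at time `t` first enters the state at time `t + 1`. -/
theorem stateSens_of_le {t p : ℕ} (i : Fin m) (h : p ≤ t) : S.stateSens K t i p = 0 := by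
  induction p with
  | zero => rfl
  | succ p ih => rw [stateSens, ih (by omega), if_neg (by omega), mulVec_zero, add_zero]

theorem hasNoiseDeriv_state (t : Fin T) (i : Fin m) (p : ℕ) (j : Fin n) :
    HasNoiseDeriv (t, i) (fun ω => S.state K ω p j) fun _ => S.stateSens K t i p j := by
  induction p generalizing j with
  | zero => exact HasNoiseDeriv.of_init fun s => s.ofLp j
  | succ p ih =>
    simp only [state_succ, Pi.add_apply, stateSens]
    refine ((HasNoiseDeriv.mulVec _ ih j).add
      (HasNoiseDeriv.mulVec S.B (hasNoiseDeriv_noise (t, i) p) j)).congr rfl ?_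
    ext ω
    congr 1
    split_ifs with h
    · rfl
    · exact congrFun (mulVec_zero S.B) j

theorem hasNoiseDeriv_action (t : Fin T) (i : Fin m) (p : ℕ) (j : Fin m) :
    HasNoiseDeriv (t, i) (fun ω => S.action K ω p j) fun _ => S.actionSens K t i p j := by
  refine ((HasNoiseDeriv.mulVec K (S.hasNoiseDeriv_state K t i p) j).add
    (hasNoiseDeriv_noise (t, i) p j)).congr rfl ?_
  ext ω
  simp only [actionSens, Pi.add_apply]
  congr 1
  split_ifs <;> rfl

/-- The derivative of the return in the noise coordinate `(t, i)`. -/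
def retSens (t : ℕ) (i : Fin m) (ω : Sample n m T) : ℝ :=
  ∑ p : Fin T, S.gamma ^ (p : ℕ) *
    (-2 * (S.state K ω (p + 1) ⬝ᵥ S.Qs *ᵥ S.stateSens K t i (p + 1)
      + S.action K ω p ⬝ᵥ S.Qa *ᵥ S.actionSens K t i p))

theorem hasNoiseDeriv_ret (hQs : S.Qsᵀ = S.Qs) (hQa : S.Qaᵀ = S.Qa) (t : Fin T) (i : Fin m) :
    HasNoiseDeriv (t, i) (fun ω => S.ret K ω) (S.retSens K t i) := by
  refine HasNoiseDeriv.sum _ fun p _ => HasNoiseDeriv.const_mul ?_ _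
  refine (((HasNoiseDeriv.dotProduct_mulVec hQs (S.hasNoiseDeriv_state K t i (p + 1))).add
    (HasNoiseDeriv.dotProduct_mulVec hQa (S.hasNoiseDeriv_action K t i p))).const_mul
      (-1)).congr ?_ ?_
  · ext ω; rw [reward]; ring
  · ext ω; ring

/-- The return is quadratic in the noise and the sensitivities are deterministic, so the second
derivative is a constant. -/
theorem hasNoiseDeriv_retSens (t : Fin T) (i : Fin m) :
    HasNoiseDeriv (t, i) (fun ω => S.retSens K t i ω) fun _ => ∑ p : Fin T, S.gamma ^ (p : ℕ) *
      (-2 * (S.stateSens K t i (p + 1) ⬝ᵥ S.Qs *ᵥ S.stateSens K t i (p + 1)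
        + S.actionSens K t i p ⬝ᵥ S.Qa *ᵥ S.actionSens K t i p)) := by
  have h : ∀ {d : ℕ} {x : Sample n m T → Fin d → ℝ} {x' y : Fin d → ℝ},
      (∀ j, HasNoiseDeriv (t, i) (fun ω => x ω j) fun _ => x' j) →
      HasNoiseDeriv (t, i) (fun ω => x ω ⬝ᵥ y) fun _ => x' ⬝ᵥ y := by
    intro d x x' y hx
    exact HasNoiseDeriv.sum _ fun j _ => ((hx j).const_mul (y j)).congr
      (by ext ω; rw [mul_comm]) (by ext ω; rw [mul_comm])
  exact HasNoiseDeriv.sum _ fun p _ => HasNoiseDeriv.const_mul (HasNoiseDeriv.const_mul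
    ((h (S.hasNoiseDeriv_state K t i (p + 1))).add (h (S.hasNoiseDeriv_action K t i p))) _) _

theorem allLp_retSens (t : ℕ) (i : Fin m) :
    AllLp (fun ω : Sample n m T => S.retSens K t i ω) (S.law ℓ T) := by
  have h : ∀ {d : ℕ} {x : Sample n m T → Fin d → ℝ} (y : Fin d → ℝ),
      (∀ j, AllLp (fun ω => x ω j) (S.law ℓ T)) → AllLp (fun ω => x ω ⬝ᵥ y) (S.law ℓ T) :=
    fun y hx => AllLp.dotProduct (g := fun _ => y) hx fun j => AllLp.const (y j)
  exact AllLp.sum _ fun p _ => (((h _ (S.allLp_state K ℓ (p + 1))).add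
    (h _ (S.allLp_action K ℓ p))).const_mul _).const_mul _

/-! ### State covariances -/

theorem _root_.integral_coord_multivariateGaussian {ι : Type*} [Fintype ι] [DecidableEq ι]
    (Ω : Matrix ι ι ℝ) (j : ι) :
    ∫ x : EuclideanSpace ℝ ι, x.ofLp j ∂(multivariateGaussian 0 Ω) = 0 := by
  have := (EuclideanSpace.proj (𝕜 := ℝ) j).integral_comp_comm
    (IsGaussian.integrable_id (μ := multivariateGaussian 0 Ω))
  simp only [id, integral_id_multivariateGaussian] at this
  simpa using this

theorem integral_init (f : EuclideanSpace ℝ (Fin n) → ℝ) :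
    ∫ ω : Sample n m T, f ω.1 ∂(S.law ℓ T) = ∫ x, f x ∂(multivariateGaussian 0 S.Sigma0) := by
  rw [law, integral_fun_fst]
  simp

theorem integral_noise (t : ℕ) (i : Fin m) :
    ∫ ω : Sample n m T, noise ω t i ∂(S.law ℓ T) = 0 := by
  by_cases h : t < T
  · have := S.integral_noise_mul (T := T) ℓ ⟨t, h⟩ i (AllLp.const 1) (AllLp.const 0)
      (HasNoiseDeriv.const 1)
    simpa using this
  · simp [noise, h]

theorem integral_state (t : ℕ) (j : Fin n) :
    ∫ ω : Sample n m T, S.state K ω t j ∂(S.law ℓ T) = 0 := by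
  induction t generalizing j with
  | zero =>
    exact (S.integral_init ℓ fun x => x.ofLp j).trans (integral_coord_multivariateGaussian _ j)
  | succ t ih =>
    simp only [state_succ, Pi.add_apply, mulVec, dotProduct]
    have hs := fun k : Fin n => ((S.allLp_state (T := T) K ℓ t k).const_mul (S.F K j k)).integrable
    have hn := fun k : Fin m => ((S.allLp_noise (T := T) ℓ t k).const_mul (S.B j k)).integrable
    rw [integral_add (integrable_finsetSum _ fun k _ => hs k)
      (integrable_finsetSum _ fun k _ => hn k), integral_finsetSum _ fun k _ => hs k,
      integral_finsetSum _ fun k _ => hn k]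
    simp [integral_const_mul, ih, integral_noise]

theorem stateCov_eq_crossMoment (t : ℕ) :
    S.stateCov K ℓ T t = crossMoment (S.law ℓ T) (fun ω => S.state K ω t)
      fun ω => S.state K ω t := by
  ext i j
  simp only [stateCov, crossMoment, of_apply, covariance, integral_state, sub_zero]

/-- Integration by parts stands in for independence: the state at a time `p ≤ t` has zero derivative
in the noise at `t`. -/
theorem crossMoment_noise_state {t p : ℕ} (h : p ≤ t) :
    crossMoment (S.law ℓ T) (fun ω => noise ω t) (fun ω => S.state K ω p) = 0 := by
  ext i j
  simp only [crossMoment, of_apply, Matrix.zero_apply]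
  by_cases ht : t < T
  · have := S.integral_noise_mul ℓ ⟨t, ht⟩ i (S.allLp_state K ℓ p j) (AllLp.const _)
      (S.hasNoiseDeriv_state K ⟨t, ht⟩ i p j)
    simpa [S.stateSens_of_le K i h] using this
  · simp [noise, ht]

theorem crossMoment_noise_noise {t : ℕ} (ht : t < T) :
    crossMoment (S.law ℓ T) (fun ω => noise ω t) (fun ω => noise ω t) = policyCov ℓ := by
  ext i j
  have := S.integral_noise_mul ℓ ⟨t, ht⟩ i (S.allLp_noise ℓ t j) (AllLp.const _)
    (hasNoiseDeriv_noise (⟨t, ht⟩, i) t j)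
  simp only [crossMoment, of_apply, policyCov]
  refine this.trans ?_
  simp [diagonal_apply, Pi.single_apply, eq_comm]

theorem crossMoment_state_succ (p : ℕ) {β : Type*} {y : Sample n m T → β → ℝ}
    (hy : ∀ j, AllLp (fun ω => y ω j) (S.law ℓ T)) :
    crossMoment (S.law ℓ T) (fun ω => S.state K ω (p + 1)) y =
      S.F K * crossMoment (S.law ℓ T) (fun ω => S.state K ω p) y
        + S.B * crossMoment (S.law ℓ T) (fun ω => noise ω p) y := by
  simp only [state_succ]
  rw [crossMoment_add_left (AllLp.mulVec _ (S.allLp_state K ℓ p))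
      (AllLp.mulVec _ (S.allLp_noise ℓ p)) hy,
    crossMoment_mulVec_left _ (S.allLp_state K ℓ p) hy,
    crossMoment_mulVec_left _ (S.allLp_noise ℓ p) hy]

theorem crossMoment_action (p : ℕ) {β : Type*} {y : Sample n m T → β → ℝ}
    (hy : ∀ j, AllLp (fun ω => y ω j) (S.law ℓ T)) :
    crossMoment (S.law ℓ T) (fun ω => S.action K ω p) y =
      K * crossMoment (S.law ℓ T) (fun ω => S.state K ω p) y
        + crossMoment (S.law ℓ T) (fun ω => noise ω p) y := by
  simp only [action]
  rw [crossMoment_add_left (AllLp.mulVec _ (S.allLp_state K ℓ p)) (S.allLp_noise ℓ p) hy,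
    crossMoment_mulVec_left _ (S.allLp_state K ℓ p) hy]

theorem stateCov_zero (h : S.Sigma0.PosSemidef) : S.stateCov K ℓ T 0 = S.Sigma0 := by
  ext i j
  rw [← covariance_eval_multivariateGaussian (μ := 0) h i j, stateCov_eq_crossMoment, covariance]
  simp only [integral_coord_multivariateGaussian, sub_zero]
  exact S.integral_init ℓ fun x => x.ofLp i * x.ofLp j

/-- The cross terms vanish because the state at `t` is uncorrelated with the noise at `t`. The bound
`t < T` matters: beyond the horizon the noise is zero and adds no covariance. -/
theorem stateCov_succ {t : ℕ} (ht : t < T) : S.stateCov K ℓ T (t + 1) =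
    S.F K * S.stateCov K ℓ T t * (S.F K)ᵀ + S.B * policyCov ℓ * S.Bᵀ := by
  have h0 := S.crossMoment_noise_state (T := T) K ℓ (le_refl t)
  have h0' : crossMoment (S.law ℓ T) (fun ω => S.state K ω t) (fun ω => noise ω t) = 0 := by
    rw [← crossMoment_transpose, h0, transpose_zero]
  rw [stateCov_eq_crossMoment, S.crossMoment_state_succ K ℓ t (S.allLp_state K ℓ (t + 1)),
    ← crossMoment_transpose, S.crossMoment_state_succ K ℓ t (S.allLp_state K ℓ t),
    ← crossMoment_transpose (fun ω => S.state K ω (t + 1)) (fun ω => noise ω t),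
    S.crossMoment_state_succ K ℓ t (S.allLp_noise ℓ t), h0, h0', S.crossMoment_noise_noise ℓ ht,
    ← stateCov_eq_crossMoment]
  have hs : (S.stateCov K ℓ T t)ᵀ = S.stateCov K ℓ T t := by
    rw [stateCov_eq_crossMoment, crossMoment_transpose]
  simp [hs, policyCov, Matrix.mul_assoc]

theorem crossMoment_action_action {t : ℕ} (ht : t < T) :
    crossMoment (S.law ℓ T) (fun ω => S.action K ω t) (fun ω => S.action K ω t) =
      K * S.stateCov K ℓ T t * Kᵀ + policyCov ℓ := by
  have h0 := S.crossMoment_noise_state (T := T) K ℓ (le_refl t)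
  have h0' : crossMoment (S.law ℓ T) (fun ω => S.state K ω t) (fun ω => noise ω t) = 0 := by
    rw [← crossMoment_transpose, h0, transpose_zero]
  rw [S.crossMoment_action K ℓ t (S.allLp_action K ℓ t),
    ← crossMoment_transpose, S.crossMoment_action K ℓ t (S.allLp_state K ℓ t),
    ← crossMoment_transpose (fun ω => S.action K ω t) (fun ω => noise ω t),
    S.crossMoment_action K ℓ t (S.allLp_noise ℓ t), h0, h0', S.crossMoment_noise_noise ℓ ht,
    ← stateCov_eq_crossMoment]
  have hs : (S.stateCov K ℓ T t)ᵀ = S.stateCov K ℓ T t := by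
    rw [stateCov_eq_crossMoment, crossMoment_transpose]
  simp [hs, policyCov, Matrix.mul_assoc]

theorem objective_eq : S.objective K ℓ T = -∑ t ∈ Finset.range T, S.gamma ^ t *
    ((S.Qs * S.stateCov K ℓ T (t + 1)).trace
      + (S.Qa * (K * S.stateCov K ℓ T t * Kᵀ + policyCov ℓ)).trace) := by
  have h1 := fun t => AllLp.dotProduct (S.allLp_state (T := T) K ℓ t)
    (AllLp.mulVec S.Qs (S.allLp_state K ℓ t))
  have h2 := fun t => AllLp.dotProduct (S.allLp_action (T := T) K ℓ t)
    (AllLp.mulVec S.Qa (S.allLp_action K ℓ t))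
  simp only [objective, ret, reward]
  rw [integral_finsetSum _ fun t _ => ((((h1 _).add (h2 _)).neg).const_mul _).integrable,
    ← Finset.sum_neg_distrib, Finset.sum_range]
  refine Finset.sum_congr rfl fun t _ => ?_
  rw [integral_const_mul, integral_neg, integral_add (h1 _).integrable (h2 _).integrable,
    integral_dotProduct_mulVec _ (S.allLp_state K ℓ _),
    integral_dotProduct_mulVec _ (S.allLp_action K ℓ _), S.crossMoment_action_action K ℓ t.2,
    ← stateCov_eq_crossMoment]
  ring

end LQG

/-! ### Cost-to-go matrices and their duality with covariances -/

namespace LQG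

variable {n m T : ℕ} (S : LQG n m) (K : Matrix (Fin m) (Fin n) ℝ) (ℓ : EuclideanSpace ℝ (Fin m))

/-- The discounted Lyapunov recursion satisfied by the cost-to-go matrices. -/
structure IsCostToGo (T : ℕ) (Λ : ℕ → Matrix (Fin n) (Fin n) ℝ) : Prop where
  terminal : Λ T = (1 / S.gamma) • S.Qs
  step : ∀ t < T, Λ t = (1 / S.gamma) • S.Qs + Kᵀ * S.Qa * K
    + S.gamma • ((S.F K)ᵀ * Λ (t + 1) * S.F K)

variable {S K}

/-- `Λ 0` is unconstrained when `T > 0`. Redefining it by the recursion lets the telescoping start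
at time `0`, and the gradient formulas read only later indices. -/
theorem exists_isCostToGo {Λ : ℕ → Matrix (Fin n) (Fin n) ℝ} (h : Λ T = (1 / S.gamma) • S.Qs)
    (h' : ∀ t, 1 ≤ t → t < T → Λ t = (1 / S.gamma) • S.Qs + Kᵀ * S.Qa * K
      + S.gamma • ((S.F K)ᵀ * Λ (t + 1) * S.F K)) :
    ∃ Λ', S.IsCostToGo K T Λ' ∧ ∀ t, Λ' (t + 1) = Λ (t + 1) := by
  rcases Nat.eq_zero_or_pos T with rfl | hT
  · exact ⟨Λ, ⟨h, fun t ht => absurd ht (Nat.not_lt_zero t)⟩, fun _ => rfl⟩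
  · refine ⟨Function.update Λ 0 ((1 / S.gamma) • S.Qs + Kᵀ * S.Qa * K
      + S.gamma • ((S.F K)ᵀ * Λ 1 * S.F K)), ⟨?_, fun t ht => ?_⟩, fun t => ?_⟩
    · rw [Function.update_of_ne hT.ne', h]
    · rw [Function.update_of_ne t.succ_ne_zero]
      rcases Nat.eq_zero_or_pos t with rfl | h0
      · rw [Function.update_self]
      · rw [Function.update_of_ne h0.ne', h' t h0 ht]
    · rw [Function.update_of_ne t.succ_ne_zero]

theorem IsCostToGo.transpose_eq {Λ : ℕ → Matrix (Fin n) (Fin n) ℝ} (hΛ : S.IsCostToGo K T Λ)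
    (hQs : S.Qsᵀ = S.Qs) (hQa : S.Qaᵀ = S.Qa) {t : ℕ} (ht : t ≤ T) : (Λ t)ᵀ = Λ t := by
  induction ht using Nat.decreasingInduction with
  | self => rw [hΛ.terminal, transpose_smul, hQs]
  | of_succ t ht ih =>
    rw [hΛ.step t ht]
    simp only [transpose_add, transpose_smul, transpose_mul, transpose_transpose, hQs, hQa, ih,
      Matrix.mul_assoc]

/-- Duality between the cost-to-go recursion and a forward Lyapunov recursion. -/
theorem IsCostToGo.sum_trace_eq {Λ : ℕ → Matrix (Fin n) (Fin n) ℝ} (hΛ : S.IsCostToGo K T Λ)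
    (hγ : S.gamma ≠ 0) {Y N : ℕ → Matrix (Fin n) (Fin n) ℝ}
    (hY : ∀ t < T, Y (t + 1) = S.F K * Y t * (S.F K)ᵀ + N t) :
    ∑ t ∈ Finset.range T, S.gamma ^ t *
        ((S.Qs * Y (t + 1)).trace + (Kᵀ * S.Qa * K * Y t).trace) =
      (Λ 0 * Y 0).trace - S.gamma⁻¹ * (S.Qs * Y 0).trace
        + ∑ t ∈ Finset.range T, S.gamma ^ (t + 1) * (Λ (t + 1) * N t).trace := by
  -- The potential is the discounted value of `Y t` with its first `Q_s` charge removed, up to sign;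
  -- the terminal condition makes it vanish at `T`.
  have h := Finset.sum_range_sub (fun t => S.gamma ^ t * (S.gamma⁻¹ * (S.Qs * Y t).trace)
    - S.gamma ^ t * (Λ t * Y t).trace) T
  have hT : S.gamma ^ T * (S.gamma⁻¹ * (S.Qs * Y T).trace) - S.gamma ^ T * (Λ T * Y T).trace
      = 0 := by
    rw [hΛ.terminal, Matrix.smul_mul, trace_smul, smul_eq_mul, one_div, sub_self]
  simp only [hT, pow_zero, one_mul] at h
  rw [← sub_eq_iff_eq_add, ← Finset.sum_sub_distrib]
  refine Eq.trans (Finset.sum_congr rfl fun t ht => ?_) (h.trans (by ring))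
  have ht := Finset.mem_range.1 ht
  have e1 : (Λ (t + 1) * Y (t + 1)).trace =
      ((S.F K)ᵀ * Λ (t + 1) * S.F K * Y t).trace + (Λ (t + 1) * N t).trace := by
    rw [hY t ht, Matrix.mul_add, trace_add]
    congr 1
    rw [← Matrix.mul_assoc, trace_mul_comm]
    simp only [Matrix.mul_assoc]
  have e2 : (Λ t * Y t).trace = S.gamma⁻¹ * (S.Qs * Y t).trace + (Kᵀ * S.Qa * K * Y t).trace
      + S.gamma * ((S.F K)ᵀ * Λ (t + 1) * S.F K * Y t).trace := by
    rw [hΛ.step t ht]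
    simp only [Matrix.add_mul, Matrix.smul_mul, trace_add, trace_smul, smul_eq_mul, one_div]
  rw [e1, e2, pow_succ]
  field_simp
  ring

variable (S K)

/-! ### Gradients of the objective -/

/-- The recursion is polynomial in the gain. Continuity is all that the gradient argument needs. -/
theorem continuous_stateCov (h0 : S.Sigma0.PosSemidef) {t : ℕ} (ht : t ≤ T) :
    Continuous fun K' => S.stateCov K' ℓ T t := by
  induction t with
  | zero => simpa only [S.stateCov_zero _ ℓ h0] using continuous_const
  | succ t ih =>
    have := ih (by omega)
    simp only [fun K' => S.stateCov_succ K' ℓ (Nat.lt_of_succ_le ht), F]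
    fun_prop

theorem stateCov_transpose (t : ℕ) : (S.stateCov K ℓ T t)ᵀ = S.stateCov K ℓ T t := by
  rw [stateCov_eq_crossMoment, crossMoment_transpose]

/-- One time step of the performance difference, with `H` the change of gain. The terms linear in
`H` come in transposed pairs, equal by symmetry, whence the `2`; the quadratic ones combine through
`Q + g BᵀLB`. -/
theorem trace_perturbation {a b : Type*} [Fintype a] [Fintype b] {Q : Matrix b b ℝ}
    {L P : Matrix a a ℝ} (hQ : Qᵀ = Q) (hL : Lᵀ = L) (hP : Pᵀ = P) (K H : Matrix b a ℝ)
    (F : Matrix a a ℝ) (B : Matrix a b ℝ) (V : Matrix b b ℝ) (g : ℝ) :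
    g * (L * (B * H * P * Fᵀ + F * P * (B * H)ᵀ + B * H * P * (B * H)ᵀ + B * V * Bᵀ)).trace
      + (Q * ((K + H) * P * (K + H)ᵀ + V)).trace =
    (Kᵀ * Q * K * P).trace + (V * (Q + g • (Bᵀ * L * B))).trace
      + (((2 : ℝ) • (Q * K * P + g • (Bᵀ * L * F * P))
        + (Q + g • (Bᵀ * L * B)) * H * P)ᵀ * H).trace := by
  have h1 : (L * (B * (H * (P * Fᵀ)))).trace = (Bᵀ * (L * (F * (P * Hᵀ)))).trace := by
    rw [← trace_transpose]
    simp only [transpose_mul, transpose_transpose, hL, hP, Matrix.mul_assoc]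
    have := trace_mul_comm (F * (P * Hᵀ)) (Bᵀ * L)
    simpa only [Matrix.mul_assoc] using this
  have h2 : ∀ X : Matrix a b ℝ, (L * (X * Bᵀ)).trace = (Bᵀ * (L * X)).trace := fun X => by
    rw [← Matrix.mul_assoc, trace_mul_comm]
  have h3 : (Q * (H * (P * Kᵀ))).trace = (Q * (K * (P * Hᵀ))).trace := by
    rw [← trace_transpose, trace_mul_comm]
    simp only [transpose_mul, transpose_transpose, hQ, hP, Matrix.mul_assoc]
  have h4 : (Q * (K * (P * Kᵀ))).trace = (Kᵀ * (Q * (K * P))).trace := by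
    rw [← trace_mul_comm _ Kᵀ]
    simp only [Matrix.mul_assoc]
  have h5 : ∀ X : Matrix b a ℝ, (Xᵀ * H).trace = (X * Hᵀ).trace := fun X => by
    rw [← trace_transpose, transpose_mul, transpose_transpose, trace_mul_comm]
  have h6 : (Bᵀ * (L * (B * V))).trace = (V * (Bᵀ * (L * B))).trace := by
    rw [trace_mul_comm V]
    simp only [Matrix.mul_assoc]
  rw [h5]
  have e1 := h2 (F * (P * Hᵀ))
  have e2 := h2 (B * (H * (P * Hᵀ)))
  have e3 := h2 (B * V)
  simp only [Matrix.mul_assoc] at e1 e2 e3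
  simp only [Matrix.mul_add, Matrix.add_mul, transpose_add, transpose_mul, Matrix.smul_mul,
    Matrix.mul_smul, smul_add, trace_add, trace_smul, smul_eq_mul, Matrix.mul_assoc, h1, h3, h4,
    e1, e2, e3, h6, trace_mul_comm Q V]
  ring

variable {S K} in
-- Performance difference: the cost-to-go of `K` is tested on the covariances of `K'`. The first two
-- terms do not involve `K'`, and the last one carries an explicit factor `K' - K`.
theorem IsCostToGo.objective_eq {Λ : ℕ → Matrix (Fin n) (Fin n) ℝ} (hΛ : S.IsCostToGo K T Λ)
    (hγ : S.gamma ≠ 0) (h0 : S.Sigma0.PosSemidef) (hQs : S.Qsᵀ = S.Qs) (hQa : S.Qaᵀ = S.Qa)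
    (K' : Matrix (Fin m) (Fin n) ℝ) (ℓ : EuclideanSpace ℝ (Fin m)) :
    S.objective K' ℓ T =
      -((Λ 0 * S.Sigma0).trace - S.gamma⁻¹ * (S.Qs * S.Sigma0).trace)
      - ∑ t ∈ Finset.range T, S.gamma ^ t *
          (policyCov ℓ * (S.Qa + S.gamma • (S.Bᵀ * Λ (t + 1) * S.B))).trace
      - ∑ t ∈ Finset.range T, S.gamma ^ t *
          (((2 : ℝ) • (S.Qa * K * S.stateCov K' ℓ T t
              + S.gamma • (S.Bᵀ * Λ (t + 1) * S.F K * S.stateCov K' ℓ T t))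
            + (S.Qa + S.gamma • (S.Bᵀ * Λ (t + 1) * S.B)) * (K' - K)
              * S.stateCov K' ℓ T t)ᵀ * (K' - K)).trace := by
  obtain ⟨H, rfl⟩ : ∃ H, K' = K + H := ⟨K' - K, by abel⟩
  rw [add_sub_cancel_left]
  have hF : S.F (K + H) = S.F K + S.B * H := by rw [F, F, Matrix.mul_add, add_assoc]
  set P := S.stateCov (K + H) ℓ T with hP
  -- The covariances follow the closed loop of `K + H`; relative to that of `K`, the mismatch `B H`
  -- is moved into the source term.
  have hd := hΛ.sum_trace_eq hγ (Y := P) (N := fun t => S.B * H * P t * (S.F K)ᵀ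
    + S.F K * P t * (S.B * H)ᵀ + S.B * H * P t * (S.B * H)ᵀ + S.B * policyCov ℓ * S.Bᵀ)
    (fun t ht => by
      rw [hP, S.stateCov_succ _ ℓ ht, hF]
      simp only [transpose_add, Matrix.mul_add, Matrix.add_mul]
      abel)
  have hP0 : P 0 = S.Sigma0 := S.stateCov_zero _ ℓ h0
  rw [hP0] at hd
  rw [LQG.objective_eq, ← hP]
  have hsum : ∑ t ∈ Finset.range T, S.gamma ^ t * ((S.Qs * P (t + 1)).trace
        + (S.Qa * ((K + H) * P t * (K + H)ᵀ + policyCov ℓ)).trace) =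
      (Λ 0 * S.Sigma0).trace - S.gamma⁻¹ * (S.Qs * S.Sigma0).trace
      + ∑ t ∈ Finset.range T, S.gamma ^ t *
          (policyCov ℓ * (S.Qa + S.gamma • (S.Bᵀ * Λ (t + 1) * S.B))).trace
      + ∑ t ∈ Finset.range T, S.gamma ^ t *
          (((2 : ℝ) • (S.Qa * K * P t + S.gamma • (S.Bᵀ * Λ (t + 1) * S.F K * P t))
            + (S.Qa + S.gamma • (S.Bᵀ * Λ (t + 1) * S.B)) * H * P t)ᵀ * H).trace := by
    have hz : ∀ t ∈ Finset.range T, S.gamma ^ t * ((S.Qs * P (t + 1)).trace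
          + (S.Qa * ((K + H) * P t * (K + H)ᵀ + policyCov ℓ)).trace)
        + S.gamma ^ (t + 1) * (Λ (t + 1) * (S.B * H * P t * (S.F K)ᵀ
          + S.F K * P t * (S.B * H)ᵀ + S.B * H * P t * (S.B * H)ᵀ
          + S.B * policyCov ℓ * S.Bᵀ)).trace =
        S.gamma ^ t * ((S.Qs * P (t + 1)).trace + (Kᵀ * S.Qa * K * P t).trace)
        + S.gamma ^ t * (policyCov ℓ * (S.Qa + S.gamma • (S.Bᵀ * Λ (t + 1) * S.B))).trace
        + S.gamma ^ t *
          (((2 : ℝ) • (S.Qa * K * P t + S.gamma • (S.Bᵀ * Λ (t + 1) * S.F K * P t))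
            + (S.Qa + S.gamma • (S.Bᵀ * Λ (t + 1) * S.B)) * H * P t)ᵀ * H).trace := by
      intro t ht
      have := trace_perturbation hQa
        (hΛ.transpose_eq hQs hQa (Nat.succ_le_of_lt (Finset.mem_range.1 ht)))
        (S.stateCov_transpose (T := T) (K + H) ℓ t) K H (S.F K) S.B (policyCov ℓ) S.gamma
      linear_combination S.gamma ^ t * this
    have hz := Finset.sum_congr rfl hz
    simp only [Finset.sum_add_distrib] at hz
    linear_combination hz + hd
  rw [hsum]
  ring

theorem hasMatGradientAt_objective {Λ : ℕ → Matrix (Fin n) (Fin n) ℝ} (hΛ : S.IsCostToGo K T Λ)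
    (hγ : S.gamma ≠ 0) (h0 : S.Sigma0.PosSemidef) (hQs : S.Qsᵀ = S.Qs) (hQa : S.Qaᵀ = S.Qa) :
    HasMatGradientAt (fun K' => S.objective K' ℓ T)
      ((-2 : ℝ) • ∑ t : Fin T, S.gamma ^ (t : ℕ) • (S.Qa * K * S.stateCov K ℓ T t
        + S.gamma • (S.Bᵀ * Λ (t + 1) * S.F K * S.stateCov K ℓ T t))) K := by
  have h := hasMatGradientAt_of_sub_eq (f := fun K' => S.objective K' ℓ T) (K := K)
    (g := fun K' => -∑ t : Fin T, S.gamma ^ (t : ℕ) •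
      ((2 : ℝ) • (S.Qa * K * S.stateCov K' ℓ T t
          + S.gamma • (S.Bᵀ * Λ (t + 1) * S.F K * S.stateCov K' ℓ T t))
        + (S.Qa + S.gamma • (S.Bᵀ * Λ (t + 1) * S.B)) * (K' - K) * S.stateCov K' ℓ T t))
    (fun K' => by
      simp only [hΛ.objective_eq hγ h0 hQs hQa, sub_self, Matrix.mul_zero, trace_zero, mul_zero,
        Finset.sum_const_zero, sub_zero, Finset.sum_range]
      rw [sub_sub_cancel_left, transpose_neg, Matrix.neg_mul, trace_neg, transpose_sum,
        Matrix.sum_mul, trace_sum]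
      simp only [transpose_smul, Matrix.smul_mul, trace_smul, smul_eq_mul])
    (fun i j => by
      have hc := fun t : Fin T => S.continuous_stateCov ℓ h0 t.2.le
      refine Continuous.matrix_elem ?_ i j
      fun_prop)
  refine Eq.subst (motive := fun G => HasMatGradientAt _ G K) ?_ h
  simp only [sub_self, Matrix.mul_zero, Matrix.zero_mul, add_zero, Finset.smul_sum, neg_smul,
    ← Finset.sum_neg_distrib]
  exact Finset.sum_congr rfl fun t _ => by rw [smul_comm]

theorem trace_policyCov_mul (M : Matrix (Fin m) (Fin m) ℝ) :
    (policyCov ℓ * M).trace = ∑ i, Real.exp (2 * ℓ i) * M i i := by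
  simp [trace, policyCov, diagonal_mul]

/-- At `K' = K` the performance-difference formula leaves a constant minus the trace of `Σ` against
a matrix independent of `ℓ`, which is a sum of functions of the single coordinates. -/
theorem hasGradientAt_objective {Λ : ℕ → Matrix (Fin n) (Fin n) ℝ} (hΛ : S.IsCostToGo K T Λ)
    (hγ : S.gamma ≠ 0) (h0 : S.Sigma0.PosSemidef) (hQs : S.Qsᵀ = S.Qs) (hQa : S.Qaᵀ = S.Qa) :
    HasGradientAt (fun ℓ' => S.objective K ℓ' T)
      (WithLp.toLp 2 ((-2 : ℝ) • (policyCov ℓ * ∑ t : Fin T, S.gamma ^ (t : ℕ) •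
          (S.Qa + S.gamma • (S.Bᵀ * Λ (t + 1) * S.B))).diag)) ℓ := by
  set b : Matrix (Fin m) (Fin m) ℝ := ∑ t : Fin T, S.gamma ^ (t : ℕ) •
          (S.Qa + S.gamma • (S.Bᵀ * Λ (t + 1) * S.B)) with hb
  have h := hasGradientAt_sum_coord (x := ℓ) (φ := fun i y => -(b i i) * Real.exp (2 * y))
    (φ' := (-2 : ℝ) • (policyCov ℓ * b).diag) (fun i => by
      have h1 : HasDerivAt (fun y : ℝ => 2 * y) (2 * 1) (ℓ i) := (hasDerivAt_id (ℓ i)).const_mul 2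
      refine (h1.exp.const_mul (-(b i i))).congr_deriv ?_
      simp only [policyCov, Pi.smul_apply, diag_apply, diagonal_mul, smul_eq_mul]
      ring)
  have h3 := (hasGradientAt_iff_hasFDerivAt.1 h).const_add
    (-((Λ 0 * S.Sigma0).trace - S.gamma⁻¹ * (S.Qs * S.Sigma0).trace))
  refine hasGradientAt_iff_hasFDerivAt.2 (h3.congr_of_eventuallyEq
    (Filter.Eventually.of_forall fun ℓ' => ?_))
  simp only [hΛ.objective_eq hγ h0 hQs hQa, sub_self, Matrix.mul_zero, trace_zero, mul_zero,
        Finset.sum_const_zero, sub_zero, Finset.sum_range]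
  have : ∑ t : Fin T, S.gamma ^ (t : ℕ) *
      (policyCov ℓ' * (S.Qa + S.gamma • (S.Bᵀ * Λ (t + 1) * S.B))).trace =
      (policyCov ℓ' * b).trace := by
    rw [hb, Matrix.mul_sum, trace_sum]
    exact Finset.sum_congr rfl fun t _ => by rw [Matrix.mul_smul, trace_smul, smul_eq_mul]
  rw [this, trace_policyCov_mul, sub_eq_add_neg, ← Finset.sum_neg_distrib]
  congr 1
  exact Finset.sum_congr rfl fun i _ => by ring

/-! ### Means of the estimators -/

variable {S K} in
/-- Discounted pairing of the sensitivity of the trajectory at `(t, i)` with a vector process that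
follows the closed-loop dynamics from time `t` on. -/
theorem IsCostToGo.sum_sens_eq {Λ : ℕ → Matrix (Fin n) (Fin n) ℝ} (hΛ : S.IsCostToGo K T Λ)
    (hγ : S.gamma ≠ 0) (t : Fin T) (i : Fin m) {c : ℕ → Fin n → ℝ}
    (hc : ∀ p, (t : ℕ) < p → c (p + 1) = S.F K *ᵥ c p) :
    ∑ p : Fin T, S.gamma ^ (p : ℕ) * (c (p + 1) ⬝ᵥ S.Qs *ᵥ S.stateSens K t i (p + 1)
      + (K *ᵥ c p) ⬝ᵥ S.Qa *ᵥ (K *ᵥ S.stateSens K t i p)) =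
    S.gamma ^ ((t : ℕ) + 1) * (c (t + 1) ⬝ᵥ Λ (t + 1) *ᵥ (S.B *ᵥ Pi.single i 1)) := by
  -- The rank-one process is zero up to time `t` and then moves by `F` on both sides, so its only
  -- source is the injection at time `t`.
  have hY := hΛ.sum_trace_eq hγ (Y := fun p => vecMulVec (S.stateSens K t i p) (c p))
    (N := fun p => if p = t then vecMulVec (S.B *ᵥ Pi.single i 1) (c (t + 1)) else 0)
    (fun p _ => by
      rcases lt_trichotomy p t with h | h | h
      · simp [S.stateSens_of_le K i h.le, S.stateSens_of_le K i (Nat.succ_le_of_lt h), h.ne]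
      · subst h
        rw [stateSens, S.stateSens_of_le K i le_rfl]
        simp
      · rw [stateSens, if_neg h.ne', if_neg h.ne', add_zero, add_zero, hc p h, mul_vecMulVec,
          vecMulVec_mul, vecMul_transpose])
  have hN : ∑ p ∈ Finset.range T, S.gamma ^ (p + 1) * (Λ (p + 1) *
      if p = t then vecMulVec (S.B *ᵥ Pi.single i 1) (c (t + 1)) else 0).trace =
      S.gamma ^ ((t : ℕ) + 1) *
        (Λ (t + 1) * vecMulVec (S.B *ᵥ Pi.single i 1) (c (t + 1))).trace := by
    rw [Finset.sum_eq_single_of_mem (t : ℕ) (Finset.mem_range.2 t.2)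
      (fun p _ hp => by rw [if_neg hp, Matrix.mul_zero, trace_zero, mul_zero]), if_pos rfl]
  rw [hN] at hY
  have h0 : S.stateSens K t i 0 = 0 := rfl
  have e : ∀ {d : ℕ} (M : Matrix (Fin d) (Fin d) ℝ) (u v : Fin d → ℝ),
      (M * vecMulVec u v).trace = v ⬝ᵥ M *ᵥ u := by
    intro d M u v
    rw [mul_vecMulVec, trace_vecMulVec, dotProduct_comm]
  simp only [h0, zero_vecMulVec, trace_zero, mul_zero, sub_zero, zero_add, e,
    Finset.sum_range] at hY
  rw [← hY]
  refine Finset.sum_congr rfl fun p _ => ?_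
  simp only [mulVec_dotProduct, mulVec_mulVec, Matrix.mul_assoc]

variable {S K} in
-- Before `t` the sensitivities vanish and after `t` both actions are pure feedback. Replacing
-- feedback by true actions therefore changes only the term at `t`, where the action sensitivity is
-- a unit vector.
theorem IsCostToGo.sum_sens_action_eq {Λ : ℕ → Matrix (Fin n) (Fin n) ℝ}
    (hΛ : S.IsCostToGo K T Λ) (hγ : S.gamma ≠ 0) (t : Fin T) (i : Fin m) {c : ℕ → Fin n → ℝ}
    {u : ℕ → Fin m → ℝ} (hc : ∀ p, (t : ℕ) < p → c (p + 1) = S.F K *ᵥ c p)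
    (hu : ∀ p, (t : ℕ) < p → u p = K *ᵥ c p) :
    ∑ p : Fin T, S.gamma ^ (p : ℕ) * (c (p + 1) ⬝ᵥ S.Qs *ᵥ S.stateSens K t i (p + 1)
      + u p ⬝ᵥ S.Qa *ᵥ S.actionSens K t i p) =
    S.gamma ^ (t : ℕ) * (u t ⬝ᵥ S.Qa *ᵥ Pi.single i 1
      + S.gamma * (c (t + 1) ⬝ᵥ Λ (t + 1) *ᵥ (S.B *ᵥ Pi.single i 1))) := by
  have h := hΛ.sum_sens_eq hγ t i hc
  rw [mul_add, ← mul_assoc, ← pow_succ, ← h, ← sub_eq_iff_eq_add, ← Finset.sum_sub_distrib,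
    Finset.sum_eq_single t]
  · rw [actionSens, S.stateSens_of_le K i le_rfl, if_pos rfl]
    simp only [mulVec_zero, zero_add, dotProduct_zero, add_zero]
    ring
  · intro p _ hp
    rcases lt_or_gt_of_ne hp with h | h
    · rw [actionSens, S.stateSens_of_le K i (Fin.lt_def.1 h).le,
        if_neg (Fin.lt_def.1 h).ne]
      simp
    · rw [actionSens, hu p (Fin.lt_def.1 h), if_neg (Fin.lt_def.1 h).ne', add_zero, sub_self]
  · simp

theorem dinv_mul_exp (i : Fin m) : dinv ℓ i * Real.exp (2 * ℓ i) = 1 := by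
  simp [dinv, policyCov_inv, ← Real.exp_add]

theorem integral_mul_dotProduct_const {d : ℕ} {x : Sample n m T → Fin d → ℝ}
    (hx : ∀ k, AllLp (fun ω => x ω k) (S.law ℓ T)) (y : Fin d → ℝ) {t : ℕ} (j : Fin n) :
    ∫ ω, S.state K ω t j * (x ω ⬝ᵥ y) ∂(S.law ℓ T) =
      (fun k => crossMoment (S.law ℓ T) x (fun ω => S.state K ω t) k j) ⬝ᵥ y := by
  simp only [dotProduct, crossMoment, of_apply, Finset.mul_sum]
  rw [integral_finsetSum _ fun k _ =>
    ((S.allLp_state K ℓ t j).mul ((hx k).mul (AllLp.const (y k)))).integrable]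
  refine Finset.sum_congr rfl fun k _ => ?_
  rw [← integral_mul_const]
  exact integral_congr_ae (Filter.Eventually.of_forall fun ω => by ring)

theorem integral_state_mul_retSens (t : ℕ) (i : Fin m) (j : Fin n) :
    ∫ ω : Sample n m T, S.state K ω t j * S.retSens K t i ω ∂(S.law ℓ T) =
      -2 * ∑ p : Fin T, S.gamma ^ (p : ℕ) *
        ((fun k => crossMoment (S.law ℓ T) (fun ω => S.state K ω (p + 1))
            (fun ω => S.state K ω t) k j) ⬝ᵥ S.Qs *ᵥ S.stateSens K t i (p + 1)
          + (fun k => crossMoment (S.law ℓ T) (fun ω => S.action K ω p)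
            (fun ω => S.state K ω t) k j) ⬝ᵥ S.Qa *ᵥ S.actionSens K t i p) := by
  have hd : ∀ {d : ℕ} {x : Sample n m T → Fin d → ℝ}, (∀ k, AllLp (fun ω => x ω k) (S.law ℓ T)) →
      ∀ y : Fin d → ℝ, Integrable (fun ω => S.state K ω t j * (x ω ⬝ᵥ y)) (S.law ℓ T) :=
    fun hx y => ((S.allLp_state K ℓ t j).mul
      (AllLp.dotProduct (g := fun _ => y) hx fun k => AllLp.const (y k))).integrable
  have e : ∀ ω : Sample n m T, S.state K ω t j * S.retSens K t i ω =
      ∑ p : Fin T, (-2 * S.gamma ^ (p : ℕ)) *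
        (S.state K ω t j * (S.state K ω (p + 1) ⬝ᵥ S.Qs *ᵥ S.stateSens K t i (p + 1))
          + S.state K ω t j * (S.action K ω p ⬝ᵥ S.Qa *ᵥ S.actionSens K t i p)) := by
    intro ω
    rw [retSens, Finset.mul_sum]
    exact Finset.sum_congr rfl fun p _ => by ring
  have hI : ∀ p : Fin T, Integrable (fun ω => (-2 * S.gamma ^ (p : ℕ)) *
        (S.state K ω t j * (S.state K ω (p + 1) ⬝ᵥ S.Qs *ᵥ S.stateSens K t i (p + 1))
          + S.state K ω t j * (S.action K ω p ⬝ᵥ S.Qa *ᵥ S.actionSens K t i p))) (S.law ℓ T) :=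
    fun p => ((hd (S.allLp_state K ℓ _) _).add (hd (S.allLp_action K ℓ _) _)).const_mul _
  simp only [e]
  rw [integral_finsetSum _ fun p _ => hI p, Finset.mul_sum]
  refine Finset.sum_congr rfl fun p _ => ?_
  rw [integral_const_mul, integral_add (hd (S.allLp_state K ℓ _) _) (hd (S.allLp_action K ℓ _) _),
    S.integral_mul_dotProduct_const K ℓ (S.allLp_state K ℓ _),
    S.integral_mul_dotProduct_const K ℓ (S.allLp_action K ℓ _), mul_assoc]

/-- After integration by parts the variance cancels `d_i` and causality kills the derivative of
`s_t`. What is left pairs the sensitivities with correlations `E[s_p s_tᵀ]`, which evolve by `F` for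
`p ≥ t`. -/
theorem integral_estK {Λ : ℕ → Matrix (Fin n) (Fin n) ℝ} (hΛ : S.IsCostToGo K T Λ)
    (hγ : S.gamma ≠ 0) (hQs : S.Qsᵀ = S.Qs) (hQa : S.Qaᵀ = S.Qa) (i : Fin m) (j : Fin n) :
    ∫ ω : Sample n m T, S.estK K ℓ ω i j ∂(S.law ℓ T) =
      ((-2 : ℝ) • ∑ t : Fin T, S.gamma ^ (t : ℕ) • (S.Qa * K * S.stateCov K ℓ T t
        + S.gamma • (S.Bᵀ * Λ (t + 1) * S.F K * S.stateCov K ℓ T t))) i j := by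
  have hI : ∀ t : Fin T, Integrable (fun ω : Sample n m T =>
      dinv ℓ i * (noise ω t i * (S.state K ω t j * S.ret K ω))) (S.law ℓ T) :=
    fun t => (((S.allLp_noise ℓ t i).mul
      ((S.allLp_state K ℓ t j).mul (S.allLp_ret K ℓ))).const_mul _).integrable
  simp only [estK_apply]
  rw [integral_finsetSum _ fun t _ => hI t,
    Matrix.smul_apply, Matrix.sum_apply, Finset.smul_sum]
  refine Finset.sum_congr rfl fun t _ => ?_
  have hL0 : AllLp (fun _ : Sample n m T => S.stateSens K t i t j) (S.law ℓ T) := AllLp.const _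
  rw [integral_const_mul, S.integral_noise_mul ℓ t i ((S.allLp_state K ℓ t j).mul (S.allLp_ret K ℓ))
    ((hL0.mul (S.allLp_ret K ℓ)).add ((S.allLp_state K ℓ t j).mul (S.allLp_retSens K ℓ t i)))
    ((S.hasNoiseDeriv_state K t i t j).mul (S.hasNoiseDeriv_ret K hQs hQa t i)), ← mul_assoc,
    dinv_mul_exp, one_mul, S.stateSens_of_le K i le_rfl]
  simp only [Pi.zero_apply, zero_mul, zero_add]
  rw [integral_state_mul_retSens]
  have hstep : ∀ p, (t : ℕ) ≤ p →
      crossMoment (S.law ℓ T) (fun ω => S.state K ω (p + 1)) (fun ω => S.state K ω t) =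
        S.F K * crossMoment (S.law ℓ T) (fun ω => S.state K ω p) (fun ω => S.state K ω t) := by
    intro p hp
    rw [S.crossMoment_state_succ K ℓ p (S.allLp_state K ℓ t), S.crossMoment_noise_state K ℓ hp,
      Matrix.mul_zero, add_zero]
  have hact : ∀ p, (t : ℕ) ≤ p →
      crossMoment (S.law ℓ T) (fun ω => S.action K ω p) (fun ω => S.state K ω t) =
        K * crossMoment (S.law ℓ T) (fun ω => S.state K ω p) (fun ω => S.state K ω t) := by
    intro p hp
    rw [S.crossMoment_action K ℓ p (S.allLp_state K ℓ t), S.crossMoment_noise_state K ℓ hp,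
      add_zero]
  have hcol : ∀ {a : ℕ} (M : Matrix (Fin a) (Fin n) ℝ) (N : Matrix (Fin n) (Fin n) ℝ),
      (fun k => (M * N) k j) = M *ᵥ fun k => N k j := fun M N => rfl
  -- The vector process is the `j`-th column of the correlations of states and actions with `s_t`.
  rw [hΛ.sum_sens_action_eq hγ t i
    (c := fun p k => crossMoment (S.law ℓ T) (fun ω => S.state K ω p)
      (fun ω => S.state K ω t) k j)
    (u := fun p k => crossMoment (S.law ℓ T) (fun ω => S.action K ω p)
      (fun ω => S.state K ω t) k j)
    (fun p hp => by rw [hstep p hp.le]; exact hcol _ _)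
    (fun p hp => by rw [hact p hp.le]; exact hcol _ _)]
  simp only [hstep t le_rfl, hact t le_rfl, ← stateCov_eq_crossMoment]
  have hΛt := hΛ.transpose_eq hQs hQa (Nat.succ_le_of_lt t.2)
  have h1 : (fun k => (K * S.stateCov K ℓ T t) k j) ⬝ᵥ S.Qa *ᵥ Pi.single i 1 =
      (S.Qa * K * S.stateCov K ℓ T t) i j := by
    rw [dotProduct_mulVec_swap, hQa, single_one_dotProduct, Matrix.mul_assoc]
    rfl
  have h2 : (fun k => (S.F K * S.stateCov K ℓ T t) k j) ⬝ᵥ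
        Λ (t + 1) *ᵥ (S.B *ᵥ Pi.single i 1) =
      (S.Bᵀ * Λ (t + 1) * S.F K * S.stateCov K ℓ T t) i j := by
    rw [mulVec_mulVec, dotProduct_mulVec_swap, transpose_mul, hΛt, single_one_dotProduct,
      Matrix.mul_assoc _ (S.F K)]
    rfl
  rw [h1, h2]
  simp only [Matrix.smul_apply, Matrix.add_apply, smul_eq_mul]

/-- Two integrations by parts. In the first, the derivative of the remaining noise factor reproduces
`E[R]`, which the `-1` in the score removes; the second yields the constant second derivative of
`R`. -/
theorem integral_estL {Λ : ℕ → Matrix (Fin n) (Fin n) ℝ} (hΛ : S.IsCostToGo K T Λ)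
    (hγ : S.gamma ≠ 0) (hQs : S.Qsᵀ = S.Qs) (hQa : S.Qaᵀ = S.Qa) (i : Fin m) :
    ∫ ω : Sample n m T, S.estL K ℓ ω i ∂(S.law ℓ T) =
      (-2 : ℝ) * (Real.exp (2 * ℓ i) * ∑ t : Fin T, S.gamma ^ (t : ℕ) *
          (S.Qa + S.gamma • (S.Bᵀ * Λ (t + 1) * S.B)) i i) := by
  have hR := S.allLp_ret (T := T) K ℓ
  have hI := fun t : Fin T => (((S.allLp_noise ℓ t i).mul ((S.allLp_noise ℓ t i).mul hR)).const_mul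
    (dinv ℓ i)).integrable
  have e : ∀ (t : Fin T) (ω : Sample n m T), (dinv ℓ i * noise ω t i ^ 2 - 1) * S.ret K ω =
      dinv ℓ i * (noise ω t i * (noise ω t i * S.ret K ω)) - S.ret K ω :=
    fun t ω => by ring
  have hI' : ∀ t : Fin T, Integrable (fun ω : Sample n m T =>
      dinv ℓ i * (noise ω t i * (noise ω t i * S.ret K ω)) - S.ret K ω) (S.law ℓ T) :=
    fun t => (hI t).sub hR.integrable
  simp only [estL_apply, e]
  rw [integral_finsetSum _ fun t _ => hI' t, Finset.mul_sum, Finset.mul_sum]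
  refine Finset.sum_congr rfl fun t _ => ?_
  have hn := (hasNoiseDeriv_noise (n := n) (t, i) t i)
  simp only [if_pos, Pi.single_eq_same] at hn
  have hL1 : AllLp (fun _ : Sample n m T => (1 : ℝ)) (S.law ℓ T) := AllLp.const 1
  rw [integral_sub (hI t) hR.integrable, integral_const_mul,
    S.integral_noise_mul ℓ t i ((S.allLp_noise ℓ t i).mul hR)
      ((hL1.mul hR).add ((S.allLp_noise ℓ t i).mul (S.allLp_retSens K ℓ t i)))
      (hn.mul (S.hasNoiseDeriv_ret K hQs hQa t i)), ← mul_assoc, dinv_mul_exp,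
    integral_add (hL1.mul hR).integrable
      ((S.allLp_noise ℓ t i).mul (S.allLp_retSens K ℓ t i)).integrable,
    S.integral_noise_mul ℓ t i (S.allLp_retSens K ℓ t i) (AllLp.const _)
      (S.hasNoiseDeriv_retSens K t i)]
  -- The second derivative pairs the sensitivity with itself, and the sensitivity too follows the
  -- closed loop after `t`.
  have h := hΛ.sum_sens_action_eq hγ t i (c := S.stateSens K t i) (u := S.actionSens K t i)
    (fun p hp => by rw [stateSens, if_neg hp.ne', add_zero])
    (fun p hp => by rw [actionSens, if_neg hp.ne', add_zero])
  rw [actionSens, if_pos rfl, stateSens, if_pos rfl, S.stateSens_of_le K i le_rfl] at h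
  have h' : ∑ p : Fin T, S.gamma ^ (p : ℕ) *
      (-2 * (S.stateSens K t i (p + 1) ⬝ᵥ S.Qs *ᵥ S.stateSens K t i (p + 1)
        + S.actionSens K t i p ⬝ᵥ S.Qa *ᵥ S.actionSens K t i p)) =
      -2 * (S.gamma ^ (t : ℕ) * (S.Qa + S.gamma • (S.Bᵀ * Λ (t + 1) * S.B)) i i) := by
    have h1 : (Pi.single i 1 : Fin m → ℝ) ⬝ᵥ S.Qa *ᵥ Pi.single i 1 = S.Qa i i := by simp
    have h2 : (S.B *ᵥ Pi.single i 1) ⬝ᵥ Λ (t + 1) *ᵥ (S.B *ᵥ Pi.single i 1) =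
        (S.Bᵀ * Λ (t + 1) * S.B) i i := by
      rw [mulVec_dotProduct, mulVec_mulVec, mulVec_mulVec]
      simp
    simp only [mulVec_zero, zero_add, h1, h2] at h
    simp only [Matrix.add_apply, Matrix.smul_apply, smul_eq_mul]
    rw [← h, Finset.mul_sum]
    exact Finset.sum_congr rfl fun p _ => by ring
  rw [h']
  simp only [one_mul, integral_const, probReal_univ, one_smul]
  ring

end LQG

/-! ### Integrability of the squared norms, and the theorem -/

namespace LQG

variable {n m T : ℕ} (S : LQG n m) (K : Matrix (Fin m) (Fin n) ℝ) (ℓ : EuclideanSpace ℝ (Fin m))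

theorem integrable_frobSq_estK :
    Integrable (fun ω : Sample n m T => frobSq (S.estK K ℓ ω)) (S.law ℓ T) :=
  (AllLp.sum _ fun i _ => AllLp.sum _ fun j _ => (S.allLp_estK K ℓ i j).pow 2).integrable

theorem integrable_norm_sq_estL :
    Integrable (fun ω : Sample n m T => ‖S.estL K ℓ ω‖ ^ 2) (S.law ℓ T) := by
  simp only [EuclideanSpace.real_norm_sq_eq]
  exact (AllLp.sum _ fun i _ => (S.allLp_estL K ℓ i).pow 2).integrable

end LQG

theorem mainTheorem2 {n m : ℕ} (T : ℕ) (S : LQG n m)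
    (hQs : S.Qs.PosSemidef) (hQa : S.Qa.PosSemidef) (hSigma0 : S.Sigma0.PosSemidef)
    (hgamma : 0 < S.gamma)
    (K : Matrix (Fin m) (Fin n) ℝ) (ℓ : EuclideanSpace ℝ (Fin m)) :
    -- lifted representation
    (∀ ω : Sample n m T,
      S.stackState K ω = S.FS K T *ᵥ ω.1.ofLp + S.FE K T *ᵥ LQG.stackNoise ω ∧
      S.stackNext K ω = S.FSnext K T *ᵥ ω.1.ofLp + S.FEnext K T *ᵥ LQG.stackNoise ω ∧
      S.stackAction K ω = S.KS K T *ᵥ ω.1.ofLp + S.KE K T *ᵥ LQG.stackNoise ω ∧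
      S.ret K ω = -(ω.1.ofLp ⬝ᵥ (S.Mss K T *ᵥ ω.1.ofLp)
        + 2 * (ω.1.ofLp ⬝ᵥ (S.Mse K T *ᵥ LQG.stackNoise ω))
        + LQG.stackNoise ω ⬝ᵥ (S.Mee K T *ᵥ LQG.stackNoise ω))) ∧
    -- second moments
    Integrable (fun ω : Sample n m T => frobSq (S.estK K ℓ ω)) (S.law ℓ T) ∧
    ∫ ω : Sample n m T, frobSq (S.estK K ℓ ω) ∂(S.law ℓ T) =
      ∑ t : Fin T, ∑ p : Fin T,
        (S.EK1 K ℓ t p + S.EK2 K ℓ t p + S.EK3 K ℓ t p + S.EK4 K ℓ t p + S.EK5 K ℓ t p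
          + S.EK6 K ℓ t p) ∧
    Integrable (fun ω : Sample n m T => ‖S.estL K ℓ ω‖ ^ 2) (S.law ℓ T) ∧
    ∫ ω : Sample n m T, ‖S.estL K ℓ ω‖ ^ 2 ∂(S.law ℓ T) =
      ∑ t : Fin T, ∑ p : Fin T,
        (S.EL1 K t p + S.EL2 K ℓ t p + S.EL3 K ℓ t p + S.EL4 K ℓ t p) ∧
    -- state covariances
    S.stateCov K ℓ T 0 = S.Sigma0 ∧
    (∀ t < T, S.stateCov K ℓ T (t + 1) =
      S.F K * S.stateCov K ℓ T t * (S.F K)ᵀ + S.B * policyCov ℓ * S.Bᵀ) ∧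
    -- mean gradients
    Integrable (fun ω : Sample n m T => S.ret K ω) (S.law ℓ T) ∧
    ∀ Λ : ℕ → Matrix (Fin n) (Fin n) ℝ,
      Λ T = (1 / S.gamma) • S.Qs →
      (∀ t, 1 ≤ t → t < T →
        Λ t = (1 / S.gamma) • S.Qs + Kᵀ * S.Qa * K
          + S.gamma • ((S.F K)ᵀ * Λ (t + 1) * S.F K)) →
      ∀ gradK : Matrix (Fin m) (Fin n) ℝ,
        gradK = (-2 : ℝ) • ∑ t : Fin T, S.gamma ^ (t : ℕ) •
          (S.Qa * K * S.stateCov K ℓ T t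
            + S.gamma • (S.Bᵀ * Λ (t + 1) * S.F K * S.stateCov K ℓ T t)) →
      ∀ gradL : EuclideanSpace ℝ (Fin m),
        gradL = WithLp.toLp 2 ((-2 : ℝ) • (policyCov ℓ * ∑ t : Fin T, S.gamma ^ (t : ℕ) •
          (S.Qa + S.gamma • (S.Bᵀ * Λ (t + 1) * S.B))).diag) →
      HasMatGradientAt (fun K' => S.objective K' ℓ T) gradK K ∧
      HasGradientAt (fun ℓ' => S.objective K ℓ' T) gradL ℓ ∧
      (∀ i j, Integrable (fun ω : Sample n m T => S.estK K ℓ ω i j) (S.law ℓ T) ∧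
        ∫ ω : Sample n m T, S.estK K ℓ ω i j ∂(S.law ℓ T) = gradK i j) ∧
      (∀ i, Integrable (fun ω : Sample n m T => S.estL K ℓ ω i) (S.law ℓ T) ∧
        ∫ ω : Sample n m T, S.estL K ℓ ω i ∂(S.law ℓ T) = gradL i) := by
  have hQs' : S.Qsᵀ = S.Qs := hQs.isHermitian
  have hQa' : S.Qaᵀ = S.Qa := hQa.isHermitian
  refine ⟨fun ω => ⟨S.stackState_eq K ω, S.stackNext_eq K ω, S.stackAction_eq K ω,
    S.ret_eq K hQs' hQa' ω⟩, S.integrable_frobSq_estK K ℓ, S.integral_frobSq_estK K ℓ hQs' hQa',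
    S.integrable_norm_sq_estL K ℓ, S.integral_norm_sq_estL K ℓ hQs' hQa',
    S.stateCov_zero K ℓ hSigma0, fun t ht => S.stateCov_succ K ℓ ht,
    (S.allLp_ret K ℓ).integrable, ?_⟩
  rintro Λ hT hstep gradK rfl gradL rfl
  -- The closed forms involve only `Λ (t + 1)`, so the sequence corrected at `0` may replace the
  -- given one.
  obtain ⟨Λ', hΛ', hΛ⟩ := LQG.exists_isCostToGo hT hstep
  simp only [← hΛ]
  refine ⟨S.hasMatGradientAt_objective K ℓ hΛ' hgamma.ne' hSigma0 hQs' hQa',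
    S.hasGradientAt_objective K ℓ hΛ' hgamma.ne' hSigma0 hQs' hQa',
    fun i j => ⟨(S.allLp_estK K ℓ i j).integrable,
      S.integral_estK K ℓ hΛ' hgamma.ne' hQs' hQa' i j⟩,
    fun i => ⟨(S.allLp_estL K ℓ i).integrable, ?_⟩⟩
  rw [S.integral_estL K ℓ hΛ' hgamma.ne' hQs' hQa' i]
  simp only [policyCov, Pi.smul_apply, diag_apply, diagonal_mul, smul_eq_mul, Matrix.sum_apply,
    Matrix.smul_apply]
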